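/- Let $K$ be an algebraically closed field of characteristic $0$, $V$ a finite-dimensional $K$-vector space, $G\subset GL(V)$ a finite group generated by (pseudo)reflections, and $L$ a normal subgroup of $G$; put $\bar G=G/L$. Let $S=S(V^*)$ be the graded algebra of polynomial functions on $V$, and let $\mathcal N_G,\mathcal N_L$ be the normalisers of $G,L$ in $GL(V)$. For a graded algebra $A$ write $A_+=\bigoplus_{i\ge1}A_i$. Let $E^*\subset S^L_+$ be a graded, $\mathcal N_L$-stable complement of $(S^L_+)^2$ in $S^L_+$, let $E$ be its dual (isomorphic to the tangent space of $V/L$ at $0$), and let $\bar S=S(E^*)$, graded so that the elements of $E^*$ keep their degrees in $S$. Let $\tau:\bar S\to S^L$ be the algebra homomorphism extending the inclusion of $E^*$. Denote by $S_G=S/(S^G_+)$ and $\bar S_{\bar G}=\bar S/(\bar S^{\bar G}_+)$ the algebras of coinvariants, where $(\cdot)$ denotes the ideal generated. Suppose that the image of $\bar G$ in $GL(E)$ is generated by (pseudo)reflections. (1) The homomorphism $\tau$ induces an isomorphism of graded algebras $\bar\tau:\bar S_{\bar G}\to(S_G)^L$ which commutes with the action of $\mathcal N_G\cap\mathcal N_L$.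 (2) For a reflection coset $H\gamma$ in $GL(W)$ (with $H\subset GL(W)$ a finite reflection group normalised by the semisimple element $\gamma$) and a finite-dimensional $\langle H,\gamma\rangle$-module $M$ on which $\gamma$ acts semisimply, let $\mathcal H\subset S(W^*)$ be the space of polynomials annihilated by all $H$-invariant constant-coefficient differential operators without constant term. The multiset of $M$-factors of $H\gamma$ is the multiset of eigenvalues of $\gamma$ on a homogeneous basis of $(\mathcal H\otimes M^*)^H$ consisting of $\gamma$-eigenvectors. Let $\gamma\in\mathcal N_G\cap\mathcal N_L$ be semisimple, let $\bar\gamma$ be its image in $(\mathcal N_G\cap\mathcal N_L)/L$, which acts on $E$, and let $M$ be a finite-dimensional $\langle\bar G,\bar\gamma\rangle$-module on which $\bar\gamma$ acts semisimply, regarded also as a $\langle G,\gamma\rangle$-module on which $L$ acts trivially. Then the multiset of $M$-factors of $\bar G\bar\gamma$ (acting on $E$) and that of $G\gamma$ (acting on $V$) are well defined and coincide. Moreover, when degrees in $\bar S$ are taken for the above grading, also the multisets of pairs (eigenvalue, degree) of such homogeneous eigenbases, for $\bar G\bar\gamma$ and for $G\gamma$, are well defined and coincide. -/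

import Mathlib

open scoped TensorProduct

noncomputable section

namespace ReflectionQuotient

universe u v w

/-! ### Reflection groups -/

section Reflections

variable {K : Type u} [Field K] {W : Type v} [AddCommGroup W] [Module K W]

/-- A (pseudo)reflection: an invertible `g` such that `g - 1` has rank one, that is, whose
fixed space is a hyperplane. -/
def IsPseudoReflection (g : LinearMap.GeneralLinearGroup K W) : Prop :=
  Module.finrank K (LinearMap.range ((g : W →ₗ[K] W) - LinearMap.id)) = 1

/-- A finite subgroup of `GL(W)` generated by the (pseudo)reflections it contains. -/
def IsReflectionGroup (H : Subgroup (LinearMap.GeneralLinearGroup K W)) : Prop :=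
  Finite H ∧ Subgroup.closure {g | g ∈ H ∧ IsPseudoReflection g} = H

end Reflections

/-! ### The symmetric algebra `S(X)` of a space `X` of linear forms with a group action -/

section Symmetric

variable {K : Type u} [Field K] {X : Type v} [AddCommGroup X] [Module K X]

variable (K X) in
/-- The homogeneous elements of degree `d` of `S(X)`, with `X` in degree one. -/
def symDegree (d : ℕ) : Submodule K (SymmetricAlgebra K X) :=
  (LinearMap.range (SymmetricAlgebra.ι K X)) ^ d

/-- The homogeneous elements of degree `d` of `S(X)` when `X` itself is graded, with homogeneous
parts `𝒳 i`: the span of the products of homogeneous elements of `X` of total degree `d`. -/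
def weightedDegree (𝒳 : ℕ → Submodule K X) (d : ℕ) : Submodule K (SymmetricAlgebra K X) :=
  Submodule.span K {f | ∃ (n : ℕ) (i : Fin n → ℕ) (x : Fin n → X),
    (∀ j, x j ∈ 𝒳 (i j)) ∧ ∑ j, i j = d ∧ f = ∏ j, SymmetricAlgebra.ι K X (x j)}

variable {A : Type w} [Group A] (σ : Representation K A X)

/-- The action of `a` on `S(X)` by the algebra endomorphism extending its action on `X`. -/
def symAct (a : A) : SymmetricAlgebra K X →ₐ[K] SymmetricAlgebra K X :=
  SymmetricAlgebra.lift (SymmetricAlgebra.ι K X ∘ₗ σ a)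

lemma symAct_mul (a b : A) : symAct σ (a * b) = (symAct σ a).comp (symAct σ b) := by
  apply SymmetricAlgebra.algHom_ext
  ext x
  simp [symAct]

lemma symAct_one : symAct σ 1 = AlgHom.id K _ := by
  apply SymmetricAlgebra.algHom_ext
  ext x
  simp [symAct]

lemma algebraMapInv_symAct (a : A) (f : SymmetricAlgebra K X) :
    SymmetricAlgebra.algebraMapInv (symAct σ a f) = SymmetricAlgebra.algebraMapInv f := by
  have h : (SymmetricAlgebra.algebraMapInv (R := K) (M := X)).comp (symAct σ a)
      = SymmetricAlgebra.algebraMapInv := by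
    apply SymmetricAlgebra.algHom_ext
    ext x
    simp [symAct, SymmetricAlgebra.algebraMapInv]
  exact DFunLike.congr_fun h f

/-- `S(X)` as a representation. -/
def symRep : Representation K A (SymmetricAlgebra K X) where
  toFun a := (symAct σ a).toLinearMap
  map_one' := by rw [symAct_one]; rfl
  map_mul' a b := by rw [symAct_mul]; rfl

/-- `S(X)^G_+`: the `G`-invariants without constant term. -/
def posInvariants (G : Subgroup A) : Submodule K (SymmetricAlgebra K X) where
  carrier := {f | (∀ g ∈ G, symAct σ g f = f) ∧ SymmetricAlgebra.algebraMapInv f = 0}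
  zero_mem' := by simp
  add_mem' := by
    rintro f f' ⟨h, h0⟩ ⟨h', h0'⟩
    exact ⟨fun g hg => by rw [map_add, h g hg, h' g hg], by rw [map_add, h0, h0', add_zero]⟩
  smul_mem' := by
    rintro c f ⟨h, h0⟩
    exact ⟨fun g hg => by rw [map_smul, h g hg], by rw [map_smul, h0, smul_zero]⟩

/-- The ideal of `S(X)` generated by the `G`-invariants without constant term. -/
def coinvariantIdeal (G : Subgroup A) : Ideal (SymmetricAlgebra K X) :=
  Ideal.span (posInvariants σ G : Set (SymmetricAlgebra K X))

/-- The algebra of coinvariants `S(X)_G`. -/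
abbrev Coinvariants (G : Subgroup A) : Type _ :=
  SymmetricAlgebra K X ⧸ coinvariantIdeal σ G

/-- The projection of `S(X)` onto `S(X)_G`. -/
def coinvariantMk (G : Subgroup A) : SymmetricAlgebra K X →ₐ[K] Coinvariants σ G :=
  Ideal.Quotient.mkₐ K (coinvariantIdeal σ G)

lemma symAct_mem_coinvariantIdeal (G : Subgroup A) [G.Normal] (a : A) :
    ∀ f ∈ coinvariantIdeal σ G, symAct σ a f ∈ coinvariantIdeal σ G := by
  intro f hf
  have hle : coinvariantIdeal σ G ≤ (coinvariantIdeal σ G).comap (symAct σ a) := by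
    refine Ideal.span_le.2 ?_
    rintro p ⟨hp, hp0⟩
    refine Ideal.subset_span ⟨fun g hg => ?_, ?_⟩
    · have hg' : a⁻¹ * g * a ∈ G := by
        simpa using Subgroup.Normal.conj_mem ‹G.Normal› g hg a⁻¹
      have e : g * a = a * (a⁻¹ * g * a) := by group
      calc symAct σ g (symAct σ a p) = symAct σ (g * a) p := by rw [symAct_mul]; rfl
        _ = symAct σ a (symAct σ (a⁻¹ * g * a) p) := by rw [e, symAct_mul]; rfl
        _ = symAct σ a p := by rw [hp _ hg']
    · exact (algebraMapInv_symAct σ a p).trans hp0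
  exact hle hf

/-- The action on `S(X)_G` of an element `a` of a group in which `G` is normal; it sends the class
of `f` to the class of `a • f`. -/
def coinvariantAct (G : Subgroup A) [G.Normal] (a : A) :
    Coinvariants σ G →ₐ[K] Coinvariants σ G :=
  Ideal.Quotient.liftₐ (coinvariantIdeal σ G) ((coinvariantMk σ G).comp (symAct σ a))
    (fun f hf => Ideal.Quotient.eq_zero_iff_mem.2 (symAct_mem_coinvariantIdeal σ G a f hf))

/-- The subalgebra `(S(X)_G)^L` of `L`-fixed elements of the algebra of coinvariants. -/
def fixedCoinvariants (G : Subgroup A) [G.Normal] (L : Subgroup A) :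
    Subalgebra K (Coinvariants σ G) where
  carrier := {x | ∀ l ∈ L, coinvariantAct σ G l x = x}
  mul_mem' := fun h h' l hl => by rw [map_mul, h l hl, h' l hl]
  add_mem' := fun h h' l hl => by rw [map_add, h l hl, h' l hl]
  algebraMap_mem' := fun r l _ => AlgHom.commutes _ r

/-- The grading of `S(X)_G` induced by a grading `𝒮` of `S(X)`. -/
def coinvariantDegree (𝒮 : ℕ → Submodule K (SymmetricAlgebra K X)) (G : Subgroup A) (d : ℕ) :
    Submodule K (Coinvariants σ G) :=
  (𝒮 d).map (coinvariantMk σ G).toLinearMap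

/-! ### Harmonic polynomials and `M`-factors -/

variable (K X) in
/-- The polynomial differential operators with constant coefficients on `S(X)`: the algebra of
operators generated by the derivations that send `X` to constants. -/
def constCoeffOperators : Subalgebra K (Module.End K (SymmetricAlgebra K X)) :=
  Algebra.adjoin K {T | ∃ D : Derivation K (SymmetricAlgebra K X) (SymmetricAlgebra K X),
    (∀ x : X, ∃ c : K, D (SymmetricAlgebra.ι K X x) = algebraMap K _ c) ∧
    T = (D : SymmetricAlgebra K X →ₗ[K] SymmetricAlgebra K X)}

/-- The `G`-harmonic polynomials: those annihilated by all `G`-invariant polynomial differential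
operators (with constant coefficients) without constant term. The constant term of such an
operator `T` is `T 1`, and `T` is invariant when it commutes with the action of `G`. -/
def harmonics (G : Subgroup A) : Submodule K (SymmetricAlgebra K X) where
  carrier := {f | ∀ T ∈ constCoeffOperators K X,
    (∀ g ∈ G, T ∘ₗ symRep σ g = symRep σ g ∘ₗ T) → T 1 = 0 → T f = 0}
  zero_mem' := fun T _ _ _ => map_zero T
  add_mem' := fun h h' T hT hG h1 => by rw [map_add, h T hT hG h1, h' T hT hG h1, add_zero]
  smul_mem' := fun c f h T hT hG h1 => by rw [map_smul, h T hT hG h1, smul_zero]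

variable {M : Type*} [AddCommGroup M] [Module K M]

/-- The subgroup `⟨G, γ⟩`. -/
abbrev cosetGroup (G : Subgroup A) (γ : A) : Subgroup A := G ⊔ Subgroup.zpowers γ

/-- The generator `γ` as an element of `⟨G, γ⟩`. -/
def cosetElt (G : Subgroup A) (γ : A) : cosetGroup G γ :=
  ⟨γ, (le_sup_right : Subgroup.zpowers γ ≤ _) (Subgroup.mem_zpowers γ)⟩

/-- The diagonal action of `⟨G, γ⟩` on `S(X) ⊗ M*`, where `M` is a `⟨G, γ⟩`-module. -/
def covariantRep (G : Subgroup A) (γ : A) (ρ : Representation K (cosetGroup G γ) M) :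
    Representation K (cosetGroup G γ) (SymmetricAlgebra K X ⊗[K] Module.Dual K M) :=
  Representation.tprod ((symRep σ).comp (cosetGroup G γ).subtype) ρ.dual

/-- The space `(ℋ ⊗ M*)^G`, inside `S(X) ⊗ M*`. -/
def harmonicCovariants (G : Subgroup A) (γ : A) (ρ : Representation K (cosetGroup G γ) M) :
    Submodule K (SymmetricAlgebra K X ⊗[K] Module.Dual K M) :=
  LinearMap.range ((harmonics σ G).subtype.rTensor (Module.Dual K M)) ⊓
    ⨅ g : cosetGroup G γ, ⨅ _ : (g : A) ∈ G,
      LinearMap.ker (covariantRep σ G γ ρ g - LinearMap.id)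

/-- `p` is the multiset of the pairs (eigenvalue `ε`, degree `m`) of a homogeneous basis
of `(ℋ ⊗ M*)^G` that consists of eigenvectors of `γ`. Degrees refer to the grading `𝒮` of
`S(X)`, and `M*` is in degree zero. -/
def IsFactorDegreePairs (𝒮 : ℕ → Submodule K (SymmetricAlgebra K X)) (G : Subgroup A) (γ : A)
    (ρ : Representation K (cosetGroup G γ) M) (p : Multiset (K × ℕ)) : Prop :=
  ∃ (n : ℕ) (b : Module.Basis (Fin n) K (harmonicCovariants σ G γ ρ)) (ε : Fin n → K)
    (m : Fin n → ℕ),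
    (∀ i, covariantRep σ G γ ρ (cosetElt G γ) (b i : SymmetricAlgebra K X ⊗[K] Module.Dual K M)
      = ε i • (b i : SymmetricAlgebra K X ⊗[K] Module.Dual K M)) ∧
    (∀ i, (b i : SymmetricAlgebra K X ⊗[K] Module.Dual K M) ∈
      LinearMap.range ((𝒮 (m i)).subtype.rTensor (Module.Dual K M))) ∧
    p = Finset.univ.val.map (fun i => (ε i, m i))

/-- `s` is the multiset of `M`-factors of the coset `Gγ` acting on the space of linear
forms `X`: the eigenvalues of `γ` on a homogeneous eigenbasis of `(ℋ ⊗ M*)^G`. -/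
def IsMFactors (G : Subgroup A) (γ : A) (ρ : Representation K (cosetGroup G γ) M)
    (s : Multiset K) : Prop :=
  ∃ p : Multiset (K × ℕ), IsFactorDegreePairs σ (symDegree K X) G γ ρ p ∧ s = p.map Prod.fst

end Symmetric

/-- The map `⟨G, γ⟩ → ⟨f(G), f(γ)⟩` induced by a group homomorphism `f`. -/
def cosetHom {A B : Type*} [Group A] [Group B] (f : A →* B) (G : Subgroup A) (γ : A) :
    cosetGroup G γ →* cosetGroup (G.map f) (f γ) :=
  (f.comp (cosetGroup G γ).subtype).codRestrict _ (fun x => by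
    have h : (cosetGroup G γ).map f = cosetGroup (G.map f) (f γ) := by
      rw [Subgroup.map_sup, MonoidHom.map_zpowers]
    rw [← h]
    exact Subgroup.mem_map_of_mem f x.2)

/-! ### The quotient `Ḡ = G/L` and its action on the tangent space `E` of `V/L` at `0` -/

section Quotient

variable {K : Type u} [Field K] {V : Type v} [AddCommGroup V] [Module K V]

variable (K V) in
/-- The contragredient action of `GL(V)` on `V*`. Then `S(V*)` is the algebra of polynomial
functions on `V`, with `(g • f) v = f (g⁻¹ v)`. -/
def dualRep : Representation K (LinearMap.GeneralLinearGroup K V) (Module.Dual K V) :=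
  Representation.dual (Units.coeHom (V →ₗ[K] V) : Representation K _ V)

/-- The group `𝒩_G ∩ 𝒩_L`, where `𝒩` denotes the normaliser in `GL(V)`. -/
abbrev commonNormalizer (G L : Subgroup (LinearMap.GeneralLinearGroup K V)) :
    Subgroup (LinearMap.GeneralLinearGroup K V) :=
  Subgroup.normalizer (G : Set (LinearMap.GeneralLinearGroup K V)) ⊓
    Subgroup.normalizer (L : Set (LinearMap.GeneralLinearGroup K V))

/-- `G`, as a subgroup of `𝒩_G ∩ 𝒩_L`. (All of `G` lies there when `L` is normal in `G`.) -/
abbrev subG (G L : Subgroup (LinearMap.GeneralLinearGroup K V)) :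
    Subgroup (commonNormalizer G L) :=
  G.subgroupOf (commonNormalizer G L)

/-- `L`, as a subgroup of `𝒩_G ∩ 𝒩_L`. -/
abbrev subL (G L : Subgroup (LinearMap.GeneralLinearGroup K V)) :
    Subgroup (commonNormalizer G L) :=
  L.subgroupOf (commonNormalizer G L)

instance subG_normal (G L : Subgroup (LinearMap.GeneralLinearGroup K V)) :
    (subG G L).Normal :=
  ⟨fun n hn g => (Subgroup.mem_normalizer_iff.1 g.2.1 n).1 hn⟩

instance subL_normal (G L : Subgroup (LinearMap.GeneralLinearGroup K V)) :
    (subL G L).Normal :=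
  ⟨fun n hn g => (Subgroup.mem_normalizer_iff.1 g.2.2 n).1 hn⟩

/-- The quotient `(𝒩_G ∩ 𝒩_L) / L`. -/
abbrev NormalizerQuotient (G L : Subgroup (LinearMap.GeneralLinearGroup K V)) : Type _ :=
  commonNormalizer G L ⧸ subL G L

/-- The projection of `𝒩_G ∩ 𝒩_L` onto its quotient by `L`. -/
abbrev quotientHom (G L : Subgroup (LinearMap.GeneralLinearGroup K V)) :
    commonNormalizer G L →* NormalizerQuotient G L :=
  QuotientGroup.mk' (subL G L)

/-- `Ḡ = G/L`, as a subgroup of `(𝒩_G ∩ 𝒩_L) / L`. -/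
abbrev Gbar (G L : Subgroup (LinearMap.GeneralLinearGroup K V)) :
    Subgroup (NormalizerQuotient G L) :=
  (subG G L).map (quotientHom G L)

instance Gbar_normal (G L : Subgroup (LinearMap.GeneralLinearGroup K V)) : (Gbar G L).Normal :=
  (subG_normal G L).map _ (QuotientGroup.mk'_surjective _)

/-- The action of `𝒩_G ∩ 𝒩_L` on `V*`. -/
def formRep (G L : Subgroup (LinearMap.GeneralLinearGroup K V)) :
    Representation K (commonNormalizer G L) (Module.Dual K V) :=
  (dualRep K V).comp (commonNormalizer G L).subtype

/-- A choice of the space `E*`: a graded complement of `(S^L_+)²` in `S^L_+`, stable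
under `𝒩_L`, where `S = S(V*)`. -/
structure EquivariantComplement (L : Subgroup (LinearMap.GeneralLinearGroup K V)) where
  /-- the subspace `E*` of `S` -/
  space : Submodule K (SymmetricAlgebra K (Module.Dual K V))
  graded : space = ⨆ d, space ⊓ symDegree K (Module.Dual K V) d
  disjoint : Disjoint space (posInvariants (dualRep K V) L ^ 2)
  sup_eq : space ⊔ posInvariants (dualRep K V) L ^ 2 = posInvariants (dualRep K V) L
  stable : ∀ n ∈ Subgroup.normalizer (L : Set (LinearMap.GeneralLinearGroup K V)),
    ∀ f ∈ space, symAct (dualRep K V) n f ∈ space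

namespace EquivariantComplement

variable {L : Subgroup (LinearMap.GeneralLinearGroup K V)} (E : EquivariantComplement L)

/-- The homogeneous parts of the graded space `E*`. -/
def part (d : ℕ) : Submodule K E.space :=
  (symDegree K (Module.Dual K V) d).comap E.space.subtype

/-- The grading of `S̄ = S(E*)` for which `E*` has its own grading. -/
def degree (d : ℕ) : Submodule K (SymmetricAlgebra K E.space) :=
  weightedDegree E.part d

/-- The homomorphism `τ : S̄ = S(E*) → S` extending the inclusion of `E*`; its values lie
in `S^L`. -/
def tau : SymmetricAlgebra K E.space →ₐ[K] SymmetricAlgebra K (Module.Dual K V) :=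
  SymmetricAlgebra.lift E.space.subtype

/-- The action of `𝒩_G ∩ 𝒩_L` on `E*`. -/
def rep (G : Subgroup (LinearMap.GeneralLinearGroup K V)) :
    Representation K (commonNormalizer G L) E.space :=
  (symRep (formRep G L)).subrepresentation E.space (fun n f hf => E.stable n.1 n.2.2 f hf)

lemma rep_subL (G : Subgroup (LinearMap.GeneralLinearGroup K V)) (l : commonNormalizer G L)
    (hl : l ∈ subL G L) : E.rep G l = 1 := by
  ext f
  have hf : (f : SymmetricAlgebra K (Module.Dual K V)) ∈ posInvariants (dualRep K V) L := by
    rw [← E.sup_eq]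
    exact Submodule.mem_sup_left f.2
  exact hf.1 l.1 hl

/-- The action of `(𝒩_G ∩ 𝒩_L) / L` on `E*`; its restriction to `Ḡ` is the action of `Ḡ`. -/
def repBar (G : Subgroup (LinearMap.GeneralLinearGroup K V)) :
    Representation K (NormalizerQuotient G L) E.space :=
  QuotientGroup.lift (subL G L) (E.rep G) (E.rep_subL G)

/-- The image of `Ḡ` in `GL(E)`, where `E` is the dual of `E*`. -/
def imageGL (G : Subgroup (LinearMap.GeneralLinearGroup K V)) :
    Subgroup (LinearMap.GeneralLinearGroup K (Module.Dual K E.space)) :=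
  (Gbar G L).map (E.repBar G).dual.asGroupHom

end EquivariantComplement

end Quotient

end ReflectionQuotient

end

open ReflectionQuotient

/-!
# Coinvariants and factors of a reflection group modulo a normal subgroup

Write `S = S(V*)`, `S̄ = S(E*)`, and let `I ⊆ S` and `Ī ⊆ S̄` be the ideals generated by the
invariants without constant term of `G` and of `Ḡ`.

**The isomorphism of coinvariants.** An induction on the degree shows that the elements of `E*`
generate `S^L`, so `τ : S̄ → S^L` is onto (`EquivariantComplement.mem_range_tau`). As `τ` is
equivariant, it maps `Ī` into `I`, and averaging over `L` shows that the induced homomorphism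
`S̄_Ḡ → (S_G)^L` is still onto (`EquivariantComplement.tauBar_surjective`). It is bijective because
the dimensions are the same; more precisely

* `dim S̄_Ḡ ≤ |Ḡ|`. This is Chevalley's argument for the reflection group `Ḡ`: polynomials that are
  linearly independent modulo `Ī` are linearly independent over `S̄^Ḡ`
  (`invariant_independent_of_linearIndependent`), and at most `|Ḡ|` polynomials are independent
  over `S̄^Ḡ` (`card_le_of_invariant_independent`);
* `dim (S_G)^L ≥ |Ḡ|`. The elements of `Ḡ` act on `S^L` by distinct homomorphisms, which are
  linearly independent over `S`, and by Nakayama's lemma a relation between them on a set that spans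
  `S^L` modulo `I` would hold on all of `S^L` (`card_le_of_span_invariants`).

Gradings are treated as eigenspaces: the homogeneous part of degree `d` is the eigenspace for
`2 ^ d` of the algebra endomorphism that multiplies each homogeneous linear form of degree `i`
by `2 ^ i` (`symDegree_eq_eigenspace`, `weightedDegree_eq_eigenspace`). Compatibility with the
gradings is then the commutation of two operators.

**The factors.** For every finite group `S = ℋ ⊕ I`, where `ℋ` is the space of harmonic polynomials
(`isCompl_harmonics`). Indeed `ℋ` is the orthogonal of the ideal of coinvariants of the
contragredient action for the apolar pairing on polynomials. Over `ℂ` this orthogonal meets `I` in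
zero, by positivity of the Hermitian form attached to the apolar pairing and to an invariant
Hermitian form on the space of linear forms (`eq_zero_of_orthogonal_complex`). A group over a
general field `K` is specialised to `ℂ`: the algebra generated over `ℚ` by the finitely many numbers
involved has a residue field that is finite over `ℚ` (`eq_zero_of_orthogonal`).

Composing `τ` with the projection of `S` onto `ℋ` along `I` gives a map which, by the isomorphism of
coinvariants, identifies the harmonics of `Ḡ` with `ℋ^L`. Since `L` acts trivially on `M`, tensoring
with `M*` and taking invariants gives an isomorphism of the two spaces of covariants, commuting
with `γ` and with the gradings (`exists_harmonicCovariants_equiv`). Joint eigenbases exist because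
`γ` is semisimple and `K` is algebraically closed (`exists_isJointEigenPairs`), and their
eigenvalues with multiplicities are dimensions of joint eigenspaces (`IsJointEigenPairs.unique`).
-/

namespace ReflectionQuotient

open Module

/-! ### Operators with a basis of eigenvectors -/

section Eigen

variable {K : Type*} [Field K] {Y Y' : Type*} [AddCommGroup Y] [Module K Y]
  [AddCommGroup Y'] [Module K Y']

lemma mem_of_mem_iSup_of_iSupIndep {κ : Type*} {P Q : κ → Submodule K Y} (h : ∀ k, P k ≤ Q k)
    (hQ : iSupIndep Q) {k : κ} {x : Y} (hx : x ∈ Q k) (hP : x ∈ ⨆ k, P k) : x ∈ P k := by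
  have hx' : x ∈ P k ⊔ ⨆ (j) (_ : j ≠ k), P j := by
    refine SetLike.le_def.1 (iSup_le fun j => ?_) hP
    by_cases hj : j = k
    · subst hj; exact le_sup_left
    · exact le_sup_of_le_right (le_iSup₂_of_le j hj le_rfl)
  obtain ⟨a, ha, b, hb, rfl⟩ := Submodule.mem_sup.1 hx'
  have hb1 : b ∈ Q k := by simpa using (Q k).sub_mem hx (h k ha)
  have hb2 : b ∈ ⨆ (j) (_ : j ≠ k), Q j := iSup₂_mono (fun j _ => h j) hb
  have : b = 0 := (Submodule.disjoint_def.1 (hQ k)) b hb1 hb2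
  simpa [this] using ha

/-- A family of submodules that spans the whole space and is contained termwise in an independent
family coincides with it. -/
lemma eq_of_le_of_iSupIndep {κ : Type*} {P Q : κ → Submodule K Y} (h : ∀ k, P k ≤ Q k)
    (hQ : iSupIndep Q) (hP : ⨆ k, P k = ⊤) (k : κ) : P k = Q k :=
  le_antisymm (h k) fun _ hx => mem_of_mem_iSup_of_iSupIndep h hQ hx (hP ▸ Submodule.mem_top)

lemma eigenspace_comp_iSupIndep {κ : Type*} (f : End K Y) {c : κ → K}
    (hc : Function.Injective c) : iSupIndep fun k => f.eigenspace (c k) :=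
  f.eigenspaces_iSupIndep.comp hc

/-- A stable subspace contains the eigencomponents of its elements: they are obtained by applying
Lagrange polynomials in the operator. -/
lemma mem_iSup_inf_eigenspace {κ : Type*} (f : End K Y) {c : κ → K} (hc : Function.Injective c)
    {p : Submodule K Y} (hp : ∀ x ∈ p, f x ∈ p) {v : Y} (hv : v ∈ p)
    (hv' : v ∈ ⨆ k, f.eigenspace (c k)) : v ∈ ⨆ k, p ⊓ f.eigenspace (c k) := by
  classical
  obtain ⟨g, hg, rfl⟩ := (Submodule.mem_iSup_iff_exists_finsupp _ _).1 hv'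
  have hev : ∀ (q : Polynomial K) (j : κ), Polynomial.aeval f q (g j) = q.eval (c j) • g j := by
    intro q j
    by_cases h0 : g j = 0
    · simp [h0]
    · exact End.aeval_apply_of_hasEigenvector ⟨hg j, h0⟩
  have hst : ∀ (q : Polynomial K), ∀ x ∈ p, Polynomial.aeval f q x ∈ p := by
    intro q x hx
    induction q using Polynomial.induction_on generalizing x with
    | C a => simpa [Polynomial.aeval_C, Module.algebraMap_end_apply] using p.smul_mem a hx
    | add a b ha hb => simpa using p.add_mem (ha x hx) (hb x hx)
    | monomial n a h =>
      have := h (f x) (hp x hx)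
      simpa [pow_succ, ← mul_assoc] using this
  refine Submodule.sum_mem _ fun k hk => Submodule.mem_iSup_of_mem k ⟨?_, hg k⟩
  have := hst (Lagrange.basis g.support c k) _ hv
  rw [Finsupp.sum, map_sum] at this
  rw [Finset.sum_eq_single_of_mem k hk] at this
  · rwa [hev, Lagrange.eval_basis_self hc.injOn hk, one_smul] at this
  · intro j hj hjk
    rw [hev, Lagrange.eval_basis_of_ne (Ne.symm hjk) hj, zero_smul]

lemma two_pow_injective [CharZero K] : Function.Injective fun m : ℕ => (2 : K) ^ m := by
  intro a b h
  have : ((2 ^ a : ℕ) : K) = ((2 ^ b : ℕ) : K) := by push_cast; exact h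
  exact Nat.pow_right_injective le_rfl (Nat.cast_injective this)

/-- `p` is the multiset of the pairs `(ε, m)` belonging to a basis of `W` that consists of common
eigenvectors of `T`, with eigenvalue `ε`, and of `Θ`, with eigenvalue `2 ^ m`. The operator `Θ`
encodes a grading: its eigenspace for `2 ^ m` is the homogeneous part of degree `m`. -/
def IsJointEigenPairs (W : Submodule K Y) (T Θ : End K Y) (p : Multiset (K × ℕ)) : Prop :=
  ∃ (n : ℕ) (b : Module.Basis (Fin n) K W) (ε : Fin n → K) (m : Fin n → ℕ),
    (∀ i, T (b i : Y) = ε i • (b i : Y)) ∧ (∀ i, Θ (b i : Y) = (2 : K) ^ m i • (b i : Y)) ∧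
    p = Finset.univ.val.map fun i => (ε i, m i)

lemma exists_isJointEigenPairs [CharZero K] (W : Submodule K Y) [FiniteDimensional K W]
    (T Θ : End K Y) (hTW : ∀ w ∈ W, T w ∈ W) (hΘW : ∀ w ∈ W, Θ w ∈ W)
    (hc : ∀ y, T (Θ y) = Θ (T y)) (hT : ⨆ μ, T.eigenspace μ = ⊤)
    (hΘ : ⨆ m : ℕ, Θ.eigenspace ((2 : K) ^ m) = ⊤) : ∃ p, IsJointEigenPairs W T Θ p := by
  classical
  let s : Set W := {w | ∃ ε : K, ∃ m : ℕ, T w = ε • (w : Y) ∧ Θ w = (2 : K) ^ m • (w : Y)}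
  have hs : Submodule.span K s = ⊤ := by
    have key : W ≤ (Submodule.span K s).map W.subtype := by
      intro w hw
      have h1 := mem_iSup_inf_eigenspace Θ two_pow_injective hΘW hw (hΘ ▸ Submodule.mem_top)
      refine SetLike.le_def.1 (iSup_le fun m => ?_) h1
      intro x hx
      have h2 := mem_iSup_inf_eigenspace T (c := id) Function.injective_id
        (p := W ⊓ Θ.eigenspace ((2 : K) ^ m)) (fun y hy => ⟨hTW y hy.1, by
          have := End.mem_eigenspace_iff.1 hy.2
          exact End.mem_eigenspace_iff.2 (by rw [← hc, this, map_smul])⟩) hx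
        (hT ▸ Submodule.mem_top)
      refine SetLike.le_def.1 (iSup_le fun ε => ?_) h2
      rintro y ⟨⟨hyW, hyΘ⟩, hyT⟩
      exact ⟨⟨y, hyW⟩, Submodule.subset_span ⟨ε, m, End.mem_eigenspace_iff.1 hyT,
        End.mem_eigenspace_iff.1 hyΘ⟩, rfl⟩
    rw [eq_top_iff]
    rintro ⟨w, hw⟩ -
    obtain ⟨w', hw', h⟩ := key hw
    have : w' = ⟨w, hw⟩ := Subtype.ext h
    exact this ▸ hw'
  obtain ⟨B, hBs, hspan, hli⟩ := exists_linearIndependent K s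
  let b : Basis B K W := Basis.mk hli (by rw [Subtype.range_coe, hspan, hs])
  have : Fintype B := FiniteDimensional.fintypeBasisIndex b
  let e := Fintype.equivFin B
  choose ε m h1 h2 using fun i : B => hBs i.2
  refine ⟨_, Fintype.card B, b.reindex e, ε ∘ e.symm, m ∘ e.symm, fun i => ?_, fun i => ?_, rfl⟩
  · simpa [b] using h1 (e.symm i)
  · simpa [b] using h2 (e.symm i)

/-- The multiplicity of `(ε, m)` is the dimension of the joint eigenspace, so that it does not
depend on the basis. -/
lemma IsJointEigenPairs.count [CharZero K] [DecidableEq (K × ℕ)] {W : Submodule K Y}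
    {T Θ : End K Y} {p : Multiset (K × ℕ)} (h : IsJointEigenPairs W T Θ p) (ε : K) (m : ℕ) :
    p.count (ε, m) = finrank K
      ((T.eigenspace ε ⊓ Θ.eigenspace ((2 : K) ^ m)).comap W.subtype : Submodule K W) := by
  classical
  obtain ⟨n, b, ε', m', h1, h2, rfl⟩ := h
  have hb : ((T.eigenspace ε ⊓ Θ.eigenspace ((2 : K) ^ m)).comap W.subtype : Submodule K W)
      = Submodule.span K (Set.range fun i : {i // (ε' i, m' i) = (ε, m)} => b i) := by
    apply le_antisymm
    · rintro w ⟨hT, hΘ⟩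
      have eq : ∀ (S : End K Y) (s : Fin n → K) (t : K), (∀ i, S (b i : Y) = s i • (b i : Y)) →
          S w = t • (w : Y) → ∀ i, (s i - t) * b.repr w i = 0 := by
        intro S s t hS hw i
        have e1 : ∑ i, ((s i - t) * b.repr w i) • b i = 0 := by
          apply Subtype.ext
          have hw' : (w : Y) = ∑ i, b.repr w i • (b i : Y) := by
            have := congrArg (Subtype.val : W → Y) (b.sum_repr w)
            rw [AddSubmonoidClass.coe_finsetSum] at this
            exact this.symm
          have : S w - t • (w : Y) = 0 := sub_eq_zero.2 hw
          rw [hw', map_sum, Finset.smul_sum, ← Finset.sum_sub_distrib] at this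
          rw [AddSubmonoidClass.coe_finsetSum, ZeroMemClass.coe_zero, ← this]
          refine Finset.sum_congr rfl fun i _ => ?_
          rw [map_smul, hS, Submodule.coe_smul, sub_mul, sub_smul, smul_smul, smul_smul,
            mul_comm (s i)]
        exact (Fintype.linearIndependent_iff.1 b.linearIndependent) _ e1 i
      have hT' := eq T ε' ε h1 (End.mem_eigenspace_iff.1 hT)
      have hΘ' := eq Θ (fun i => (2 : K) ^ m' i) (2 ^ m) h2 (End.mem_eigenspace_iff.1 hΘ)
      rw [← b.sum_repr w]
      refine Submodule.sum_mem _ fun i _ => ?_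
      by_cases hi : (ε' i, m' i) = (ε, m)
      · exact Submodule.smul_mem _ _ (Submodule.subset_span ⟨⟨i, hi⟩, rfl⟩)
      · have : b.repr w i = 0 := by
          by_contra hne
          apply hi
          have e1 := sub_eq_zero.1 ((mul_eq_zero.1 (hT' i)).resolve_right hne)
          have e2 := two_pow_injective
            (sub_eq_zero.1 ((mul_eq_zero.1 (hΘ' i)).resolve_right hne))
          rw [e1, e2]
        rw [this, zero_smul]
        exact Submodule.zero_mem _
    · rw [Submodule.span_le]
      rintro _ ⟨⟨i, hi⟩, rfl⟩
      obtain ⟨rfl, rfl⟩ := Prod.mk.injEq .. ▸ hi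
      exact ⟨End.mem_eigenspace_iff.2 (h1 i), End.mem_eigenspace_iff.2 (h2 i)⟩
  rw [hb, finrank_span_eq_card (b := fun i : {i // (ε' i, m' i) = (ε, m)} => b i)
    (b.linearIndependent.comp _ Subtype.val_injective), Multiset.count_map, Fintype.card_subtype]
  simp [Finset.card, Finset.filter, eq_comm]

lemma IsJointEigenPairs.unique [CharZero K] {W : Submodule K Y} {T Θ : End K Y}
    {p q : Multiset (K × ℕ)} (hp : IsJointEigenPairs W T Θ p)
    (hq : IsJointEigenPairs W T Θ q) : p = q := by
  classical
  ext ⟨ε, m⟩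
  rw [hp.count, hq.count]

/-- The eigenvalues of `T` do not depend on the grading. -/
lemma IsJointEigenPairs.map_fst_unique [CharZero K] {W : Submodule K Y} {T Θ Θ' : End K Y}
    {p q : Multiset (K × ℕ)} (hp : IsJointEigenPairs W T Θ p)
    (hq : IsJointEigenPairs W T Θ' q) : p.map Prod.fst = q.map Prod.fst := by
  have key : ∀ {Θ : End K Y} {p}, IsJointEigenPairs W T Θ p →
      IsJointEigenPairs W T 1 (p.map fun x => (x.1, 0)) := by
    rintro Θ _ ⟨n, b, ε, m, h1, h2, rfl⟩
    exact ⟨n, b, ε, fun _ => 0, h1, by simp,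
      by rw [Multiset.map_map]; rfl⟩
  have := congrArg (Multiset.map Prod.fst) ((key hp).unique (key hq))
  simpa using this

lemma IsJointEigenPairs.map {W : Submodule K Y} {W' : Submodule K Y'} {T Θ : End K Y}
    {T' Θ' : End K Y'} (e : W ≃ₗ[K] W')
    (hT : ∀ w : W, ∀ μ : K, T w = μ • (w : Y) → T' (e w) = μ • (e w : Y'))
    (hΘ : ∀ w : W, ∀ μ : K, Θ w = μ • (w : Y) → Θ' (e w) = μ • (e w : Y'))
    {p : Multiset (K × ℕ)} (h : IsJointEigenPairs W T Θ p) : IsJointEigenPairs W' T' Θ' p := by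
  obtain ⟨n, b, ε, m, h1, h2, rfl⟩ := h
  exact ⟨n, b.map e, ε, m, fun i => by simpa using hT _ _ (h1 i),
    fun i => by simpa using hΘ _ _ (h2 i), rfl⟩

/-- A tensor product of two operators each of which is spanned by eigenvectors is again so. -/
lemma iSup_eigenspace_tensor_map {f : End K Y} {g : End K Y'} (hf : ⨆ μ, f.eigenspace μ = ⊤)
    (hg : ⨆ μ, g.eigenspace μ = ⊤) : ⨆ μ, End.eigenspace (TensorProduct.map f g) μ = ⊤ := by
  rw [eq_top_iff, ← TensorProduct.span_tmul_eq_top, Submodule.span_le]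
  rintro _ ⟨x, y, rfl⟩
  have hx : x ∈ ⨆ μ, f.eigenspace μ := hf ▸ Submodule.mem_top
  have hy : y ∈ ⨆ μ, g.eigenspace μ := hg ▸ Submodule.mem_top
  change x ⊗ₜ[K] y ∈ ⨆ μ, End.eigenspace (TensorProduct.map f g) μ
  induction hx using Submodule.iSup_induction' with
  | zero => simp
  | add a b _ _ ha hb => rw [TensorProduct.add_tmul]; exact Submodule.add_mem _ ha hb
  | mem μ x hx =>
    induction hy using Submodule.iSup_induction' with
    | zero => simp
    | add a b _ _ ha hb => rw [TensorProduct.tmul_add]; exact Submodule.add_mem _ ha hb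
    | mem ν y hy =>
      refine Submodule.mem_iSup_of_mem (μ * ν) (End.mem_eigenspace_iff.2 ?_)
      rw [TensorProduct.map_tmul, End.mem_eigenspace_iff.1 hx, End.mem_eigenspace_iff.1 hy,
        TensorProduct.smul_tmul_smul]

/-- The dual of a diagonalizable operator is diagonalizable. -/
lemma iSup_eigenspace_dualMap [FiniteDimensional K Y] {f : End K Y}
    (hf : ⨆ μ, f.eigenspace μ = ⊤) :
    ⨆ μ, End.eigenspace (f.dualMap : End K (Dual K Y)) μ = ⊤ := by
  classical
  let s : Set Y := {v | ∃ μ : K, f v = μ • v}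
  have hs : Submodule.span K s = ⊤ := by
    rw [eq_top_iff, ← hf]
    exact iSup_le fun μ x hx => Submodule.subset_span ⟨μ, End.mem_eigenspace_iff.1 hx⟩
  obtain ⟨B, hBs, hspan, hli⟩ := exists_linearIndependent K s
  let b : Basis B K Y := Basis.mk hli (by rw [Subtype.range_coe, hspan, hs])
  have : Fintype B := FiniteDimensional.fintypeBasisIndex b
  choose μ hμ using fun i : B => hBs i.2
  rw [eq_top_iff, ← b.dualBasis.span_eq, Submodule.span_le]
  rintro _ ⟨i, rfl⟩
  refine Submodule.mem_iSup_of_mem (μ i) (End.mem_eigenspace_iff.2 (b.ext fun j => ?_))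
  have hj : f (b j) = μ j • b j := by simpa [b] using hμ j
  rw [LinearMap.dualMap_apply, hj]
  by_cases h : j = i
  · subst h; simp
  · simp [h]

end Eigen

/-! ### Functoriality and gradings of the symmetric algebra -/

section SymMap

variable {K : Type*} [Field K] {X X' X'' : Type*} [AddCommGroup X] [Module K X]
  [AddCommGroup X'] [Module K X'] [AddCommGroup X''] [Module K X'']

/-- The algebra homomorphism `S(X) → S(X')` extending a linear map `X → X'`. -/
noncomputable def symMap (θ : X →ₗ[K] X') : SymmetricAlgebra K X →ₐ[K] SymmetricAlgebra K X' :=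
  SymmetricAlgebra.lift (SymmetricAlgebra.ι K X' ∘ₗ θ)

@[simp]
lemma symMap_ι (θ : X →ₗ[K] X') (x : X) :
    symMap θ (SymmetricAlgebra.ι K X x) = SymmetricAlgebra.ι K X' (θ x) := by
  simp [symMap]

lemma symMap_symMap (θ : X →ₗ[K] X') (θ' : X' →ₗ[K] X'') (f : SymmetricAlgebra K X) :
    symMap θ' (symMap θ f) = symMap (θ' ∘ₗ θ) f := by
  have : (symMap θ').comp (symMap θ) = symMap (θ' ∘ₗ θ) := by
    apply SymmetricAlgebra.algHom_ext
    ext x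
    simp
  exact DFunLike.congr_fun this f

lemma symMap_id (f : SymmetricAlgebra K X) : symMap (LinearMap.id : X →ₗ[K] X) f = f := by
  have : symMap (LinearMap.id : X →ₗ[K] X) = AlgHom.id K _ := by
    apply SymmetricAlgebra.algHom_ext
    ext x
    simp
  exact DFunLike.congr_fun this f

lemma algebraMapInv_symMap (θ : X →ₗ[K] X') (f : SymmetricAlgebra K X) :
    SymmetricAlgebra.algebraMapInv (symMap θ f) = SymmetricAlgebra.algebraMapInv f := by
  have h : (SymmetricAlgebra.algebraMapInv (R := K) (M := X')).comp (symMap θ)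
      = SymmetricAlgebra.algebraMapInv := by
    apply SymmetricAlgebra.algHom_ext
    ext x
    simp [SymmetricAlgebra.algebraMapInv]
  exact DFunLike.congr_fun h f

lemma symAct_eq_symMap {A : Type*} [Group A] (σ : Representation K A X) (a : A) :
    symAct σ a = symMap (σ a) := rfl

@[simp]
lemma symRep_apply {A : Type*} [Group A] (σ : Representation K A X) (a : A)
    (f : SymmetricAlgebra K X) : symRep σ a f = symAct σ a f := rfl

/-- In a commutative algebra the span of the eigenvectors of an endomorphism is a subalgebra. -/
lemma mul_mem_iSup_eigenspace {S : Type*} [CommRing S] [Algebra K S] (F : S →ₐ[K] S) {a b : S}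
    (ha : a ∈ ⨆ μ, End.eigenspace F.toLinearMap μ)
    (hb : b ∈ ⨆ μ, End.eigenspace F.toLinearMap μ) :
    a * b ∈ ⨆ μ, End.eigenspace F.toLinearMap μ := by
  induction ha using Submodule.iSup_induction' with
  | zero => simp
  | add a a' _ _ h h' => rw [add_mul]; exact Submodule.add_mem _ h h'
  | mem μ a ha =>
    induction hb using Submodule.iSup_induction' with
    | zero => simp
    | add a b _ _ ha hb => rw [mul_add]; exact Submodule.add_mem _ ha hb
    | mem ν b hb =>
      refine Submodule.mem_iSup_of_mem (μ * ν) (End.mem_eigenspace_iff.2 ?_)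
      have ha' : F a = μ • a := End.mem_eigenspace_iff.1 ha
      have hb' : F b = ν • b := End.mem_eigenspace_iff.1 hb
      rw [AlgHom.toLinearMap_apply, map_mul, ha', hb', smul_mul_smul_comm]

lemma iSup_eigenspace_symMap {θ : End K X} (h : ⨆ μ, θ.eigenspace μ = ⊤) :
    ⨆ μ, End.eigenspace (symMap θ).toLinearMap μ = ⊤ := by
  rw [eq_top_iff]
  rintro f -
  induction f using SymmetricAlgebra.induction with
  | algebraMap r =>
    exact Submodule.mem_iSup_of_mem 1 (End.mem_eigenspace_iff.2 (by simp))
  | ι x =>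
    have hx : x ∈ ⨆ μ, θ.eigenspace μ := h ▸ Submodule.mem_top
    induction hx using Submodule.iSup_induction' with
    | zero => simp
    | add a b _ _ ha hb => rw [map_add]; exact Submodule.add_mem _ ha hb
    | mem μ x hx =>
      refine Submodule.mem_iSup_of_mem μ (End.mem_eigenspace_iff.2 ?_)
      simp [End.mem_eigenspace_iff.1 hx]
  | mul a b ha hb => exact mul_mem_iSup_eigenspace _ ha hb
  | add a b ha hb => exact Submodule.add_mem _ ha hb

lemma iSup_symDegree : ⨆ d, symDegree K X d = ⊤ := by
  rw [eq_top_iff]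
  rintro f -
  induction f using SymmetricAlgebra.induction with
  | algebraMap r =>
    refine Submodule.mem_iSup_of_mem 0 ?_
    rw [symDegree, pow_zero]
    exact Submodule.algebraMap_mem r
  | ι x =>
    refine Submodule.mem_iSup_of_mem 1 ?_
    rw [symDegree, pow_one]
    exact ⟨x, rfl⟩
  | add a b ha hb => exact Submodule.add_mem _ ha hb
  | mul a b ha hb =>
    have hab := Submodule.mul_mem_mul ha hb
    rw [Submodule.iSup_mul] at hab
    refine SetLike.le_def.1 (iSup_le fun i => ?_) hab
    rw [Submodule.mul_iSup]
    exact iSup_le fun j => le_iSup_of_le (i + j) (pow_add _ i j).ge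

lemma symDegree_le_eigenspace (d : ℕ) :
    symDegree K X d ≤ End.eigenspace (symMap ((2 : K) • LinearMap.id : X →ₗ[K] X)).toLinearMap
      (2 ^ d) := by
  intro f hf
  induction d generalizing f with
  | zero =>
    rw [symDegree, pow_zero] at hf
    obtain ⟨r, rfl⟩ := Submodule.mem_one.1 hf
    exact End.mem_eigenspace_iff.2 (by simp)
  | succ d ih =>
    rw [symDegree, pow_succ] at hf
    induction hf using Submodule.mul_induction_on' with
    | add x _ y _ hx hy => exact Submodule.add_mem _ hx hy
    | mem_mul_mem a ha b hb =>
      obtain ⟨x, rfl⟩ := hb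
      have h := End.mem_eigenspace_iff.1 (ih ha)
      rw [AlgHom.toLinearMap_apply] at h
      refine End.mem_eigenspace_iff.2 ?_
      rw [AlgHom.toLinearMap_apply, map_mul, h]
      simp [pow_succ, smul_smul, mul_comm]

lemma symDegree_eq_eigenspace [CharZero K] (d : ℕ) :
    symDegree K X d = End.eigenspace (symMap ((2 : K) • LinearMap.id : X →ₗ[K] X)).toLinearMap
      (2 ^ d) :=
  eq_of_le_of_iSupIndep symDegree_le_eigenspace
    (eigenspace_comp_iSupIndep _ two_pow_injective) iSup_symDegree d

lemma mul_mem_weightedDegree {𝒳 : ℕ → Submodule K X} {i j : ℕ} {f g : SymmetricAlgebra K X}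
    (hf : f ∈ weightedDegree 𝒳 i) (hg : g ∈ weightedDegree 𝒳 j) :
    f * g ∈ weightedDegree 𝒳 (i + j) := by
  have := Submodule.mul_mem_mul hf hg
  rw [weightedDegree, weightedDegree, Submodule.span_mul_span] at this
  refine (Submodule.span_mono ?_ : _ ≤ weightedDegree 𝒳 (i + j)) this
  rintro _ ⟨_, ⟨n, a, x, hx, rfl, rfl⟩, _, ⟨m, b, y, hy, rfl, rfl⟩, rfl⟩
  refine ⟨n + m, Fin.append a b, Fin.append x y, ?_, ?_, ?_⟩
  · intro k
    refine Fin.addCases (fun k => ?_) (fun k => ?_) k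
    · simpa using hx k
    · simpa using hy k
  · simp [Fin.sum_univ_add]
  · simp [Fin.prod_univ_add]

lemma iSup_weightedDegree {𝒳 : ℕ → Submodule K X} (h : ⨆ i, 𝒳 i = ⊤) :
    ⨆ d, weightedDegree 𝒳 d = ⊤ := by
  rw [eq_top_iff]
  rintro f -
  induction f using SymmetricAlgebra.induction with
  | algebraMap r =>
    refine Submodule.mem_iSup_of_mem 0 ?_
    rw [Algebra.algebraMap_eq_smul_one]
    exact Submodule.smul_mem _ _
      (Submodule.subset_span ⟨0, Fin.elim0, Fin.elim0, fun j => j.elim0, by simp, by simp⟩)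
  | ι x =>
    have hx : x ∈ ⨆ i, 𝒳 i := h ▸ Submodule.mem_top
    induction hx using Submodule.iSup_induction' with
    | zero => simp
    | add a b _ _ ha hb => rw [map_add]; exact Submodule.add_mem _ ha hb
    | mem i x hx =>
      exact Submodule.mem_iSup_of_mem i (Submodule.subset_span
        ⟨1, fun _ => i, fun _ => x, fun _ => hx, by simp, by simp⟩)
  | add a b ha hb => exact Submodule.add_mem _ ha hb
  | mul a b ha hb =>
    have hab := Submodule.mul_mem_mul ha hb
    rw [Submodule.iSup_mul] at hab
    refine SetLike.le_def.1 (iSup_le fun i => ?_) hab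
    rw [Submodule.mul_iSup]
    exact iSup_le fun j => le_iSup_of_le (i + j)
      (Submodule.mul_le.2 fun _ ha _ hb => mul_mem_weightedDegree ha hb)

lemma weightedDegree_eq_eigenspace [CharZero K] {𝒳 : ℕ → Submodule K X} (h : ⨆ i, 𝒳 i = ⊤)
    {θ : X →ₗ[K] X} (hθ : ∀ i, ∀ x ∈ 𝒳 i, θ x = (2 : K) ^ i • x) (d : ℕ) :
    weightedDegree 𝒳 d = End.eigenspace (symMap θ).toLinearMap (2 ^ d) := by
  refine eq_of_le_of_iSupIndep (fun d => ?_)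
    (eigenspace_comp_iSupIndep _ two_pow_injective) (iSup_weightedDegree h) d
  rw [weightedDegree, Submodule.span_le]
  rintro _ ⟨n, i, x, hx, rfl, rfl⟩
  refine End.mem_eigenspace_iff.2 ?_
  rw [AlgHom.toLinearMap_apply, map_prod, ← Finset.prod_pow_eq_pow_sum]
  simp_rw [symMap_ι]
  rw [← Finset.prod_smul]
  exact Finset.prod_congr rfl fun j _ => by rw [hθ _ _ (hx j), map_smul]

/-- The homogeneous parts of a grading by eigenspaces, tensored with a space in degree zero. -/
lemma range_rTensor_eq_eigenspace [CharZero K] {S N : Type*} [AddCommGroup S] [Module K S]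
    [AddCommGroup N] [Module K N] {𝒮 : ℕ → Submodule K S} {Θ : End K S}
    (h𝒮 : ∀ d, 𝒮 d = Θ.eigenspace ((2 : K) ^ d)) (htop : ⨆ d, 𝒮 d = ⊤) (d : ℕ) :
    LinearMap.range ((𝒮 d).subtype.rTensor N) = End.eigenspace (Θ.rTensor N) ((2 : K) ^ d) := by
  refine eq_of_le_of_iSupIndep (P := fun d => LinearMap.range ((𝒮 d).subtype.rTensor N))
    (fun d => ?_) (eigenspace_comp_iSupIndep _ two_pow_injective) ?_ d
  · rintro _ ⟨t, rfl⟩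
    induction t with
    | zero => simp
    | add a b ha hb => rw [map_add]; exact Submodule.add_mem _ ha hb
    | tmul s n =>
      have hs : Θ s = (2 : K) ^ d • (s : S) := End.mem_eigenspace_iff.1 ((h𝒮 d).le s.2)
      refine End.mem_eigenspace_iff.2 ?_
      simp [hs, TensorProduct.smul_tmul']
  · rw [eq_top_iff, ← TensorProduct.span_tmul_eq_top, Submodule.span_le]
    rintro _ ⟨s, n, rfl⟩
    have hs : s ∈ ⨆ d, 𝒮 d := htop ▸ Submodule.mem_top
    change s ⊗ₜ[K] n ∈ ⨆ d, LinearMap.range ((𝒮 d).subtype.rTensor N)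
    induction hs using Submodule.iSup_induction' with
    | zero => simp
    | add a b _ _ ha hb => rw [TensorProduct.add_tmul]; exact Submodule.add_mem _ ha hb
    | mem d s hs => exact Submodule.mem_iSup_of_mem d ⟨⟨s, hs⟩ ⊗ₜ n, by simp⟩

end SymMap

/-! ### Invariants of a finite group and the Reynolds operator -/

section Invariants

lemma ι_injective {K X : Type*} [Field K] [AddCommGroup X] [Module K X] :
    Function.Injective (SymmetricAlgebra.ι K X) := by
  intro u v huv
  rw [← sub_eq_zero, ← Module.forall_dual_apply_eq_zero_iff K]
  intro φ
  have h := congrArg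
    (SymmetricAlgebra.lift (φ.smulRight (Polynomial.X : Polynomial K))) huv
  have h' := congrArg (fun p => Polynomial.coeff p 1) h
  simpa [sub_eq_zero] using h'

variable {K : Type*} [Field K] {X : Type*} [AddCommGroup X] [Module K X]
  {A : Type*} [Group A] (σ : Representation K A X) (G : Subgroup A)

/-- The algebra `S(X)^G` of invariants. -/
def invariantAlgebra : Subalgebra K (SymmetricAlgebra K X) where
  carrier := {f | ∀ g ∈ G, symAct σ g f = f}
  mul_mem' := fun h h' g hg => by rw [map_mul, h g hg, h' g hg]
  add_mem' := fun h h' g hg => by rw [map_add, h g hg, h' g hg]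
  algebraMap_mem' := fun r g _ => AlgHom.commutes _ r

variable {σ G}

lemma mem_posInvariants {f : SymmetricAlgebra K X} :
    f ∈ posInvariants σ G ↔
      f ∈ invariantAlgebra σ G ∧ SymmetricAlgebra.algebraMapInv f = 0 := Iff.rfl

lemma symAct_symAct (a b : A) (f : SymmetricAlgebra K X) :
    symAct σ a (symAct σ b f) = symAct σ (a * b) f := by rw [symAct_mul]; rfl

lemma symAct_one_apply (f : SymmetricAlgebra K X) : symAct σ 1 f = f := by rw [symAct_one]; rfl

lemma posInvariants_le_coinvariantIdeal {f : SymmetricAlgebra K X}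
    (hf : f ∈ posInvariants σ G) : f ∈ coinvariantIdeal σ G := Ideal.subset_span hf

lemma coinvariantMk_eq_zero {f : SymmetricAlgebra K X} :
    coinvariantMk σ G f = 0 ↔ f ∈ coinvariantIdeal σ G := Ideal.Quotient.eq_zero_iff_mem

lemma coinvariantMk_surjective : Function.Surjective (coinvariantMk σ G) :=
  Ideal.Quotient.mk_surjective

lemma sub_algebraMapInv_mem_posInvariants {f : SymmetricAlgebra K X}
    (hf : f ∈ invariantAlgebra σ G) :
    f - algebraMap K _ (SymmetricAlgebra.algebraMapInv f) ∈ posInvariants σ G :=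
  ⟨(invariantAlgebra σ G).sub_mem hf (Subalgebra.algebraMap_mem _ _), by simp⟩

/-- A linear substitution that commutes with `G` preserves the ideal generated by the invariants
without constant term. -/
lemma symMap_mem_coinvariantIdeal {θ : X →ₗ[K] X} (hθ : ∀ g ∈ G, ∀ x, σ g (θ x) = θ (σ g x))
    {f : SymmetricAlgebra K X} (hf : f ∈ coinvariantIdeal σ G) :
    symMap θ f ∈ coinvariantIdeal σ G := by
  have hle : coinvariantIdeal σ G ≤ (coinvariantIdeal σ G).comap (symMap θ) := by
    refine Ideal.span_le.2 fun p hp => Ideal.subset_span ⟨fun g hg => ?_, ?_⟩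
    · rw [symAct_eq_symMap, symMap_symMap,
        show σ g ∘ₗ θ = θ ∘ₗ σ g from LinearMap.ext (hθ g hg), ← symMap_symMap,
        ← symAct_eq_symMap, hp.1 g hg]
    · rw [algebraMapInv_symMap]; exact hp.2
  exact hle hf

lemma symAct_mem_coinvariantIdeal_of_mem {g : A} (hg : g ∈ G) {f : SymmetricAlgebra K X}
    (hf : f ∈ coinvariantIdeal σ G) : symAct σ g f ∈ coinvariantIdeal σ G := by
  have hle : coinvariantIdeal σ G ≤ (coinvariantIdeal σ G).comap (symAct σ g) := by
    refine Ideal.span_le.2 fun p hp => ?_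
    change symAct σ g p ∈ coinvariantIdeal σ G
    rw [hp.1 g hg]
    exact Ideal.subset_span hp
  exact hle hf

variable (σ G)

/-- The Reynolds operator of a finite group `G`, the projection of `S(X)` onto `S(X)^G` given by
averaging. -/
noncomputable def reynolds [Finite G] : SymmetricAlgebra K X →ₗ[K] SymmetricAlgebra K X :=
  letI := Fintype.ofFinite G
  (Nat.card G : K)⁻¹ • ∑ g : G, (symAct σ (g : A)).toLinearMap

variable {σ G}

lemma reynolds_apply [Fintype G] (f : SymmetricAlgebra K X) :
    reynolds σ G f = (Nat.card G : K)⁻¹ • ∑ g : G, symAct σ (g : A) f := by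
  rw [reynolds]
  simp only [LinearMap.smul_apply, LinearMap.sum_apply, AlgHom.toLinearMap_apply]
  congr!

lemma natCard_ne_zero [CharZero K] [Finite G] : (Nat.card G : K) ≠ 0 := by
  exact_mod_cast Nat.card_pos.ne'

lemma reynolds_mem [Finite G] (f : SymmetricAlgebra K X) :
    reynolds σ G f ∈ invariantAlgebra σ G := by
  have := Fintype.ofFinite G
  intro h hh
  rw [reynolds_apply, map_smul, map_sum]
  congr 1
  simp_rw [symAct_symAct]
  exact Fintype.sum_equiv (Equiv.mulLeft (⟨h, hh⟩ : G)) _ _ fun g => rfl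

lemma reynolds_of_mem [CharZero K] [Finite G] {f : SymmetricAlgebra K X}
    (hf : f ∈ invariantAlgebra σ G) : reynolds σ G f = f := by
  have := Fintype.ofFinite G
  rw [reynolds_apply, Finset.sum_congr rfl fun (g : G) _ => hf g g.2, Finset.sum_const,
    Finset.card_univ, ← Nat.card_eq_fintype_card, ← Nat.cast_smul_eq_nsmul K, smul_smul,
    inv_mul_cancel₀ natCard_ne_zero, one_smul]

lemma reynolds_mul [Finite G] {a : SymmetricAlgebra K X} (ha : a ∈ invariantAlgebra σ G)
    (f : SymmetricAlgebra K X) : reynolds σ G (a * f) = a * reynolds σ G f := by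
  have := Fintype.ofFinite G
  rw [reynolds_apply, reynolds_apply, mul_smul_comm, Finset.mul_sum]
  congr 1
  exact Finset.sum_congr rfl fun g _ => by rw [map_mul, ha g g.2]

lemma algebraMapInv_reynolds [CharZero K] [Finite G] (f : SymmetricAlgebra K X) :
    SymmetricAlgebra.algebraMapInv (reynolds σ G f) = SymmetricAlgebra.algebraMapInv f := by
  have := Fintype.ofFinite G
  rw [reynolds_apply, map_smul, map_sum,
    Finset.sum_congr rfl fun g _ => algebraMapInv_symAct σ _ f, Finset.sum_const,
    Finset.card_univ, ← Nat.card_eq_fintype_card, ← Nat.cast_smul_eq_nsmul K, smul_smul,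
    inv_mul_cancel₀ natCard_ne_zero, one_smul]

lemma reynolds_sub_mem [CharZero K] [Finite G] {I : Ideal (SymmetricAlgebra K X)}
    {f : SymmetricAlgebra K X} (h : ∀ g ∈ G, symAct σ g f - f ∈ I) :
    reynolds σ G f - f ∈ I := by
  have := Fintype.ofFinite G
  have e : reynolds σ G f - f = (Nat.card G : K)⁻¹ • ∑ g : G, (symAct σ (g : A) f - f) := by
    rw [reynolds_apply, Finset.sum_sub_distrib, smul_sub, Finset.sum_const,
      Finset.card_univ, ← Nat.card_eq_fintype_card, ← Nat.cast_smul_eq_nsmul K, smul_smul,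
      inv_mul_cancel₀ natCard_ne_zero, one_smul]
  rw [e, Algebra.smul_def]
  exact I.mul_mem_left _ (I.sum_mem fun g _ => h g g.2)

variable (σ G)

/-- The polynomial `∏_{g ∈ G} (T - g b)`. -/
noncomputable def orbitPolynomial [Fintype G] (b : SymmetricAlgebra K X) :
    Polynomial (SymmetricAlgebra K X) :=
  ∏ g : G, (Polynomial.X - Polynomial.C (symAct σ (g : A) b))

variable {σ G}

lemma coeff_orbitPolynomial_mem [Fintype G] (b : SymmetricAlgebra K X) (n : ℕ) :
    (orbitPolynomial σ G b).coeff n ∈ invariantAlgebra σ G := by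
  intro h hh
  have : (orbitPolynomial σ G b).map (symAct σ h : _ →+* _) = orbitPolynomial σ G b := by
    rw [orbitPolynomial, Polynomial.map_prod]
    refine Fintype.prod_equiv (Equiv.mulLeft (⟨h, hh⟩ : G)) _ _ fun g => ?_
    simp [symAct_symAct]
  conv_rhs => rw [← this]
  rw [Polynomial.coeff_map]
  rfl

lemma monic_orbitPolynomial [Fintype G] (b : SymmetricAlgebra K X) :
    (orbitPolynomial σ G b).Monic :=
  Polynomial.monic_prod_of_monic _ _ fun _ _ => Polynomial.monic_X_sub_C _

lemma eval_orbitPolynomial [Fintype G] (b : SymmetricAlgebra K X) :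
    (orbitPolynomial σ G b).eval b = 0 := by
  rw [orbitPolynomial, Polynomial.eval_prod]
  exact Finset.prod_eq_zero (Finset.mem_univ 1) (by simp [symAct_one_apply])

/-- `S(X)` is a finitely generated module over `S(X)^G`. -/
lemma finite_invariantAlgebra [FiniteDimensional K X] [Finite G] :
    Module.Finite (invariantAlgebra σ G) (SymmetricAlgebra K X) := by
  have := Fintype.ofFinite G
  have hft : Algebra.FiniteType K (SymmetricAlgebra K X) :=
    Algebra.FiniteType.equiv inferInstance
      (SymmetricAlgebra.equivMvPolynomial (Module.finBasis K X)).symm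
  have : Algebra.FiniteType (invariantAlgebra σ G) (SymmetricAlgebra K X) :=
    .of_restrictScalars_finiteType K _ _
  have : Algebra.IsIntegral (invariantAlgebra σ G) (SymmetricAlgebra K X) := by
    refine ⟨fun b => ?_⟩
    have hl : orbitPolynomial σ G b ∈
        Polynomial.lifts (algebraMap (invariantAlgebra σ G) (SymmetricAlgebra K X)) := by
      rw [Polynomial.lifts_iff_coeff_lifts]
      exact fun n => ⟨⟨_, coeff_orbitPolynomial_mem b n⟩, rfl⟩
    obtain ⟨q, hq, -, hm⟩ :=
      Polynomial.lifts_and_natDegree_eq_and_monic hl (monic_orbitPolynomial b)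
    refine ⟨q, hm, ?_⟩
    rw [← Polynomial.eval_map, hq, eval_orbitPolynomial]
  exact Algebra.IsIntegral.finite

/-- An element of `G` that fixes every `L`-invariant polynomial belongs to `L`. For each linear
form `x` some `g l` with `l ∈ L` fixes `x`, and `X` is not a finite union of proper subspaces. -/
lemma mem_of_fixes_invariantAlgebra [Infinite K] {L : Subgroup A} [Finite L]
    (hσ : Function.Injective σ) {g : A}
    (hg : ∀ f ∈ invariantAlgebra σ L, symAct σ g f = f) : g ∈ L := by
  have := Fintype.ofFinite L
  have key : ∀ x : X, ∃ l : L, σ (g * l) x = x := by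
    intro x
    set b := SymmetricAlgebra.ι K X x
    have h1 : (orbitPolynomial σ L b).map (symAct σ g : _ →+* _) = orbitPolynomial σ L b := by
      ext n
      rw [Polynomial.coeff_map]
      exact hg _ (coeff_orbitPolynomial_mem b n)
    have h2 := eval_orbitPolynomial (σ := σ) (G := L) b
    rw [← h1, orbitPolynomial, Polynomial.map_prod, Polynomial.eval_prod,
      Finset.prod_eq_zero_iff] at h2
    obtain ⟨l, -, hl⟩ := h2
    refine ⟨l, ?_⟩
    have h3 : b = symAct σ (g * l) b := by
      rw [← symAct_symAct]
      simpa [sub_eq_zero] using hl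
    have h4 : SymmetricAlgebra.ι K X (σ (g * l) x) = SymmetricAlgebra.ι K X x := by
      rw [symAct_eq_symMap, symMap_ι] at h3
      exact h3.symm
    exact ι_injective h4
  obtain ⟨l, hl⟩ := Subspace.exists_eq_top_of_iUnion_eq_univ
    (p := fun l : L => LinearMap.ker (σ (g * l) - LinearMap.id)) (by
      rw [Set.eq_univ_iff_forall]
      intro x
      obtain ⟨l, hl⟩ := key x
      exact Set.mem_iUnion.2 ⟨l, sub_eq_zero.2 hl⟩)
  have : g * l = 1 := hσ (by
    rw [map_one]
    exact sub_eq_zero.1 (LinearMap.ker_eq_top.1 hl))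
  rw [eq_inv_of_mul_eq_one_left this]
  exact L.inv_mem l.2

end Invariants

/-! ### The dimension of the algebra of coinvariants -/

section Counting

variable {K : Type*} [Field K] {X : Type*} [AddCommGroup X] [Module K X]
  {A : Type*} [Group A] {σ : Representation K A X} {G : Subgroup A}

/-- A form of Nakayama's lemma: a homogeneous linear system with coefficient matrix `1 - M` has no
nonzero solution if the entries of `M` have no constant term. -/
lemma eq_zero_of_eq_sum_mul {k : Type*} [Fintype k]
    {M : k → k → SymmetricAlgebra K X} (hM : ∀ i j, SymmetricAlgebra.algebraMapInv (M i j) = 0)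
    {u : k → SymmetricAlgebra K X} (hu : ∀ i, u i = ∑ j, M i j * u j) : u = 0 := by
  classical
  let N : Matrix k k (SymmetricAlgebra K X) := 1 - Matrix.of M
  have hdet : N.det ≠ 0 := by
    intro h0
    have h1 := congrArg (SymmetricAlgebra.algebraMapInv : SymmetricAlgebra K X →ₐ[K] K) h0
    have h2 : (SymmetricAlgebra.algebraMapInv : SymmetricAlgebra K X →ₐ[K] K).mapMatrix N = 1 := by
      rw [map_sub, map_one, sub_eq_self]
      ext i j
      simpa using hM i j
    rw [AlgHom.map_det, h2] at h1
    simp at h1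
  refine Matrix.eq_zero_of_mulVec_eq_zero hdet ?_
  rw [Matrix.sub_mulVec, Matrix.one_mulVec, sub_eq_zero]
  ext1 i
  exact hu i

/-- Elements that are linearly independent over the invariants of `G` are at most `|G|` in number.
Otherwise some nonzero vector `c` would be orthogonal to all the vectors `(g e_i)_i`; multiplying
`c` by a suitable element and averaging gives a nonzero relation with invariant coefficients. -/
lemma card_le_of_invariant_independent [CharZero K] [Finite G] {n : ℕ}
    {e : Fin n → SymmetricAlgebra K X}
    (he : ∀ y : Fin n → SymmetricAlgebra K X, (∀ i, y i ∈ invariantAlgebra σ G) →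
      ∑ i, y i * e i = 0 → y = 0) : n ≤ Nat.card G := by
  classical
  have := Fintype.ofFinite G
  let F : (Fin n → SymmetricAlgebra K X) →ₗ[SymmetricAlgebra K X] (G → SymmetricAlgebra K X) :=
    Matrix.mulVecLin (Matrix.of fun (g : G) i => symAct σ (g : A) (e i))
  by_contra hn
  rw [Nat.card_eq_fintype_card] at hn
  have hF : ¬ Function.Injective F := by
    intro h
    have := card_le_of_injective (SymmetricAlgebra K X) F h
    simp at this
    omega
  rw [← LinearMap.ker_eq_bot, Submodule.eq_bot_iff] at hF
  push Not at hF
  obtain ⟨c, hc, hc0⟩ := hF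
  have hc1 : ∀ g ∈ G, ∑ i, c i * symAct σ g (e i) = 0 := by
    intro g hg
    have := congrFun (LinearMap.mem_ker.1 hc) ⟨g, hg⟩
    simpa [F, Matrix.mulVec, dotProduct, mul_comm] using this
  obtain ⟨i₀, hi₀⟩ := Function.ne_iff.1 hc0
  -- multiplication by `s` turns the coefficient of index `i₀` into its norm
  let s := ∏ g ∈ (Finset.univ : Finset G).erase 1, symAct σ (g : A) (c i₀)
  have hs : s * c i₀ = ∏ g : G, symAct σ (g : A) (c i₀) := by
    rw [← Finset.mul_prod_erase _ _ (Finset.mem_univ (1 : G)), mul_comm]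
    simp [s, symAct_one_apply]
  have hsne : s * c i₀ ≠ 0 := by
    rw [hs, Finset.prod_ne_zero_iff]
    intro g _ h0
    have := congrArg (symAct σ (g : A)⁻¹) h0
    rw [symAct_symAct, inv_mul_cancel, symAct_one_apply, map_zero] at this
    exact hi₀ this
  have hsinv : s * c i₀ ∈ invariantAlgebra σ G := by
    intro h hh
    rw [hs, map_prod]
    simp_rw [symAct_symAct]
    exact Fintype.prod_equiv (Equiv.mulLeft (⟨h, hh⟩ : G)) _ _ fun g => rfl
  have hrel : ∑ i, reynolds σ G (s * c i) * e i = 0 := by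
    have h1 : ∀ g : G, ∑ i, symAct σ (g : A) (s * c i) * e i = 0 := by
      intro g
      have h2 := congrArg (fun z => symAct σ (g : A) (s * z)) (hc1 (g⁻¹ : G) (g⁻¹ : G).2)
      simp only [mul_zero, map_zero, Finset.mul_sum, map_sum] at h2
      rw [← h2]
      refine Finset.sum_congr rfl fun i _ => ?_
      rw [← mul_assoc, map_mul _ (s * c i), symAct_symAct, ← Subgroup.coe_mul, mul_inv_cancel,
        Subgroup.coe_one, symAct_one_apply]
    simp_rw [reynolds_apply, smul_mul_assoc, Finset.sum_mul]
    rw [← Finset.smul_sum, Finset.sum_comm, Finset.sum_eq_zero fun g _ => h1 g, smul_zero]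
  have := congrFun (he _ (fun i => reynolds_mem _) hrel) i₀
  rw [reynolds_of_mem hsinv] at this
  exact hsne this

variable (K X) in
/-- The polynomials of degree less than `d`. -/
noncomputable def degreeLT (d : ℕ) : Submodule K (SymmetricAlgebra K X) :=
  ⨆ i : ℕ, ⨆ _ : i < d, symDegree K X i

lemma degreeLT_mono : Monotone (degreeLT K X) := fun _ _ h =>
  iSup₂_mono' fun i hi => ⟨i, hi.trans_le h, le_rfl⟩

lemma symDegree_le_degreeLT {i d : ℕ} (h : i < d) : symDegree K X i ≤ degreeLT K X d :=
  le_iSup₂_of_le i h le_rfl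

lemma exists_mem_degreeLT (f : SymmetricAlgebra K X) : ∃ d, f ∈ degreeLT K X d := by
  have hf : f ∈ ⨆ d, symDegree K X d := iSup_symDegree (K := K) (X := X) ▸ Submodule.mem_top
  induction hf using Submodule.iSup_induction' with
  | zero => exact ⟨0, Submodule.zero_mem _⟩
  | mem i x hx => exact ⟨i + 1, symDegree_le_degreeLT (Nat.lt_succ_self i) hx⟩
  | add a b _ _ ha hb =>
    obtain ⟨d, hd⟩ := ha
    obtain ⟨d', hd'⟩ := hb
    exact ⟨max d d', Submodule.add_mem _ (degreeLT_mono (le_max_left _ _) hd)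
      (degreeLT_mono (le_max_right _ _) hd')⟩

lemma mul_ι_mem_degreeLT {d : ℕ} {f : SymmetricAlgebra K X} (hf : f ∈ degreeLT K X d) (x : X) :
    f * SymmetricAlgebra.ι K X x ∈ degreeLT K X (d + 1) := by
  have hle : degreeLT K X d ≤ (degreeLT K X (d + 1)).comap
      (LinearMap.mulRight K (SymmetricAlgebra.ι K X x)) := by
    refine iSup₂_le fun i hi a ha => ?_
    refine symDegree_le_degreeLT (Nat.succ_lt_succ hi) ?_
    rw [symDegree, pow_succ]
    exact Submodule.mul_mem_mul ha ⟨x, rfl⟩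
  exact hle hf

/-- Demazure's divided difference: if `θ` is the identity up to multiples of `l`, then
`θ f - f` is divisible by `l`, with a quotient of smaller degree. -/
lemma exists_divided_difference {θ : X →ₗ[K] X} {φ : Dual K X} {l : X}
    (hθ : ∀ x, θ x = x + φ x • l) {d : ℕ} {f : SymmetricAlgebra K X}
    (hf : f ∈ degreeLT K X (d + 1)) :
    ∃ q ∈ degreeLT K X d, symMap θ f = f + SymmetricAlgebra.ι K X l * q := by
  have key : ∀ i, ∀ f ∈ symDegree K X i, ∃ q ∈ degreeLT K X i,
      symMap θ f = f + SymmetricAlgebra.ι K X l * q := by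
    intro i
    induction i with
    | zero =>
      intro f hf
      rw [symDegree, pow_zero] at hf
      obtain ⟨r, rfl⟩ := Submodule.mem_one.1 hf
      exact ⟨0, Submodule.zero_mem _, by simp⟩
    | succ i ih =>
      intro f hf
      rw [symDegree, pow_succ] at hf
      induction hf using Submodule.mul_induction_on' with
      | add x _ y _ hx hy =>
        obtain ⟨q, hq, h⟩ := hx
        obtain ⟨q', hq', h'⟩ := hy
        exact ⟨q + q', Submodule.add_mem _ hq hq', by rw [map_add, h, h']; ring⟩
      | mem_mul_mem a ha b hb =>
        obtain ⟨x, rfl⟩ := hb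
        obtain ⟨q, hq, h⟩ := ih a ha
        refine ⟨q * SymmetricAlgebra.ι K X x + φ x • a +
          φ x • (q * SymmetricAlgebra.ι K X l), ?_, ?_⟩
        · refine Submodule.add_mem _ (Submodule.add_mem _ (mul_ι_mem_degreeLT hq x) ?_) ?_
          · exact Submodule.smul_mem _ _ (symDegree_le_degreeLT (Nat.lt_succ_self i) ha)
          · exact Submodule.smul_mem _ _ (mul_ι_mem_degreeLT hq l)
        · rw [map_mul, h, symMap_ι, hθ, map_add, map_smul, Algebra.smul_def, Algebra.smul_def,
            Algebra.smul_def]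
          ring
  have hle : degreeLT K X (d + 1) ≤ Submodule.comap
      ((symMap θ).toLinearMap - LinearMap.id) ((degreeLT K X d).map
        (LinearMap.mulLeft K (SymmetricAlgebra.ι K X l))) := by
    refine iSup₂_le fun i hi a ha => ?_
    obtain ⟨q, hq, h⟩ := key i a ha
    exact ⟨q, degreeLT_mono (Nat.lt_succ_iff.1 hi) hq, by simp [h]⟩
  obtain ⟨q, hq, h⟩ := hle hf
  refine ⟨q, hq, ?_⟩
  simp only [LinearMap.mulLeft_apply, LinearMap.sub_apply, AlgHom.toLinearMap_apply,
    LinearMap.id_apply] at h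
  rw [h]; ring

variable (σ G) in
/-- The operators by which `G` acts are products of operators from `G` of the form
`x ↦ x + φ(x) l`, that is, of (pseudo)reflections and identities. -/
def ActsByReflections : Prop :=
  ∀ g ∈ G, σ g ∈ Submonoid.closure
    {T : End K X | (∃ s ∈ G, σ s = T) ∧ ∃ (φ : Dual K X) (l : X), ∀ x, T x = x + φ x • l}

/-- An element that is fixed by the reflections in `G` modulo the coinvariant ideal is fixed by `G`
modulo this ideal. -/
lemma ActsByReflections.symAct_sub_mem (hgen : ActsByReflections σ G) {f : SymmetricAlgebra K X}
    (hf : ∀ s ∈ G, (∃ (φ : Dual K X) (l : X), ∀ x, σ s x = x + φ x • l) →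
      symAct σ s f - f ∈ coinvariantIdeal σ G) :
    ∀ g ∈ G, symAct σ g f - f ∈ coinvariantIdeal σ G := by
  intro g hg
  have key : ∀ T ∈ Submonoid.closure
      {T : End K X | (∃ s ∈ G, σ s = T) ∧ ∃ (φ : Dual K X) (l : X), ∀ x, T x = x + φ x • l},
      (∃ s ∈ G, σ s = T) ∧ symMap T f - f ∈ coinvariantIdeal σ G := by
    intro T hT
    induction hT using Submonoid.closure_induction with
    | mem T hT =>
      obtain ⟨⟨s, hs, rfl⟩, h⟩ := hT
      exact ⟨⟨s, hs, rfl⟩, hf s hs h⟩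
    | one =>
      refine ⟨⟨1, G.one_mem, map_one σ⟩, ?_⟩
      have : symMap (1 : End K X) f = f := symMap_id f
      simp [this]
    | mul T T' _ _ h h' =>
      obtain ⟨⟨s, hs, rfl⟩, h⟩ := h
      obtain ⟨⟨s', hs', rfl⟩, h'⟩ := h'
      refine ⟨⟨s * s', G.mul_mem hs hs', map_mul σ s s'⟩, ?_⟩
      have e : symMap (σ s * σ s') f - f
          = symAct σ s (symMap (σ s') f - f) + (symMap (σ s) f - f) := by
        rw [map_sub, symAct_eq_symMap, symMap_symMap]
        change symMap (σ s ∘ₗ σ s') f - f = _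
        ring
      rw [e]
      exact Ideal.add_mem _ (symAct_mem_coinvariantIdeal_of_mem hs h') h
  exact (key _ (hgen g hg)).2

/-- Chevalley's lemma: a relation `∑ y_i z_i = 0` with invariant `y_i` yields, for each `K`-valued
functional `φ` that is semilinear over the invariants on the module generated by the `y_i`, a
relation `∑ φ(y_i) z_i ≡ 0` modulo the invariants without constant term. The induction on
the degree of the `z_i` uses divided differences. -/
lemma sum_smul_mem_coinvariantIdeal [CharZero K] [Finite G] (hgen : ActsByReflections σ G) {n : ℕ}
    {y : Fin n → SymmetricAlgebra K X} (hy : ∀ i, y i ∈ invariantAlgebra σ G)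
    (φ : SymmetricAlgebra K X →ₗ[K] K)
    (hφ : ∀ i, ∀ a ∈ invariantAlgebra σ G,
      φ (a * y i) = SymmetricAlgebra.algebraMapInv a * φ (y i))
    (d : ℕ) (z : Fin n → SymmetricAlgebra K X) (hz : ∀ i, z i ∈ degreeLT K X d)
    (hyz : ∑ i, y i * z i = 0) : ∑ i, φ (y i) • z i ∈ coinvariantIdeal σ G := by
  induction d generalizing z with
  | zero =>
    have hz0 : ∀ i, z i = 0 := fun i => by simpa [degreeLT] using hz i
    simp [hz0]
  | succ d ih =>
    set w := ∑ i, φ (y i) • z i with hw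
    have h1 : ∀ g ∈ G, symAct σ g w - w ∈ coinvariantIdeal σ G := by
      refine hgen.symAct_sub_mem fun s hs ⟨ψ, l, hl⟩ => ?_
      choose q hq hzq using fun i => exists_divided_difference hl (hz i)
      have hlq : SymmetricAlgebra.ι K X l * ∑ i, y i * q i = 0 := by
        have h2 := congrArg (symAct σ s) hyz
        rw [map_sum, map_zero] at h2
        have h3 : ∑ i, symAct σ s (y i * z i)
            = ∑ i, y i * z i + SymmetricAlgebra.ι K X l * ∑ i, y i * q i := by
          rw [Finset.mul_sum, ← Finset.sum_add_distrib]
          refine Finset.sum_congr rfl fun i _ => ?_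
          rw [map_mul, hy i s hs, symAct_eq_symMap, hzq]
          ring
        rwa [h3, hyz, zero_add] at h2
      have hdiff : symAct σ s w - w = SymmetricAlgebra.ι K X l * ∑ i, φ (y i) • q i := by
        rw [hw, map_sum, Finset.mul_sum, ← Finset.sum_sub_distrib]
        refine Finset.sum_congr rfl fun i _ => ?_
        rw [map_smul, symAct_eq_symMap, hzq, smul_add, add_sub_cancel_left, mul_smul_comm]
      rcases mul_eq_zero.1 hlq with h0 | h0
      · rw [hdiff, h0, zero_mul]; exact Ideal.zero_mem _
      · rw [hdiff]; exact Ideal.mul_mem_left _ _ (ih q hq h0)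
    have h2 : SymmetricAlgebra.algebraMapInv (reynolds σ G w) = 0 := by
      have : φ (reynolds σ G (∑ i, y i * z i)) = 0 := by rw [hyz, map_zero, map_zero]
      rw [map_sum, map_sum] at this
      rw [algebraMapInv_reynolds, hw, map_sum, ← this]
      refine Finset.sum_congr rfl fun i _ => ?_
      rw [reynolds_mul (hy i), mul_comm (y i), hφ i _ (reynolds_mem _), algebraMapInv_reynolds,
        map_smul, smul_eq_mul, mul_comm]
    have h3 : reynolds σ G w ∈ coinvariantIdeal σ G :=
      posInvariants_le_coinvariantIdeal ⟨reynolds_mem w, h2⟩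
    have h4 := Ideal.sub_mem _ h3 (reynolds_sub_mem h1)
    simpa using h4

/-- For a group generated by reflections, elements whose classes in the algebra of coinvariants are
linearly independent are linearly independent over the invariants. In a nontrivial relation some
coefficient is, by Nakayama's lemma, not in the span of the multiples of the coefficients by
invariants without constant term; a functional that separates it from this span turns the relation
into a linear relation between the classes. -/
lemma invariant_independent_of_linearIndependent [CharZero K] [Finite G]
    (hgen : ActsByReflections σ G) {n : ℕ} {e : Fin n → SymmetricAlgebra K X}
    (he : LinearIndependent K fun i => coinvariantMk σ G (e i))
    (y : Fin n → SymmetricAlgebra K X) (hy : ∀ i, y i ∈ invariantAlgebra σ G)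
    (hye : ∑ i, y i * e i = 0) : y = 0 := by
  classical
  let 𝔪y : Submodule K (SymmetricAlgebra K X) :=
    Submodule.span K {f | ∃ i, ∃ m ∈ posInvariants σ G, f = m * y i}
  by_cases hall : ∀ i, y i ∈ 𝔪y
  · have hsum : ∀ f ∈ 𝔪y, ∃ m : Fin n → SymmetricAlgebra K X,
        (∀ j, m j ∈ posInvariants σ G) ∧ f = ∑ j, m j * y j := by
      intro f hf
      induction hf using Submodule.span_induction with
      | mem f hf =>
        obtain ⟨i, m, hm, rfl⟩ := hf
        refine ⟨Pi.single i m, fun j => ?_, ?_⟩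
        · by_cases h : j = i
          · subst h; simpa using hm
          · simp [h]
        · rw [Finset.sum_eq_single i] <;> simp +contextual
      | zero => exact ⟨0, fun _ => Submodule.zero_mem _, by simp⟩
      | add a b _ _ ha hb =>
        obtain ⟨m, hm, rfl⟩ := ha
        obtain ⟨m', hm', rfl⟩ := hb
        exact ⟨m + m', fun j => Submodule.add_mem _ (hm j) (hm' j), by
          simp [add_mul, Finset.sum_add_distrib]⟩
      | smul c a _ ha =>
        obtain ⟨m, hm, rfl⟩ := ha
        exact ⟨c • m, fun j => Submodule.smul_mem _ _ (hm j), by simp [Finset.smul_sum]⟩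
    choose M hM hyM using fun i => hsum (y i) (hall i)
    exact eq_zero_of_eq_sum_mul (fun i j => (hM i j).2) hyM
  · push Not at hall
    obtain ⟨i₀, hi₀⟩ := hall
    obtain ⟨φ, hφ0, hφ⟩ := Submodule.exists_le_ker_of_notMem hi₀
    exfalso
    have hφ' : ∀ i, ∀ a ∈ invariantAlgebra σ G,
        φ (a * y i) = SymmetricAlgebra.algebraMapInv a * φ (y i) := by
      intro i a ha
      have h1 : (a - algebraMap K _ (SymmetricAlgebra.algebraMapInv a)) * y i ∈ 𝔪y :=
        Submodule.subset_span ⟨i, _, sub_algebraMapInv_mem_posInvariants ha, rfl⟩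
      have h2 := LinearMap.mem_ker.1 (hφ h1)
      rw [sub_mul, map_sub, sub_eq_zero, ← Algebra.smul_def, map_smul, smul_eq_mul] at h2
      exact h2
    choose d hd using fun i => exists_mem_degreeLT (e i)
    have h3 := sum_smul_mem_coinvariantIdeal hgen hy φ hφ' (Finset.univ.sup d) e
      (fun i => degreeLT_mono (Finset.le_sup (Finset.mem_univ i)) (hd i)) hye
    rw [← coinvariantMk_eq_zero, map_sum] at h3
    simp_rw [map_smul] at h3
    exact hφ0 (Fintype.linearIndependent_iff.1 he _ h3 i₀)

/-- Chevalley: the algebra of coinvariants of a finite reflection group has dimension at most the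
order of the group. -/
theorem rank_coinvariants_le [CharZero K] [Finite G] (hgen : ActsByReflections σ G) :
    Module.rank K (Coinvariants σ G) ≤ (Nat.card G : ℕ) := by
  refine rank_le fun s hs => ?_
  let e' := s.equivFin.symm
  choose e he using fun i => coinvariantMk_surjective (σ := σ) (G := G) (e' i : Coinvariants σ G)
  have hli : LinearIndependent K fun i => coinvariantMk σ G (e i) := by
    simp_rw [he]
    exact hs.comp _ e'.injective
  exact card_le_of_invariant_independent (invariant_independent_of_linearIndependent hgen hli)

/-- The lower bound for the dimension of `(S_G)^L`: elements `x_j` of `S^L` that span it modulo the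
coinvariant ideal of `G` are at least as numerous as any set `Q` of elements of `G` which induce
distinct maps on `S^L`. With fewer of them, a combination of the maps from `Q` would vanish on all
`x_j`, hence on `S^L` by Nakayama's lemma, against the independence of characters. -/
lemma card_le_of_span_invariants [CharZero K] [FiniteDimensional K X] [Finite G]
    {L : Subgroup A} [Finite L] (hLG : L ≤ G) {Q : Type*} [Fintype Q] (r : Q → A)
    (hrG : ∀ q, r q ∈ G)
    (hr : ∀ q q', (∀ f ∈ invariantAlgebra σ L, symAct σ (r q) f = symAct σ (r q') f) → q = q')
    {n : ℕ} {x : Fin n → SymmetricAlgebra K X}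
    (hspan : ∀ f ∈ invariantAlgebra σ L, ∃ c : Fin n → K,
      f - ∑ j, c j • x j ∈ coinvariantIdeal σ G) (hxL : ∀ j, x j ∈ invariantAlgebra σ L) :
    Fintype.card Q ≤ n := by
  classical
  by_contra hn
  let F : (Q → SymmetricAlgebra K X) →ₗ[SymmetricAlgebra K X] (Fin n → SymmetricAlgebra K X) :=
    Matrix.mulVecLin (Matrix.of fun i q => symAct σ (r q) (x i))
  have hF : ¬ Function.Injective F := by
    intro h
    have := card_le_of_injective (SymmetricAlgebra K X) F h
    simp at this
    omega
  rw [← LinearMap.ker_eq_bot, Submodule.eq_bot_iff] at hF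
  push Not at hF
  obtain ⟨c, hc, hc0⟩ := hF
  have hc1 : ∀ j, ∑ q, c q * symAct σ (r q) (x j) = 0 := by
    intro j
    have := congrFun (LinearMap.mem_ker.1 hc) j
    simpa [F, Matrix.mulVec, dotProduct, mul_comm] using this
  have hGL : invariantAlgebra σ G ≤ invariantAlgebra σ L := fun f hf l hl => hf l (hLG hl)
  obtain ⟨k, t, ht⟩ := (finite_invariantAlgebra (σ := σ) (G := G)).exists_fin
  have htspan : ∀ f, ∃ a : Fin k → SymmetricAlgebra K X,
      (∀ i, a i ∈ invariantAlgebra σ G) ∧ f = ∑ i, a i * t i := by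
    intro f
    have hf : f ∈ Submodule.span (invariantAlgebra σ G) (Set.range t) := ht ▸ Submodule.mem_top
    obtain ⟨a, ha⟩ := (Submodule.mem_span_range_iff_exists_fun _).1 hf
    exact ⟨fun i => a i, fun i => (a i).2, ha.symm⟩
  let t' := fun i => reynolds σ L (t i)
  have ht' : ∀ i, t' i ∈ invariantAlgebra σ L := fun i => reynolds_mem _
  have hspan' : ∀ f, ∃ a : Fin k → SymmetricAlgebra K X,
      (∀ i, a i ∈ invariantAlgebra σ G) ∧ reynolds σ L f = ∑ i, a i * t' i := by
    intro f
    obtain ⟨a, ha, rfl⟩ := htspan f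
    refine ⟨a, ha, ?_⟩
    rw [map_sum]
    exact Finset.sum_congr rfl fun i _ => reynolds_mul (hGL (ha i)) _
  have hIspan : ∀ f ∈ coinvariantIdeal σ G, ∀ s, ∃ m : Fin k → SymmetricAlgebra K X,
      (∀ i, m i ∈ posInvariants σ G) ∧ reynolds σ L (s * f) = ∑ i, m i * t' i := by
    intro f hf
    induction hf using Submodule.span_induction with
    | mem p hp =>
      intro s
      obtain ⟨hp1, hp2⟩ := mem_posInvariants.1 hp
      obtain ⟨a, ha, h1⟩ := hspan' s
      refine ⟨fun i => p * a i, fun i => ⟨Subalgebra.mul_mem _ hp1 (ha i), by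
        rw [map_mul, hp2, zero_mul]⟩, ?_⟩
      rw [mul_comm, reynolds_mul (hGL hp1), h1, Finset.mul_sum]
      simp [mul_assoc]
    | zero => exact fun _ => ⟨0, fun _ => Submodule.zero_mem _, by simp⟩
    | add a b _ _ ha hb =>
      intro s
      obtain ⟨m, hm, h⟩ := ha s
      obtain ⟨m', hm', h'⟩ := hb s
      exact ⟨m + m', fun j => Submodule.add_mem _ (hm j) (hm' j), by
        simp [h, h', add_mul, mul_add, Finset.sum_add_distrib]⟩
    | smul s' a ha hm =>
      intro s
      obtain ⟨m, hm, h⟩ := hm (s * s')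
      exact ⟨m, hm, by rw [← h, smul_eq_mul, mul_assoc]⟩
  choose b hb using fun i => hspan (t' i) (ht' i)
  choose M hM hMt using fun i => hIspan _ (hb i) 1
  have ht'M : ∀ i, t' i = ∑ j, b i j • x j + ∑ j, M i j * t' j := by
    intro i
    have hmem : t' i - ∑ j, b i j • x j ∈ invariantAlgebra σ L :=
      Subalgebra.sub_mem _ (ht' i)
        (Subalgebra.sum_mem _ fun j _ => Subalgebra.smul_mem _ (hxL j) _)
    rw [← hMt, one_mul, reynolds_of_mem hmem]
    ring
  -- the vanishing combination of the maps from `Q` also kills the generators `t'` of `S^L`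
  have hu : (fun i => ∑ q, c q * symAct σ (r q) (t' i)) = 0 := by
    refine eq_zero_of_eq_sum_mul (fun i j => (hM i j).2) fun i => ?_
    have h1 : ∀ q, symAct σ (r q) (t' i)
        = ∑ j, b i j • symAct σ (r q) (x j) + ∑ j, M i j * symAct σ (r q) (t' j) := by
      intro q
      conv_lhs => rw [ht'M i]
      rw [map_add, map_sum, map_sum]
      congr 1
      · exact Finset.sum_congr rfl fun j _ => map_smul _ _ _
      · exact Finset.sum_congr rfl fun j _ => by rw [map_mul, (hM i j).1 _ (hrG q)]
    have h2 : ∑ q, c q * ∑ j, b i j • symAct σ (r q) (x j) = 0 := by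
      simp_rw [Finset.mul_sum]
      rw [Finset.sum_comm]
      refine Finset.sum_eq_zero fun j _ => ?_
      simp_rw [mul_smul_comm]
      rw [← Finset.smul_sum, hc1, smul_zero]
    calc ∑ q, c q * symAct σ (r q) (t' i)
        = ∑ q, c q * ∑ j, M i j * symAct σ (r q) (t' j) := by
          simp_rw [h1, mul_add, Finset.sum_add_distrib]
          rw [h2, zero_add]
      _ = ∑ j, M i j * ∑ q, c q * symAct σ (r q) (t' j) := by
          simp_rw [Finset.mul_sum]
          rw [Finset.sum_comm]
          exact Finset.sum_congr rfl fun j _ => Finset.sum_congr rfl fun q _ => by ring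
  have hall : ∀ f ∈ invariantAlgebra σ L, ∑ q, c q * symAct σ (r q) f = 0 := by
    intro f hf
    obtain ⟨a, ha, h⟩ := hspan' f
    rw [reynolds_of_mem hf] at h
    have h1 : ∀ q, symAct σ (r q) f = ∑ i, a i * symAct σ (r q) (t' i) := by
      intro q
      rw [h, map_sum]
      exact Finset.sum_congr rfl fun i _ => by rw [map_mul, ha i _ (hrG q)]
    calc ∑ q, c q * symAct σ (r q) f
        = ∑ i, a i * ∑ q, c q * symAct σ (r q) (t' i) := by
          simp_rw [h1, Finset.mul_sum]
          rw [Finset.sum_comm]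
          exact Finset.sum_congr rfl fun j _ => Finset.sum_congr rfl fun q _ => by ring
      _ = 0 := Finset.sum_eq_zero fun i _ => by
          have := congrFun hu i
          rw [Pi.zero_apply] at this
          rw [this, mul_zero]
  let ev : Q → (invariantAlgebra σ L →* SymmetricAlgebra K X) := fun q =>
    ((symAct σ (r q)).comp (invariantAlgebra σ L).val : _ →* _)
  have hev : Function.Injective ev := fun q q' h =>
    hr q q' fun f hf => DFunLike.congr_fun h ⟨f, hf⟩
  have hli := (linearIndependent_monoidHom (invariantAlgebra σ L) (SymmetricAlgebra K X)).comp
    ev hev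
  refine hc0 (funext fun q => Fintype.linearIndependent_iff.1 hli c ?_ q)
  ext1 f
  have := hall f f.2
  rw [Finset.sum_apply]
  exact this

end Counting

/-! ### The apolar pairing of polynomials -/

section Fischer

open MvPolynomial

variable {R : Type*} [CommRing R] {ι ι' ι'' : Type*} [Fintype ι'] [Fintype ι'']

/-- The linear substitution `x_j ↦ ∑ i, B_ij x_i`. -/
noncomputable def linSubst (B : Matrix ι' ι R) : MvPolynomial ι R →ₐ[R] MvPolynomial ι' R :=
  aeval fun j => ∑ i, B i j • X i

@[simp]
lemma linSubst_X (B : Matrix ι' ι R) (j : ι) : linSubst B (X j) = ∑ i, B i j • X i := by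
  simp [linSubst]

lemma linSubst_linSubst (B : Matrix ι'' ι' R) (C : Matrix ι' ι R) (f : MvPolynomial ι R) :
    linSubst B (linSubst C f) = linSubst (B * C) f := by
  have : (linSubst B).comp (linSubst C) = linSubst (B * C) := by
    ext1 j
    simp only [AlgHom.comp_apply, linSubst_X, map_sum, map_smul, Finset.smul_sum, smul_smul,
      Matrix.mul_apply, Finset.sum_smul]
    rw [Finset.sum_comm]
    simp_rw [mul_comm]
  exact DFunLike.congr_fun this f

lemma linSubst_one [Fintype ι] [DecidableEq ι] (f : MvPolynomial ι R) :
    linSubst (1 : Matrix ι ι R) f = f := by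
  have : linSubst (1 : Matrix ι ι R) = AlgHom.id R _ := by
    ext1 j
    simp [Matrix.one_apply]
  exact DFunLike.congr_fun this f

lemma map_linSubst {R' : Type*} [CommRing R'] (φ : R →+* R') (B : Matrix ι' ι R)
    (f : MvPolynomial ι R) : map φ (linSubst B f) = linSubst (B.map φ) (map φ f) := by
  induction f using MvPolynomial.induction_on with
  | C r => simp [← algebraMap_eq]
  | add a b ha hb => simp [ha, hb]
  | mul_X a j h => simp [h, smul_eq_C_mul]

lemma constantCoeff_linSubst (B : Matrix ι' ι R) (f : MvPolynomial ι R) :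
    constantCoeff (linSubst B f) = constantCoeff f := by
  induction f using MvPolynomial.induction_on with
  | C r => simp [← algebraMap_eq]
  | add a b ha hb => simp [ha, hb]
  | mul_X a j h => simp [smul_eq_C_mul]

variable [Fintype ι]

variable (R ι) in
/-- The apolar (Fischer) pairing `⟨q, f⟩ = ∑_μ μ! q_μ f_μ`, which is the constant term
of `q(∂) f`. -/
noncomputable def fischer : MvPolynomial ι R →ₗ[R] MvPolynomial ι R →ₗ[R] R :=
  ((basisMonomials ι R).constr R).toLinearMap ∘ₗ
    LinearMap.pi fun μ : ι →₀ ℕ => ((∏ i, (μ i).factorial : ℕ) : R) • lcoeff R μ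

lemma fischer_monomial_right (q : MvPolynomial ι R) (μ : ι →₀ ℕ) (c : R) :
    fischer R ι q (monomial μ c) = ((∏ i, (μ i).factorial : ℕ) : R) * coeff μ q * c := by
  have h : (monomial μ c : MvPolynomial ι R) = c • basisMonomials ι R μ := by
    rw [coe_basisMonomials, smul_monomial, smul_eq_mul, mul_one]
  rw [h, map_smul, fischer, LinearMap.comp_apply, LinearEquiv.coe_coe, Basis.constr_basis]
  simp [mul_comm]

lemma fischer_comm (q f : MvPolynomial ι R) : fischer R ι q f = fischer R ι f q := by
  classical
  induction q using MvPolynomial.induction_on' with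
  | add a b ha hb => simp [ha, hb]
  | monomial μ c =>
    induction f using MvPolynomial.induction_on' with
    | add a b ha hb => simp [ha, hb]
    | monomial ν d =>
      rw [fischer_monomial_right, fischer_monomial_right, coeff_monomial, coeff_monomial]
      by_cases h : μ = ν
      · subst h; simp; ring
      · simp [h, Ne.symm h]

lemma fischer_one_left (f : MvPolynomial ι R) : fischer R ι 1 f = constantCoeff f := by
  rw [fischer_comm, ← C_1, ← monomial_zero', fischer_monomial_right]
  simp [constantCoeff_eq]

/-- Multiplication by a variable is adjoint to the partial derivative. -/
lemma fischer_mul_X (i : ι) (q f : MvPolynomial ι R) :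
    fischer R ι (q * X i) f = fischer R ι q (pderiv i f) := by
  classical
  induction f using MvPolynomial.induction_on' with
  | add a b ha hb => simp [ha, hb]
  | monomial ν d =>
    rw [pderiv_monomial, fischer_monomial_right, fischer_monomial_right, coeff_mul_X']
    by_cases h : i ∈ ν.support
    · rw [if_pos h]
      have h1 : ν = (ν - Finsupp.single i 1) + Finsupp.single i 1 := by
        ext j
        by_cases hj : j = i
        · subst hj
          have := Nat.pos_of_ne_zero (Finsupp.mem_support_iff.1 h)
          simp; omega
        · simp [Ne.symm hj]
      set μ := ν - Finsupp.single i 1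
      have h2 : (∏ j, (ν j).factorial) = (∏ j, (μ j).factorial) * ν i := by
        rw [h1, ← Finset.mul_prod_erase _ _ (Finset.mem_univ i),
          ← Finset.mul_prod_erase (Finset.univ) (fun j => (μ j).factorial) (Finset.mem_univ i),
          Finset.prod_congr rfl (g := fun j => (μ j).factorial)]
        · simp [Nat.factorial_succ]; ring
        · intro j hj
          simp [Ne.symm (Finset.ne_of_mem_erase hj)]
      rw [h2]
      push_cast
      ring
    · rw [if_neg h, Finsupp.notMem_support_iff.1 h]
      simp

lemma fischer_map {R' : Type*} [CommRing R'] (φ : R →+* R') (q f : MvPolynomial ι R) :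
    fischer R' ι (map φ q) (map φ f) = φ (fischer R ι q f) := by
  induction f using MvPolynomial.induction_on' with
  | add a b ha hb => simp [ha, hb]
  | monomial ν d => simp [fischer_monomial_right, coeff_map]

lemma fischer_nondegenerate [IsDomain R] [CharZero R] {f : MvPolynomial ι R}
    (h : ∀ q, fischer R ι q f = 0) : f = 0 := by
  ext μ
  have := h (monomial μ 1)
  rw [fischer_comm, fischer_monomial_right, mul_one] at this
  rw [coeff_zero]
  refine (mul_eq_zero.1 this).resolve_left ?_
  refine Nat.cast_ne_zero.2 ?_
  exact Finset.prod_ne_zero_iff.2 fun i _ => Nat.factorial_ne_zero _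

lemma pderiv_linSubst (B : Matrix ι' ι R) (i : ι') (f : MvPolynomial ι R) :
    pderiv i (linSubst B f) = ∑ j, B i j • linSubst B (pderiv j f) := by
  classical
  induction f using MvPolynomial.induction_on with
  | C r => simp [← algebraMap_eq]
  | add a b ha hb => simp [ha, hb, Finset.sum_add_distrib]
  | mul_X a k h =>
    simp only [map_mul, Derivation.leibniz, smul_eq_mul, map_add, smul_add,
      Finset.sum_add_distrib, h, linSubst_X, pderiv_X]
    congr 1
    · simp [map_sum, Derivation.map_smul, pderiv_X, Pi.single_apply, mul_comm]
    · rw [Finset.mul_sum]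
      exact Finset.sum_congr rfl fun j _ => by rw [mul_smul_comm]

/-- A linear substitution is adjoint to the transposed one. -/
lemma fischer_linSubst (B : Matrix ι' ι R) (q : MvPolynomial ι' R) (f : MvPolynomial ι R) :
    fischer R ι' q (linSubst B f) = fischer R ι (linSubst B.transpose q) f := by
  induction q using MvPolynomial.induction_on generalizing f with
  | C r =>
    have e : (C r : MvPolynomial ι' R) = r • 1 := by rw [smul_eq_C_mul, mul_one]
    rw [e, map_smul, map_smul, map_smul, map_one (linSubst B.transpose),
      LinearMap.smul_apply, LinearMap.smul_apply,
      fischer_one_left, fischer_one_left, constantCoeff_linSubst]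
  | add a b ha hb => simp [ha, hb]
  | mul_X a i h =>
    rw [fischer_mul_X, pderiv_linSubst, map_mul, linSubst_X, map_sum, Finset.mul_sum, map_sum,
      LinearMap.sum_apply]
    refine Finset.sum_congr rfl fun j _ => ?_
    rw [map_smul, h, Matrix.transpose_apply, mul_smul_comm, map_smul, LinearMap.smul_apply,
      fischer_mul_X]

end Fischer

/-! ### The coinvariant ideal and the orthogonal of the dual one meet in zero -/

section Positivity

open MvPolynomial ComplexConjugate

variable {ι : Type*} [Fintype ι] [DecidableEq ι] {Γ : Type*} [Group Γ] [Fintype Γ]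

/-- The sum over the orbit of a polynomial under a matrix group. -/
noncomputable def orbitSum {R : Type*} [CommRing R] (a : Γ →* Matrix ι ι R)
    (p : MvPolynomial ι R) : MvPolynomial ι R := ∑ g, linSubst (a g) p

/-- The sum over the orbit of a polynomial under the contragredient matrix group. -/
noncomputable def dualOrbitSum {R : Type*} [CommRing R] (a : Γ →* Matrix ι ι R)
    (p : MvPolynomial ι R) : MvPolynomial ι R := ∑ g, linSubst (a g⁻¹).transpose p

lemma map_orbitSum {R R' : Type*} [CommRing R] [CommRing R'] (φ : R →+* R')
    (a : Γ →* Matrix ι ι R) (p : MvPolynomial ι R) :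
    map φ (orbitSum a p)
      = orbitSum ((φ.mapMatrix : Matrix ι ι R →+* Matrix ι ι R').toMonoidHom.comp a) (map φ p) := by
  simp [orbitSum, map_sum, map_linSubst]

lemma map_dualOrbitSum {R R' : Type*} [CommRing R] [CommRing R'] (φ : R →+* R')
    (a : Γ →* Matrix ι ι R) (p : MvPolynomial ι R) :
    map φ (dualOrbitSum a p)
      = dualOrbitSum ((φ.mapMatrix : Matrix ι ι R →+* Matrix ι ι R').toMonoidHom.comp a)
        (map φ p) := by
  simp [dualOrbitSum, map_sum, map_linSubst, Matrix.transpose_map]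

lemma fischer_conj_self_eq_zero {κ : Type*} [Fintype κ] {h : MvPolynomial κ ℂ}
    (h0 : fischer ℂ κ (map (starRingEnd ℂ) h) h = 0) : h = 0 := by
  have e : fischer ℂ κ (map (starRingEnd ℂ) h) h = ((∑ μ ∈ h.support,
      ((∏ i, (μ i).factorial : ℕ) : ℝ) * Complex.normSq (coeff μ h) : ℝ) : ℂ) := by
    conv_lhs => rw [h.as_sum, map_sum]
    push_cast
    refine Finset.sum_congr rfl fun μ _ => ?_
    rw [fischer_monomial_right, ← h.as_sum, coeff_map, mul_assoc, Complex.normSq_eq_conj_mul_self]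
    push_cast
    rfl
  rw [e, Complex.ofReal_eq_zero, Finset.sum_eq_zero_iff_of_nonneg fun μ _ =>
    mul_nonneg (Nat.cast_nonneg _) (Complex.normSq_nonneg _)] at h0
  ext μ
  rw [coeff_zero]
  by_contra hμ
  have := h0 μ (mem_support_iff.2 hμ)
  rcases mul_eq_zero.1 this with h1 | h1
  · exact (Finset.prod_ne_zero_iff.2 fun i _ => Nat.factorial_ne_zero (μ i))
      (Nat.cast_eq_zero.1 h1)
  · exact hμ (Complex.normSq_eq_zero.1 h1)

/-- Over `ℂ`, an element of the ideal spanned by the invariants without constant term vanishes if it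
is orthogonal to the corresponding ideal of the dual group. The apolar pairing becomes positive
definite when combined with complex conjugation and an invariant Hermitian form `∑_g a(g)ᴴ a(g)`,
and the conjugate linear map so obtained carries invariants to invariants of the dual group, hence
the element to one orthogonal to it. -/
lemma eq_zero_of_orthogonal_complex (a : Γ →* Matrix ι ι ℂ) {n : ℕ}
    (c p : Fin n → MvPolynomial ι ℂ) (hp : ∀ k, constantCoeff (p k) = 0)
    (h : ∀ μ ν : ι →₀ ℕ, μ ≠ 0 →
      fischer ℂ ι (monomial ν 1 * dualOrbitSum a (monomial μ 1))
        (∑ k, c k * orbitSum a (p k)) = 0) :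
    ∑ k, c k * orbitSum a (p k) = 0 := by
  classical
  obtain ⟨f, hf⟩ : ∃ f, f = ∑ k, c k * orbitSum a (p k) := ⟨_, rfl⟩
  rw [← hf] at h ⊢
  have h' : ∀ q r : MvPolynomial ι ℂ, constantCoeff r = 0 →
      fischer ℂ ι (q * dualOrbitSum a r) f = 0 := by
    intro q r hr
    have hr' : dualOrbitSum a r
        = ∑ μ ∈ r.support, coeff μ r • dualOrbitSum a (monomial μ (1 : ℂ)) := by
      conv_lhs => rw [r.as_sum]
      simp only [dualOrbitSum, map_sum, Finset.smul_sum]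
      rw [Finset.sum_comm]
      refine Finset.sum_congr rfl fun μ _ => Finset.sum_congr rfl fun g _ => ?_
      rw [← map_smul, smul_monomial, smul_eq_mul, mul_one]
    rw [hr', q.as_sum, Finset.sum_mul_sum, map_sum, LinearMap.sum_apply]
    refine Finset.sum_eq_zero fun ν _ => ?_
    rw [map_sum, LinearMap.sum_apply]
    refine Finset.sum_eq_zero fun μ hμ => ?_
    have hμ0 : μ ≠ 0 := by
      rintro rfl
      rw [constantCoeff_eq] at hr
      exact mem_support_iff.1 hμ hr
    have e : (monomial ν (coeff ν q) : MvPolynomial ι ℂ) = coeff ν q • monomial ν 1 := by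
      rw [smul_monomial, smul_eq_mul, mul_one]
    rw [e, smul_mul_smul_comm, map_smul, LinearMap.smul_apply, h μ ν hμ0, smul_zero]
  -- the matrices of the group stacked upon each other, so that `Bᴴ B` is an invariant form
  let B : Matrix (Γ × ι) ι ℂ := Matrix.of fun x j => a x.1 x.2 j
  let κ : MvPolynomial ι ℂ → MvPolynomial ι ℂ := map (starRingEnd ℂ)
  let N : Matrix ι ι ℂ := B.transpose * B.map (starRingEnd ℂ)
  have hN : ∀ g, N * (a g).map (starRingEnd ℂ) = (a g⁻¹).transpose * N := by
    intro g
    ext i j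
    have hl : (N * (a g).map (starRingEnd ℂ)) i j = ∑ h, ∑ l, a h l i * conj (a (h * g) l j) := by
      have e : B.map (starRingEnd ℂ) * (a g).map (starRingEnd ℂ)
          = Matrix.of fun x j => conj (a (x.1 * g) x.2 j) := by
        ext x j
        simp [B, Matrix.mul_apply]
      rw [Matrix.mul_assoc, e]
      simp [B, Matrix.mul_apply, Fintype.sum_prod_type]
    have hr : ((a g⁻¹).transpose * N) i j = ∑ h, ∑ l, a (h * g⁻¹) l i * conj (a h l j) := by
      have e : B * a g⁻¹ = Matrix.of fun x j => a (x.1 * g⁻¹) x.2 j := by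
        ext x j
        simp only [map_mul]
        simp [B, Matrix.mul_apply]
      rw [← Matrix.mul_assoc, ← Matrix.transpose_mul, e]
      simp [B, Matrix.mul_apply, Fintype.sum_prod_type]
    rw [hl, hr]
    exact Fintype.sum_equiv (Equiv.mulRight g) _ _ fun h => by simp
  have hκ : ∀ p, linSubst N (κ (orbitSum a p)) = dualOrbitSum a (linSubst N (κ p)) := by
    intro p
    simp only [κ, orbitSum, dualOrbitSum, map_sum, linSubst_linSubst]
    refine Finset.sum_congr rfl fun g _ => ?_
    rw [← hN, map_linSubst, linSubst_linSubst]
  have h0 : fischer ℂ ι (linSubst N (κ f)) f = 0 := by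
    have : linSubst N (κ f)
        = ∑ k, linSubst N (κ (c k)) * dualOrbitSum a (linSubst N (κ (p k))) := by
      simp only [hf, κ, map_sum, map_mul]
      exact Finset.sum_congr rfl fun k _ => by rw [← hκ]
    rw [this, map_sum, LinearMap.sum_apply]
    refine Finset.sum_eq_zero fun k _ => h' _ _ ?_
    rw [constantCoeff_linSubst]
    simp [κ, hp k]
  rw [← linSubst_linSubst, ← fischer_linSubst] at h0
  simp only [κ] at h0
  rw [← map_linSubst] at h0
  have h1 := fischer_conj_self_eq_zero h0
  let P : Matrix ι (Γ × ι) ℂ := Matrix.of fun i x => if x = (1, i) then 1 else 0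
  have hPB : P * B = 1 := by
    ext i j
    simp [P, B, Matrix.mul_apply, map_one]
  have h2 := congrArg (linSubst P) h1
  rwa [linSubst_linSubst, hPB, linSubst_one, map_zero] at h2

end Positivity

/-! ### Specialisation from characteristic zero to the complex numbers -/

section Descent

open MvPolynomial

/-- A nonzero finitely generated `ℚ`-algebra has a complex point, by the Nullstellensatz. -/
lemma exists_ringHom_complex (B : Type*) [CommRing B] [Nontrivial B] [Algebra ℚ B]
    [Algebra.FiniteType ℚ B] : Nonempty (B →+* ℂ) := by
  obtain ⟨m, hm⟩ := Ideal.exists_maximal B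
  let : Field (B ⧸ m) := Ideal.Quotient.field m
  have : Algebra.FiniteType ℚ (B ⧸ m) :=
    Algebra.FiniteType.of_surjective (Ideal.Quotient.mkₐ ℚ m) (Ideal.Quotient.mkₐ_surjective ℚ m)
  have : Module.Finite ℚ (B ⧸ m) := finite_of_finite_type_of_isJacobsonRing ℚ (B ⧸ m)
  have : Algebra.IsAlgebraic ℚ (B ⧸ m) := Algebra.IsAlgebraic.of_finite ℚ (B ⧸ m)
  exact ⟨(IsAlgClosed.lift (R := ℚ) (S := B ⧸ m) (M := ℂ) : B ⧸ m →ₐ[ℚ] ℂ).toRingHom.comp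
    (Ideal.Quotient.mk m)⟩

variable {ι : Type*} [Fintype ι] [DecidableEq ι] {Γ : Type*} [Group Γ] [Fintype Γ]

/-- The same over any field of characteristic zero. All data are defined over a finitely generated
`ℚ`-algebra that contains the inverse of a nonzero coefficient of the polynomial in question, and a
homomorphism from it to `ℂ` reduces the claim to the complex case. -/
lemma eq_zero_of_orthogonal {K : Type*} [Field K] [CharZero K] (a : Γ →* Matrix ι ι K) {n : ℕ}
    (c p : Fin n → MvPolynomial ι K) (hp : ∀ k, constantCoeff (p k) = 0)
    (h : ∀ μ ν : ι →₀ ℕ, μ ≠ 0 →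
      fischer K ι (monomial ν 1 * dualOrbitSum a (monomial μ 1))
        (∑ k, c k * orbitSum a (p k)) = 0) :
    ∑ k, c k * orbitSum a (p k) = 0 := by
  by_contra hne
  obtain ⟨μ₀, hμ₀⟩ := ne_zero_iff.1 hne
  let s : Set K := {(coeff μ₀ (∑ k, c k * orbitSum a (p k)))⁻¹} ∪
    (Set.range fun x : Γ × ι × ι => a x.1 x.2.1 x.2.2) ∪
    (⋃ k, ((c k).coeffs : Set K)) ∪ ⋃ k, ((p k).coeffs : Set K)
  have hs : s.Finite := by
    refine ((Set.Finite.union (Set.finite_singleton _) (Set.finite_range _)).union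
      (Set.finite_iUnion fun k => Finset.finite_toSet _)).union
      (Set.finite_iUnion fun k => Finset.finite_toSet _)
  let R₀ := Algebra.adjoin ℚ s
  have hft : Algebra.FiniteType ℚ R₀ :=
    (Subalgebra.fg_iff_finiteType _).1 (Subalgebra.fg_def.2 ⟨s, hs, rfl⟩)
  obtain ⟨φ⟩ := exists_ringHom_complex R₀
  let i₀ : R₀ →+* K := R₀.val.toRingHom
  have hi₀ : Function.Injective i₀ := Subtype.val_injective
  have hsub : ∀ x ∈ s, x ∈ R₀ := fun x hx => Algebra.subset_adjoin hx
  let a₀ : Γ →* Matrix ι ι R₀ :=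
    { toFun := fun g => Matrix.of fun i j => ⟨a g i j, hsub _ (by
        left; left; right; exact ⟨(g, i, j), rfl⟩)⟩
      map_one' := by
        ext i j
        simp [Matrix.one_apply]
        split_ifs <;> rfl
      map_mul' := by
        intro g g'
        ext i j
        simp [Matrix.mul_apply] }
  have ha₀ : (i₀.mapMatrix : Matrix ι ι R₀ →+* Matrix ι ι K).toMonoidHom.comp a₀ = a := by
    ext g i j
    rfl
  have hc₀ : ∀ k, ∃ c₀ : MvPolynomial ι R₀, map i₀ c₀ = c k := fun k => by
    refine mem_range_map_iff_coeffs_subset.2 fun x hx => ⟨⟨x, hsub x ?_⟩, rfl⟩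
    left; right; exact Set.mem_iUnion.2 ⟨k, hx⟩
  have hp₀ : ∀ k, ∃ p₀ : MvPolynomial ι R₀, map i₀ p₀ = p k := fun k => by
    refine mem_range_map_iff_coeffs_subset.2 fun x hx => ⟨⟨x, hsub x ?_⟩, rfl⟩
    right; exact Set.mem_iUnion.2 ⟨k, hx⟩
  choose c₀ hc₀ using hc₀
  choose p₀ hp₀ using hp₀
  let f₀ := ∑ k, c₀ k * orbitSum a₀ (p₀ k)
  have hf₀ : map i₀ f₀ = ∑ k, c k * orbitSum a (p k) := by
    simp only [f₀, map_sum, map_mul, hc₀, map_orbitSum, hp₀, ha₀]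
  have hmap : ∀ {R' : Type _} [CommRing R'] (ψ : R₀ →+* R'), map ψ f₀
      = ∑ k, map ψ (c₀ k) * orbitSum
        ((ψ.mapMatrix : Matrix ι ι R₀ →+* Matrix ι ι R').toMonoidHom.comp a₀) (map ψ (p₀ k)) := by
    intro R' _ ψ
    simp only [f₀, map_sum, map_mul, map_orbitSum]
  have h0 : map φ f₀ = 0 := by
    rw [hmap]
    refine eq_zero_of_orthogonal_complex _ _ _ (fun k => ?_) fun μ ν hμ => ?_
    · have h1 : i₀ (constantCoeff (p₀ k)) = 0 := by
        rw [← constantCoeff_map, hp₀, hp]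
      rw [constantCoeff_map, (map_eq_zero_iff i₀ hi₀).1 h1, map_zero]
    · have h1 := h μ ν hμ
      rw [← hf₀, ← ha₀, ← map_one i₀, ← map_monomial, ← map_monomial, ← map_dualOrbitSum,
        ← map_mul, fischer_map, map_eq_zero_iff i₀ hi₀] at h1
      rw [← hmap, ← map_one φ, ← map_monomial, ← map_monomial, ← map_dualOrbitSum, ← map_mul,
        fischer_map, h1, map_zero]
  have hunit : coeff μ₀ f₀ * (⟨_, hsub _ (by left; left; left; rfl)⟩ : R₀) = 1 := by
    apply hi₀
    rw [map_mul, map_one, ← coeff_map, hf₀]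
    exact mul_inv_cancel₀ hμ₀
  have h2 := congrArg φ hunit
  rw [map_mul, ← coeff_map, h0, coeff_zero, zero_mul, map_one] at h2
  exact zero_ne_one h2

end Descent

/-! ### Harmonic polynomials are a complement of the coinvariant ideal -/

section Harmonics

variable {K : Type*} [Field K] {X : Type*} [AddCommGroup X] [Module K X]
  {A : Type*} [Group A] (σ : Representation K A X) (G : Subgroup A)
  {ι : Type*} [Fintype ι] (b : Basis ι K X)

lemma constantCoeff_equivMvPolynomial (f : SymmetricAlgebra K X) :
    MvPolynomial.constantCoeff (SymmetricAlgebra.equivMvPolynomial b f)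
      = SymmetricAlgebra.algebraMapInv f := by
  induction f using SymmetricAlgebra.induction with
  | algebraMap r =>
    rw [AlgEquiv.commutes, AlgHom.commutes, MvPolynomial.algebraMap_eq,
      MvPolynomial.constantCoeff_C]
    rfl
  | ι x =>
    rw [SymmetricAlgebra.algebraMapInv_ι, ← b.sum_repr x]
    simp only [map_sum, map_smul, SymmetricAlgebra.equivMvPolynomial_ι_apply]
    exact Finset.sum_eq_zero fun i _ => by simp [MvPolynomial.smul_eq_C_mul]
  | mul f g hf hg => simp [hf, hg]
  | add f g hf hg => simp [hf, hg]

/-- The apolar pairing on `S(X)`, with `X` identified with its dual by means of a basis. -/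
noncomputable def apolar :
    SymmetricAlgebra K X →ₗ[K] SymmetricAlgebra K X →ₗ[K] K :=
  (fischer K ι).compl₁₂ (SymmetricAlgebra.equivMvPolynomial b).toLinearMap
    (SymmetricAlgebra.equivMvPolynomial b).toLinearMap

lemma apolar_apply (q f : SymmetricAlgebra K X) : apolar b q f = fischer K ι
    (SymmetricAlgebra.equivMvPolynomial b q) (SymmetricAlgebra.equivMvPolynomial b f) := rfl

lemma apolar_comm (q f : SymmetricAlgebra K X) : apolar b q f = apolar b f q := fischer_comm _ _

lemma apolar_nondegenerate [CharZero K] {f : SymmetricAlgebra K X}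
    (h : ∀ q, apolar b q f = 0) : f = 0 := by
  have := fischer_nondegenerate (f := SymmetricAlgebra.equivMvPolynomial b f) fun q => by
    simpa [apolar_apply] using h ((SymmetricAlgebra.equivMvPolynomial b).symm q)
  simpa using this

lemma apolar_one_left (f : SymmetricAlgebra K X) :
    apolar b 1 f = SymmetricAlgebra.algebraMapInv f := by
  rw [apolar_apply, map_one, fischer_one_left, constantCoeff_equivMvPolynomial]

variable [DecidableEq ι]

lemma equivMvPolynomial_symMap (θ : X →ₗ[K] X) (f : SymmetricAlgebra K X) :
    SymmetricAlgebra.equivMvPolynomial b (symMap θ f)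
      = linSubst (LinearMap.toMatrix b b θ) (SymmetricAlgebra.equivMvPolynomial b f) := by
  have : (SymmetricAlgebra.equivMvPolynomial b : _ →ₐ[K] _).comp (symMap θ)
      = (linSubst (LinearMap.toMatrix b b θ)).comp
        (SymmetricAlgebra.equivMvPolynomial b : _ →ₐ[K] _) := by
    apply SymmetricAlgebra.algHom_ext
    refine b.ext fun j => ?_
    change SymmetricAlgebra.equivMvPolynomial b (symMap θ (SymmetricAlgebra.ι K X (b j)))
      = linSubst _ (SymmetricAlgebra.equivMvPolynomial b (SymmetricAlgebra.ι K X (b j)))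
    rw [symMap_ι, SymmetricAlgebra.equivMvPolynomial_ι_apply, linSubst_X]
    conv_lhs => rw [← b.sum_repr (θ (b j)), map_sum, map_sum]
    refine Finset.sum_congr rfl fun i _ => ?_
    rw [map_smul, map_smul, SymmetricAlgebra.equivMvPolynomial_ι_apply, LinearMap.toMatrix_apply]
  exact DFunLike.congr_fun this f

/-- The contragredient representation, realised on the same space by means of a basis: its matrices
are the transposed inverses. -/
noncomputable def contragredient : Representation K A X where
  toFun a := Matrix.toLin b b (LinearMap.toMatrix b b (σ a⁻¹)).transpose
  map_one' := by simp [Module.End.one_eq_id]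
  map_mul' a a' := by
    rw [mul_inv_rev, map_mul, LinearMap.toMatrix_mul, Matrix.transpose_mul, Matrix.toLin_mul b b b]
    rfl

lemma toMatrix_contragredient (a : A) :
    LinearMap.toMatrix b b (contragredient σ b a)
      = (LinearMap.toMatrix b b (σ a⁻¹)).transpose := by
  simp [contragredient]

lemma contragredient_contragredient :
    contragredient (contragredient σ b) b = σ := by
  ext1 a
  apply (LinearMap.toMatrix b b).injective
  rw [toMatrix_contragredient, toMatrix_contragredient, inv_inv, Matrix.transpose_transpose]

lemma apolar_symMap (θ : X →ₗ[K] X) (q f : SymmetricAlgebra K X) :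
    apolar b q (symMap θ f) = apolar b
      (symMap (Matrix.toLin b b (LinearMap.toMatrix b b θ).transpose) q) f := by
  rw [apolar_apply, apolar_apply, equivMvPolynomial_symMap, equivMvPolynomial_symMap,
    fischer_linSubst, LinearMap.toMatrix_toLin]

lemma apolar_symAct (a : A) (q f : SymmetricAlgebra K X) :
    apolar b q (symAct σ a f) = apolar b (symAct (contragredient σ b) a⁻¹ q) f := by
  rw [symAct_eq_symMap, apolar_symMap, symAct_eq_symMap]
  congr 3
  simp [contragredient]

variable {σ G} in
/-- The coinvariant ideal meets the orthogonal of the dual coinvariant ideal in zero. -/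
lemma eq_zero_of_mem_of_apolar [CharZero K] [Finite G] {f : SymmetricAlgebra K X}
    (hf : f ∈ coinvariantIdeal σ G)
    (h : ∀ q ∈ coinvariantIdeal (contragredient σ b) G, apolar b q f = 0) : f = 0 := by
  have := Fintype.ofFinite G
  let e := SymmetricAlgebra.equivMvPolynomial b
  let a : G →* Matrix ι ι K :=
    ((LinearMap.toMatrixAlgEquiv b : End K X →* Matrix ι ι K).comp σ).comp G.subtype
  have ha : ∀ g : G, a g = LinearMap.toMatrix b b (σ (g : A)) := fun g => rfl
  obtain ⟨n, c, p, hcp⟩ := Submodule.mem_span_set'.1 hf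
  have hp : ∀ k, orbitSum a (e (p k)) = (Nat.card G : K) • e (p k) := by
    intro k
    have h1 : ∀ g : G, linSubst (a g) (e (p k)) = e (p k) := fun g => by
      rw [ha, ← equivMvPolynomial_symMap, ← symAct_eq_symMap, (p k).2.1 g g.2]
    rw [orbitSum, Finset.sum_congr rfl fun g _ => h1 g, Finset.sum_const, Finset.card_univ,
      ← Nat.card_eq_fintype_card, Nat.cast_smul_eq_nsmul]
  have hef : e f = ∑ k, ((Nat.card G : K)⁻¹ • e (c k)) * orbitSum a (e (p k)) := by
    rw [← hcp, map_sum]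
    refine Finset.sum_congr rfl fun k _ => ?_
    rw [hp, smul_mul_smul_comm, inv_mul_cancel₀ natCard_ne_zero, one_smul, smul_eq_mul, map_mul]
  have h0 : e f = 0 := by
    rw [hef]
    refine eq_zero_of_orthogonal a _ _ (fun k => ?_) fun μ ν hμ => ?_
    · rw [constantCoeff_equivMvPolynomial, (p k).2.2]
    · rw [← hef]
      let r : SymmetricAlgebra K X := e.symm (MvPolynomial.monomial μ 1)
      have hr : dualOrbitSum a (MvPolynomial.monomial μ 1)
          = e ((Nat.card G : K) • reynolds (contragredient σ b) G r) := by
        rw [reynolds_apply, smul_smul, mul_inv_cancel₀ natCard_ne_zero, one_smul, map_sum]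
        refine Finset.sum_congr rfl fun g _ => ?_
        rw [symAct_eq_symMap, equivMvPolynomial_symMap, toMatrix_contragredient, ha]
        simp [r, e]
      have hmem : e.symm (MvPolynomial.monomial ν 1)
          * ((Nat.card G : K) • reynolds (contragredient σ b) G r)
            ∈ coinvariantIdeal (contragredient σ b) G := by
        refine Ideal.mul_mem_left _ _ (posInvariants_le_coinvariantIdeal
          (Submodule.smul_mem _ _ ⟨reynolds_mem r, ?_⟩))
        rw [algebraMapInv_reynolds, ← constantCoeff_equivMvPolynomial b]
        simp [r, e, MvPolynomial.constantCoeff_monomial, hμ]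
      have := h _ hmem
      rw [apolar_apply, map_mul, AlgEquiv.apply_symm_apply] at this
      rw [hr]
      exact this
  simpa [e] using h0

/-- The orthogonal of the coinvariant ideal of the contragredient representation. -/
noncomputable def dualCoinvariantOrthogonal : Submodule K (SymmetricAlgebra K X) where
  carrier := {f | ∀ q ∈ coinvariantIdeal (contragredient σ b) G, apolar b q f = 0}
  zero_mem' := fun q _ => map_zero _
  add_mem' := fun h h' q hq => by rw [map_add, h q hq, h' q hq, add_zero]
  smul_mem' := fun c f h q hq => by rw [map_smul, h q hq, smul_zero]

lemma apolar_eq_zero_of_ne [CharZero K] {i j : ℕ} (hij : i ≠ j) {q f : SymmetricAlgebra K X}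
    (hq : q ∈ symDegree K X i) (hf : f ∈ symDegree K X j) : apolar b q f = 0 := by
  rw [symDegree_eq_eigenspace] at hq hf
  have hq' := End.mem_eigenspace_iff.1 hq
  have hf' := End.mem_eigenspace_iff.1 hf
  rw [AlgHom.toLinearMap_apply] at hq' hf'
  have h := apolar_symMap b ((2 : K) • LinearMap.id) q f
  have e : Matrix.toLin b b (LinearMap.toMatrix b b ((2 : K) • LinearMap.id)).transpose
      = (2 : K) • LinearMap.id := by simp
  rw [e, hq', hf', map_smul, map_smul, LinearMap.smul_apply, smul_eq_mul, smul_eq_mul,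
    ← sub_eq_zero, ← sub_mul] at h
  exact (mul_eq_zero.1 h).resolve_left
    (sub_ne_zero.2 fun h => hij (two_pow_injective h).symm)

variable {σ G} in
lemma mem_iSup_coinvariantIdeal_inf [CharZero K] {q : SymmetricAlgebra K X}
    (hq : q ∈ coinvariantIdeal σ G) :
    q ∈ ⨆ d, (coinvariantIdeal σ G).restrictScalars K ⊓ symDegree K X d := by
  simp_rw [symDegree_eq_eigenspace]
  refine mem_iSup_inf_eigenspace _ two_pow_injective (fun x hx => ?_)
    (show q ∈ (coinvariantIdeal σ G).restrictScalars K from hq) ?_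
  · exact symMap_mem_coinvariantIdeal (by simp) hx
  · simp_rw [← symDegree_eq_eigenspace, iSup_symDegree]
    trivial

variable {σ G} in
lemma mem_dualCoinvariantOrthogonal_of_degree [CharZero K] {d : ℕ} {f : SymmetricAlgebra K X}
    (hf : f ∈ symDegree K X d)
    (h : ∀ q ∈ coinvariantIdeal (contragredient σ b) G, q ∈ symDegree K X d →
      apolar b q f = 0) : f ∈ dualCoinvariantOrthogonal σ G b := by
  intro q hq
  have hle : (⨆ d, (coinvariantIdeal (contragredient σ b) G).restrictScalars K ⊓
      symDegree K X d) ≤ LinearMap.ker ((apolar b).flip f) := by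
    refine iSup_le fun i r hr => ?_
    rw [LinearMap.mem_ker, LinearMap.flip_apply]
    by_cases hi : i = d
    · subst hi; exact h r hr.1 hr.2
    · exact apolar_eq_zero_of_ne b hi hr.2 hf
  simpa using hle (mem_iSup_coinvariantIdeal_inf hq)

/-- In a finite-dimensional space with a nondegenerate form, two subspaces each of which
meets the orthogonal of the other in zero have equal dimension, so that each is a complement of the
orthogonal of the other. -/
lemma sup_orthogonal_eq_top {N : Type*} [AddCommGroup N] [Module K N] [FiniteDimensional K N]
    {B : LinearMap.BilinForm K N} (hB : B.Nondegenerate) {U U' : Submodule K N}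
    (h : Disjoint U (B.orthogonal U')) (h' : Disjoint U' (B.orthogonal U)) :
    U ⊔ B.orthogonal U' = ⊤ := by
  have h1 := LinearMap.BilinForm.finrank_orthogonal hB U
  have h2 := LinearMap.BilinForm.finrank_orthogonal hB U'
  have h3 := Submodule.finrank_add_finrank_le_of_disjoint h
  have h4 := Submodule.finrank_add_finrank_le_of_disjoint h'
  have h5 := Submodule.finrank_le U
  have h6 := Submodule.finrank_le U'
  exact Submodule.eq_top_of_disjoint _ _ (by omega) h

/-- The sum is everything by `sup_orthogonal_eq_top` in each degree, applied to the representation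
and to its contragredient. -/
lemma coinvariantIdeal_sup_orthogonal [CharZero K] [Finite G] :
    (coinvariantIdeal σ G).restrictScalars K ⊔ dualCoinvariantOrthogonal σ G b = ⊤ := by
  rw [eq_top_iff, ← iSup_symDegree]
  refine iSup_le fun d f hf => ?_
  let N := symDegree K X d
  have hfd : FiniteDimensional K N := by
    have := Module.Finite.of_basis b
    have hfg : (LinearMap.range (SymmetricAlgebra.ι K X)).FG := by
      rw [LinearMap.range_eq_map]
      exact Submodule.FG.map _ Module.Finite.fg_top
    exact Module.Finite.iff_fg.2 (hfg.pow d)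
  let B : LinearMap.BilinForm K N := (apolar b).compl₁₂ N.subtype N.subtype
  have hBs : B.IsSymm := ⟨fun x y => apolar_comm b _ _⟩
  have hB : B.Nondegenerate := by
    have key : ∀ x : N, (∀ y, B y x = 0) → x = 0 := by
      intro x hx
      apply Subtype.ext
      refine apolar_nondegenerate b fun q => ?_
      have hq : q ∈ ⨆ d, symDegree K X d := iSup_symDegree (K := K) (X := X) ▸ Submodule.mem_top
      have hle : (⨆ d, symDegree K X d) ≤ LinearMap.ker ((apolar b).flip x) := by
        refine iSup_le fun i r hr => ?_
        rw [LinearMap.mem_ker, LinearMap.flip_apply]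
        by_cases hi : i = d
        · subst hi; exact hx ⟨r, hr⟩
        · exact apolar_eq_zero_of_ne b hi hr x.2
      simpa using hle hq
    exact ⟨fun x hx => key x fun y => by rw [← hx y]; exact hBs.eq y x, fun x hx => key x hx⟩
  let U : Submodule K N := ((coinvariantIdeal σ G).restrictScalars K).comap N.subtype
  let U' : Submodule K N :=
    ((coinvariantIdeal (contragredient σ b) G).restrictScalars K).comap N.subtype
  have h : Disjoint U (B.orthogonal U') := by
    rw [Submodule.disjoint_def]
    intro x hx hx'
    apply Subtype.ext
    exact eq_zero_of_mem_of_apolar b hx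
      (mem_dualCoinvariantOrthogonal_of_degree b x.2 fun q hq hqN => hx' ⟨q, hqN⟩ hq)
  have h' : Disjoint U' (B.orthogonal U) := by
    rw [Submodule.disjoint_def]
    intro x hx hx'
    apply Subtype.ext
    exact eq_zero_of_mem_of_apolar b hx
      (mem_dualCoinvariantOrthogonal_of_degree b x.2 fun q hq hqN => hx' ⟨q, hqN⟩ (by
        rwa [contragredient_contragredient] at hq))
  have hf' : (⟨f, hf⟩ : N) ∈ U ⊔ B.orthogonal U' := by
    rw [sup_orthogonal_eq_top hB h h']; trivial
  obtain ⟨u, hu, v, hv, huv⟩ := Submodule.mem_sup.1 hf'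
  have : f = u + v := (congrArg Subtype.val huv).symm
  rw [this]
  refine Submodule.add_mem_sup hu ?_
  exact mem_dualCoinvariantOrthogonal_of_degree b v.2 fun q hq hqN => hv ⟨q, hqN⟩ hq

/-- The operators `q(∂)`: each polynomial `q` gives a constant coefficient operator that is adjoint
to multiplication by `q`. -/
lemma exists_operator_of_polynomial (q : SymmetricAlgebra K X) :
    ∃ T ∈ constCoeffOperators K X, ∀ r f, apolar b r (T f) = apolar b (r * q) f := by
  let e := SymmetricAlgebra.equivMvPolynomial b
  obtain ⟨q', rfl⟩ := e.symm.surjective q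
  induction q' using MvPolynomial.induction_on with
  | C c =>
    refine ⟨algebraMap K _ c, Subalgebra.algebraMap_mem _ _, fun r f => ?_⟩
    have : e.symm (MvPolynomial.C c) = algebraMap K _ c := e.symm.commutes c
    rw [this, Module.algebraMap_end_apply, map_smul, ← Algebra.commutes, ← Algebra.smul_def,
      map_smul, LinearMap.smul_apply]
  | add p p' h h' =>
    obtain ⟨T, hT, h⟩ := h
    obtain ⟨T', hT', h'⟩ := h'
    refine ⟨T + T', Subalgebra.add_mem _ hT hT', fun r f => ?_⟩
    rw [LinearMap.add_apply, map_add, h, h', map_add, mul_add, map_add, LinearMap.add_apply]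
  | mul_X p i h =>
    obtain ⟨T, hT, h⟩ := h
    let D : Derivation K (SymmetricAlgebra K X) (SymmetricAlgebra K X) :=
      Derivation.mk' (e.symm.toLinearMap ∘ₗ (MvPolynomial.pderiv i).toLinearMap ∘ₗ e.toLinearMap)
        (fun f g => by simp [Derivation.leibniz])
    have hD : ∀ f, e (D f) = MvPolynomial.pderiv i (e f) := fun f =>
      e.apply_symm_apply _
    refine ⟨D.toLinearMap * T, Subalgebra.mul_mem _ (Algebra.subset_adjoin ⟨D, ?_, rfl⟩) hT,
      fun r f => ?_⟩
    · intro x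
      refine ⟨b.repr x i, ?_⟩
      apply e.injective
      rw [hD, AlgEquiv.commutes]
      conv_lhs => rw [← b.sum_repr x]
      simp only [map_sum, map_smul, e, SymmetricAlgebra.equivMvPolynomial_ι_apply]
      simp [Pi.single_apply, MvPolynomial.algebraMap_eq, MvPolynomial.smul_eq_C_mul]
    · have h1 : apolar b r ((D.toLinearMap * T) f)
          = apolar b (r * e.symm (MvPolynomial.X i)) (T f) := by
        rw [apolar_apply, apolar_apply, map_mul]
        change fischer K ι (e r) (e (D (T f))) = fischer K ι (e r * e (e.symm _)) _
        rw [hD, AlgEquiv.apply_symm_apply, fischer_mul_X]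
      rw [h1, h, map_mul e.symm, mul_assoc, mul_comm (e.symm _)]

/-- Every constant coefficient operator is adjoint to multiplication by a polynomial. -/
lemma exists_polynomial_of_operator {T : End K (SymmetricAlgebra K X)}
    (hT : T ∈ constCoeffOperators K X) :
    ∃ q, ∀ r f, apolar b r (T f) = apolar b (r * q) f := by
  induction hT using Algebra.adjoin_induction with
  | algebraMap c =>
    refine ⟨algebraMap K _ c, fun r f => ?_⟩
    rw [Module.algebraMap_end_apply, map_smul, ← Algebra.commutes, ← Algebra.smul_def,
      map_smul, LinearMap.smul_apply]
  | add T T' _ _ h h' =>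
    obtain ⟨q, h⟩ := h
    obtain ⟨q', h'⟩ := h'
    exact ⟨q + q', fun r f => by
      rw [LinearMap.add_apply, map_add, h, h', mul_add, map_add, LinearMap.add_apply]⟩
  | mul T T' _ _ h h' =>
    obtain ⟨q, h⟩ := h
    obtain ⟨q', h'⟩ := h'
    exact ⟨q * q', fun r f => by rw [Module.End.mul_apply, h, h', mul_assoc]⟩
  | mem T hT =>
    obtain ⟨D, hD, rfl⟩ := hT
    choose c hc using hD
    let e := SymmetricAlgebra.equivMvPolynomial b
    refine ⟨∑ i, c (b i) • SymmetricAlgebra.ι K X (b i), fun r f => ?_⟩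
    have hDe : e (D f) = ∑ i, c (b i) • MvPolynomial.pderiv i (e f) := by
      let D' : Derivation K (MvPolynomial ι K) (MvPolynomial ι K) :=
        Derivation.mk' (e.toLinearMap ∘ₗ D.toLinearMap ∘ₗ e.symm.toLinearMap)
          (fun f g => by simp [Derivation.leibniz])
      have : D' = ∑ i, c (b i) • MvPolynomial.pderiv i := by
        apply MvPolynomial.derivation_ext
        intro j
        have h1 : D' (MvPolynomial.X j) = MvPolynomial.C (c (b j)) := by
          change e (D (e.symm (MvPolynomial.X j))) = _
          rw [SymmetricAlgebra.equivMvPolynomial_symm_X, hc, AlgEquiv.commutes]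
          rfl
        rw [h1]
        have h2 : (∑ i, c (b i) • MvPolynomial.pderiv (R := K) i) (MvPolynomial.X j)
            = ∑ i, c (b i) • MvPolynomial.pderiv (R := K) i (MvPolynomial.X j) := by
          rw [← Derivation.coeFnAddMonoidHom_apply, map_sum, Finset.sum_apply]
          rfl
        rw [h2]
        simp [MvPolynomial.pderiv_X, Pi.single_apply, MvPolynomial.smul_eq_C_mul]
      have h3 := DFunLike.congr_fun this (e f)
      have h4 : D' (e f) = e (D f) := by
        change e (D (e.symm (e f))) = _
        rw [AlgEquiv.symm_apply_apply]
      rw [← h4, h3, ← Derivation.coeFnAddMonoidHom_apply, map_sum, Finset.sum_apply]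
      rfl
    rw [apolar_apply, apolar_apply]
    change fischer K ι (e r) (e (D f)) = fischer K ι (e _) (e f)
    rw [hDe, map_sum, map_mul, map_sum, Finset.mul_sum, map_sum, LinearMap.sum_apply]
    refine Finset.sum_congr rfl fun i _ => ?_
    rw [map_smul, map_smul, mul_smul_comm, map_smul, LinearMap.smul_apply,
      SymmetricAlgebra.equivMvPolynomial_ι_apply, fischer_mul_X]

/-- The correspondence `q ↦ q(∂)` matches the invariant constant coefficient operators without
constant term with the invariants without constant term of the contragredient representation. -/
lemma harmonics_eq_orthogonal [CharZero K] :
    harmonics σ G = dualCoinvariantOrthogonal σ G b := by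
  ext f
  constructor
  · intro hf
    have key : ∀ q ∈ posInvariants (contragredient σ b) G, ∀ r, apolar b (r * q) f = 0 := by
      rintro q ⟨hq, hq0⟩ r
      obtain ⟨T, hT, hTq⟩ := exists_operator_of_polynomial b q
      rw [← hTq, hf T hT, map_zero]
      · intro g hg
        ext1 f
        rw [← sub_eq_zero]
        refine apolar_nondegenerate b fun r => ?_
        rw [map_sub, sub_eq_zero]
        simp only [LinearMap.comp_apply, symRep_apply]
        rw [hTq, apolar_symAct, apolar_symAct, hTq, map_mul, hq _ (G.inv_mem hg)]
      · refine apolar_nondegenerate b fun r => ?_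
        rw [hTq, apolar_comm, apolar_one_left, map_mul, hq0, mul_zero]
    intro q hq
    have h1 : ∀ r, apolar b (r * q) f = 0 := by
      induction hq using Submodule.span_induction with
      | mem q hq => exact key q hq
      | zero => simp
      | add q q' _ _ h h' =>
        exact fun r => by rw [mul_add, map_add, LinearMap.add_apply, h, h', add_zero]
      | smul s q _ h => exact fun r => by rw [smul_eq_mul, ← mul_assoc, h]
    simpa using h1 1
  · intro hf T hT hTG hT1
    obtain ⟨q, hq⟩ := exists_polynomial_of_operator b hT
    have hqpos : q ∈ posInvariants (contragredient σ b) G := by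
      constructor
      · intro g hg
        rw [← sub_eq_zero]
        refine apolar_nondegenerate b fun f' => ?_
        have h1 := LinearMap.congr_fun (hTG g⁻¹ (G.inv_mem hg)) f'
        simp only [LinearMap.comp_apply, symRep_apply] at h1
        have h2 := congrArg (apolar b 1) h1
        rw [hq, apolar_symAct, apolar_symAct, hq, inv_inv, one_mul, map_one, one_mul] at h2
        rw [apolar_comm, map_sub, LinearMap.sub_apply, h2, sub_self]
      · have h1 := hq 1 1
        rw [hT1, map_zero, one_mul, apolar_comm, apolar_one_left] at h1
        exact h1.symm
    refine apolar_nondegenerate b fun r => ?_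
    rw [hq]
    exact hf _ (Ideal.mul_mem_left _ _ (posInvariants_le_coinvariantIdeal hqpos))

/-- For every finite group acting linearly on a finite-dimensional space, the harmonic polynomials
form a complement of the coinvariant ideal. -/
theorem isCompl_harmonics [CharZero K] [FiniteDimensional K X] [Finite G] :
    IsCompl (harmonics σ G) ((coinvariantIdeal σ G).restrictScalars K) := by
  rw [harmonics_eq_orthogonal σ G (Module.finBasis K X)]
  refine ⟨?_, ?_⟩
  · rw [Submodule.disjoint_def]
    exact fun f h h' => eq_zero_of_mem_of_apolar _ h' h
  · rw [codisjoint_comm, codisjoint_iff]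
    exact coinvariantIdeal_sup_orthogonal σ G _

end Harmonics

/-! ### Symmetries of the space of harmonic polynomials -/

section HarmonicsStable

variable {K : Type*} [Field K] {X : Type*} [AddCommGroup X] [Module K X]
  {A : Type*} [Group A] {σ : Representation K A X} {G : Subgroup A}

/-- A linear automorphism that normalises the image of `G` preserves the harmonic polynomials. -/
lemma symMap_mem_harmonics {θ θ' : X →ₗ[K] X} (h1 : θ ∘ₗ θ' = LinearMap.id)
    (h2 : θ' ∘ₗ θ = LinearMap.id) (hθ : ∀ g ∈ G, ∃ g' ∈ G, σ g' ∘ₗ θ = θ ∘ₗ σ g)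
    {f : SymmetricAlgebra K X} (hf : f ∈ harmonics σ G) : symMap θ f ∈ harmonics σ G := by
  have e1 : ∀ p, symMap θ (symMap θ' p) = p := fun p => by rw [symMap_symMap, h1, symMap_id]
  have e2 : ∀ p, symMap θ' (symMap θ p) = p := fun p => by rw [symMap_symMap, h2, symMap_id]
  let conj : End K (SymmetricAlgebra K X) → End K (SymmetricAlgebra K X) := fun T =>
    (symMap θ').toLinearMap ∘ₗ T ∘ₗ (symMap θ).toLinearMap
  have hconj : ∀ T ∈ constCoeffOperators K X, conj T ∈ constCoeffOperators K X := by
    intro T hT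
    induction hT using Algebra.adjoin_induction with
    | algebraMap c =>
      have : conj (algebraMap K _ c) = algebraMap K _ c := by
        ext1 p
        simp [conj, Module.algebraMap_end_apply, e2]
      rw [this]
      exact Subalgebra.algebraMap_mem _ _
    | add T T' _ _ h h' =>
      have : conj (T + T') = conj T + conj T' := by
        ext1 p
        simp [conj]
      rw [this]
      exact Subalgebra.add_mem _ h h'
    | mul T T' _ _ h h' =>
      have : conj (T * T') = conj T * conj T' := by
        ext1 p
        simp [conj, e1]
      rw [this]
      exact Subalgebra.mul_mem _ h h'
    | mem T hT =>
      obtain ⟨D, hD, rfl⟩ := hT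
      let D' : Derivation K (SymmetricAlgebra K X) (SymmetricAlgebra K X) :=
        Derivation.mk' (conj D.toLinearMap)
          (fun f g => by simp [conj, Derivation.leibniz, e2])
      refine Algebra.subset_adjoin ⟨D', fun x => ?_, rfl⟩
      obtain ⟨c, hc⟩ := hD (θ x)
      refine ⟨c, ?_⟩
      change symMap θ' (D (symMap θ (SymmetricAlgebra.ι K X x))) = _
      rw [symMap_ι, hc, AlgHom.commutes]
  intro T hT hTG hT1
  have h3 : conj T f = 0 := by
    refine hf _ (hconj T hT) (fun g hg => ?_) ?_
    · obtain ⟨g', hg', hgg⟩ := hθ g hg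
      have hθ'g : ∀ p, symMap θ' (symAct σ g' p) = symAct σ g (symMap θ' p) := by
        intro p
        have : θ' ∘ₗ σ g' = σ g ∘ₗ θ' := by
          calc θ' ∘ₗ σ g' = θ' ∘ₗ (σ g' ∘ₗ θ) ∘ₗ θ' := by
                rw [LinearMap.comp_assoc, h1, LinearMap.comp_id]
            _ = (θ' ∘ₗ θ) ∘ₗ σ g ∘ₗ θ' := by rw [hgg]; rfl
            _ = σ g ∘ₗ θ' := by rw [h2, LinearMap.id_comp]
        rw [symAct_eq_symMap, symMap_symMap, this, ← symMap_symMap, symAct_eq_symMap]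
      ext1 p
      have h4 := LinearMap.congr_fun (hTG g' hg') (symMap θ p)
      simp only [LinearMap.comp_apply, symRep_apply] at h4
      have h5 : symMap θ (symAct σ g p) = symAct σ g' (symMap θ p) := by
        rw [symAct_eq_symMap, symAct_eq_symMap, symMap_symMap, symMap_symMap, hgg]
      simp only [conj, LinearMap.comp_apply, symRep_apply, AlgHom.toLinearMap_apply]
      rw [h5, h4, hθ'g]
    · simp [conj, hT1]
  have h4 := congrArg (symMap θ) h3
  simpa [conj, e1] using h4

lemma symAct_mem_harmonics [hG : G.Normal] (a : A) {f : SymmetricAlgebra K X}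
    (hf : f ∈ harmonics σ G) : symAct σ a f ∈ harmonics σ G := by
  refine symMap_mem_harmonics (θ := σ a) (θ' := σ a⁻¹) ?_ ?_ (fun g hg => ?_) hf
  · change σ a * σ a⁻¹ = 1
    rw [← map_mul, mul_inv_cancel, map_one]
  · change σ a⁻¹ * σ a = 1
    rw [← map_mul, inv_mul_cancel, map_one]
  · refine ⟨a * g * a⁻¹, hG.conj_mem g hg a, ?_⟩
    change σ (a * g * a⁻¹) * σ a = σ a * σ g
    rw [← map_mul, ← map_mul]
    congr 1
    group

end HarmonicsStable

/-! ### The space `E*` and the homomorphism `τ` -/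

section Tau

variable {K : Type*} [Field K] {V : Type*} [AddCommGroup V] [Module K V]
  {G L : Subgroup (LinearMap.GeneralLinearGroup K V)}

lemma le_commonNormalizer (hLG : L ≤ G) (hL : (L.subgroupOf G).Normal) :
    G ≤ commonNormalizer G L := fun g hg => by
  refine ⟨Subgroup.le_normalizer hg, Subgroup.mem_normalizer_iff.2 fun h => ⟨fun hh => ?_,
    fun hh => ?_⟩⟩
  · exact hL.conj_mem ⟨h, hLG hh⟩ hh ⟨g, hg⟩
  · have := hL.conj_mem ⟨_, hLG hh⟩ hh ⟨g⁻¹, G.inv_mem hg⟩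
    have e : (⟨g⁻¹, G.inv_mem hg⟩ * ⟨g * h * g⁻¹, hLG hh⟩ * ⟨g⁻¹, G.inv_mem hg⟩⁻¹ : G)
        = ⟨h, by simpa [mul_assoc] using
          G.mul_mem (G.mul_mem (G.inv_mem hg) (hLG hh)) hg⟩ := by
      apply Subtype.ext
      simp [mul_assoc]
    rw [e] at this
    exact this

lemma dualRep_injective [FiniteDimensional K V] : Function.Injective (dualRep K V) := by
  intro a a' h
  have h1 : ((a⁻¹ : LinearMap.GeneralLinearGroup K V) : V →ₗ[K] V)
      = ((a'⁻¹ : LinearMap.GeneralLinearGroup K V) : V →ₗ[K] V) := by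
    ext v
    refine (Module.forall_dual_apply_eq_zero_iff K _).1 (fun φ => ?_) |> sub_eq_zero.1
    rw [map_sub, sub_eq_zero]
    exact LinearMap.congr_fun (LinearMap.congr_fun h φ) v
  exact inv_injective (Units.ext h1)

lemma formRep_injective [FiniteDimensional K V] : Function.Injective (formRep G L) :=
  dualRep_injective.comp Subtype.val_injective

lemma mem_invariantAlgebra_subL (hLN : L ≤ commonNormalizer G L)
    {f : SymmetricAlgebra K (Dual K V)} :
    f ∈ invariantAlgebra (formRep G L) (subL G L) ↔ f ∈ invariantAlgebra (dualRep K V) L :=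
  ⟨fun h l hl => h ⟨l, hLN hl⟩ hl, fun h l hl => h l hl⟩

namespace EquivariantComplement

variable (E : EquivariantComplement L)

lemma space_le : E.space ≤ posInvariants (dualRep K V) L := by
  conv_rhs => rw [← E.sup_eq]
  exact le_sup_left

@[simp]
lemma tau_ι (x : E.space) : E.tau (SymmetricAlgebra.ι K E.space x) = x := by
  simp [tau]

lemma tau_mem_invariantAlgebra (f : SymmetricAlgebra K E.space) :
    E.tau f ∈ invariantAlgebra (dualRep K V) L := by
  induction f using SymmetricAlgebra.induction with
  | algebraMap r => rw [AlgHom.commutes]; exact Subalgebra.algebraMap_mem _ _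
  | ι x => rw [tau_ι]; exact (E.space_le x.2).1
  | mul f g hf hg => rw [map_mul]; exact Subalgebra.mul_mem _ hf hg
  | add f g hf hg => rw [map_add]; exact Subalgebra.add_mem _ hf hg

lemma algebraMapInv_tau (f : SymmetricAlgebra K E.space) :
    SymmetricAlgebra.algebraMapInv (E.tau f) = SymmetricAlgebra.algebraMapInv f := by
  induction f using SymmetricAlgebra.induction with
  | algebraMap r => simp
  | ι x => rw [tau_ι, SymmetricAlgebra.algebraMapInv_ι]; exact (E.space_le x.2).2
  | mul f g hf hg => simp [hf, hg]
  | add f g hf hg => simp [hf, hg]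

lemma tau_symMap {θ : E.space →ₗ[K] E.space} {θ' : Dual K V →ₗ[K] Dual K V}
    (h : ∀ x, ((θ x : E.space) : SymmetricAlgebra K (Dual K V)) = symMap θ' x)
    (f : SymmetricAlgebra K E.space) : E.tau (symMap θ f) = symMap θ' (E.tau f) := by
  have : E.tau.comp (symMap θ) = (symMap θ').comp E.tau := by
    apply SymmetricAlgebra.algHom_ext
    ext1 x
    simp [h]
  exact DFunLike.congr_fun this f

lemma tau_symAct (n : commonNormalizer G L) (f : SymmetricAlgebra K E.space) :
    E.tau (symAct (E.repBar G) (quotientHom G L n) f) = symAct (formRep G L) n (E.tau f) :=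
  E.tau_symMap (fun _ => rfl) f

lemma tau_mem_coinvariantIdeal {f : SymmetricAlgebra K E.space}
    (hf : f ∈ coinvariantIdeal (E.repBar G) (Gbar G L)) :
    E.tau f ∈ coinvariantIdeal (formRep G L) (subG G L) := by
  have hle : coinvariantIdeal (E.repBar G) (Gbar G L)
      ≤ (coinvariantIdeal (formRep G L) (subG G L)).comap E.tau := by
    refine Ideal.span_le.2 fun p hp => Ideal.subset_span ⟨fun g hg => ?_, ?_⟩
    · rw [← tau_symAct, hp.1 _ (Subgroup.mem_map_of_mem _ hg)]
    · rw [algebraMapInv_tau]; exact hp.2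
  exact hle hf

/-- Multiplication by `2 ^ d` on the homogeneous elements of degree `d` of `S(V*)` preserves the
graded subspace `E*`; this is the induced operator. -/
noncomputable def scaling : E.space →ₗ[K] E.space :=
  (symMap ((2 : K) • LinearMap.id : Dual K V →ₗ[K] Dual K V)).toLinearMap.restrict (by
    intro x hx
    rw [E.graded] at hx
    induction hx using Submodule.iSup_induction' with
    | zero => simp
    | add a b _ _ ha hb => rw [map_add]; exact Submodule.add_mem _ ha hb
    | mem i x hx =>
      rw [End.mem_eigenspace_iff.1 (symDegree_le_eigenspace i hx.2)]
      exact Submodule.smul_mem _ _ hx.1)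

lemma coe_scaling (x : E.space) : ((E.scaling x : E.space) : SymmetricAlgebra K (Dual K V))
    = symMap ((2 : K) • LinearMap.id : Dual K V →ₗ[K] Dual K V) x := rfl

lemma scaling_of_mem_part (i : ℕ) (x : E.space) (hx : x ∈ E.part i) :
    E.scaling x = (2 : K) ^ i • x :=
  Subtype.ext (End.mem_eigenspace_iff.1 (symDegree_le_eigenspace i hx))

lemma iSup_part : ⨆ i, E.part i = ⊤ := by
  rw [eq_top_iff]
  rintro ⟨x, hx⟩ -
  have key : E.space ≤ (⨆ i, E.part i).map E.space.subtype := by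
    conv_lhs => rw [E.graded]
    refine iSup_le fun i y hy => ⟨⟨y, hy.1⟩, Submodule.mem_iSup_of_mem i hy.2, rfl⟩
  obtain ⟨y, hy, h⟩ := key hx
  have : y = ⟨x, hx⟩ := Subtype.ext h
  exact this ▸ hy

lemma degree_eq_eigenspace [CharZero K] (d : ℕ) :
    E.degree d = End.eigenspace (symMap E.scaling).toLinearMap (2 ^ d) :=
  weightedDegree_eq_eigenspace E.iSup_part E.scaling_of_mem_part d

lemma iSup_degree : ⨆ d, E.degree d = ⊤ := iSup_weightedDegree E.iSup_part

lemma rep_comp_scaling (n : commonNormalizer G L) (x : E.space) :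
    E.rep G n (E.scaling x) = E.scaling (E.rep G n x) := by
  apply Subtype.ext
  change symMap (formRep G L n) (symMap _ (x : SymmetricAlgebra K (Dual K V)))
    = symMap _ (symMap (formRep G L n) (x : SymmetricAlgebra K (Dual K V)))
  rw [symMap_symMap, symMap_symMap]
  congr 2

lemma repBar_comp_scaling (n : NormalizerQuotient G L) (x : E.space) :
    E.repBar G n (E.scaling x) = E.scaling (E.repBar G n x) := by
  obtain ⟨n, rfl⟩ := QuotientGroup.mk'_surjective _ n
  exact E.rep_comp_scaling n x

/-- The invariants of `L` without constant term are spanned by homogeneous ones. -/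
lemma posInvariants_le_iSup [CharZero K] : posInvariants (dualRep K V) L
    ≤ ⨆ d, posInvariants (dualRep K V) L ⊓ symDegree K (Dual K V) d := by
  intro f hf
  simp_rw [symDegree_eq_eigenspace]
  refine mem_iSup_inf_eigenspace _ two_pow_injective (fun x hx => ?_) hf ?_
  · refine ⟨fun g hg => ?_, ?_⟩
    · rw [AlgHom.toLinearMap_apply]
      conv_rhs => rw [← hx.1 g hg]
      rw [symAct_eq_symMap, symMap_symMap, symMap_symMap]
      congr 2
    · rw [AlgHom.toLinearMap_apply, algebraMapInv_symMap]; exact hx.2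
  · simp_rw [← symDegree_eq_eigenspace, iSup_symDegree]
    trivial

lemma eq_zero_of_mem_symDegree_zero {X : Type*} [AddCommGroup X] [Module K X]
    {f : SymmetricAlgebra K X} (hf : f ∈ symDegree K X 0)
    (h0 : SymmetricAlgebra.algebraMapInv f = 0) : f = 0 := by
  rw [symDegree, pow_zero] at hf
  obtain ⟨r, rfl⟩ := Submodule.mem_one.1 hf
  rw [AlgHom.commutes] at h0
  have : r = 0 := h0
  rw [this, map_zero]

/-- The homogeneous invariants of positive degree are polynomials in elements of `E*`, by induction
on the degree: such an invariant is a sum of elements of `E*` and products of invariants of smaller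
degree. -/
lemma mem_range_tau_of_homogeneous [CharZero K] (d : ℕ) {f : SymmetricAlgebra K (Dual K V)}
    (hf : f ∈ posInvariants (dualRep K V) L) (hd : f ∈ symDegree K (Dual K V) d) :
    f ∈ E.tau.range := by
  induction d using Nat.strong_induction_on generalizing f with
  | _ d ih =>
    set 𝔪 := posInvariants (dualRep K V) L
    let 𝒮 := symDegree K (Dual K V)
    let P : ℕ → Submodule K (SymmetricAlgebra K (Dual K V)) := fun d =>
      (E.space ⊓ 𝒮 d) ⊔ ⨆ (i : ℕ) (j : ℕ) (_ : i + j = d), (𝔪 ⊓ 𝒮 i) * (𝔪 ⊓ 𝒮 j)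
    have hP𝒮 : ∀ d, P d ≤ 𝒮 d := fun d => by
      refine sup_le inf_le_right (iSup_le fun i => iSup_le fun j => iSup_le fun hij => ?_)
      refine (mul_le_mul' inf_le_right inf_le_right).trans ?_
      subst hij
      exact (pow_add _ i j).ge
    have hind : iSupIndep 𝒮 := by
      have : 𝒮 = fun d => End.eigenspace
          (symMap ((2 : K) • LinearMap.id : Dual K V →ₗ[K] Dual K V)).toLinearMap (2 ^ d) :=
        funext fun d => symDegree_eq_eigenspace d
      rw [this]
      exact eigenspace_comp_iSupIndep _ two_pow_injective
    have hP : 𝔪 ≤ ⨆ d, P d := by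
      refine E.sup_eq.ge.trans (sup_le ?_ ?_)
      · conv_lhs => rw [E.graded]
        exact iSup_mono fun d => le_sup_left
      · rw [pow_two]
        refine (mul_le_mul' posInvariants_le_iSup posInvariants_le_iSup).trans ?_
        rw [Submodule.iSup_mul]
        refine iSup_le fun i => ?_
        rw [Submodule.mul_iSup]
        refine iSup_le fun j => le_iSup_of_le (i + j) (le_sup_of_le_right ?_)
        exact le_iSup_of_le i (le_iSup_of_le j (le_iSup_of_le rfl le_rfl))
    have hfP : f ∈ P d := mem_of_mem_iSup_of_iSupIndep hP𝒮 hind hd (hP hf)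
    have hPd : P d ≤ Subalgebra.toSubmodule E.tau.range := by
      refine sup_le (fun x hx => ⟨SymmetricAlgebra.ι K _ ⟨x, hx.1⟩, E.tau_ι _⟩)
        (iSup_le fun i => iSup_le fun j => iSup_le fun hij => Submodule.mul_le.2 ?_)
      intro a ha b hb
      rcases Nat.eq_zero_or_pos i with rfl | hi
      · rw [eq_zero_of_mem_symDegree_zero ha.2 ha.1.2, zero_mul]; exact Submodule.zero_mem _
      rcases Nat.eq_zero_or_pos j with rfl | hj
      · rw [eq_zero_of_mem_symDegree_zero hb.2 hb.1.2, mul_zero]; exact Submodule.zero_mem _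
      exact Subalgebra.mul_mem _ (ih i (by omega) ha.1 ha.2) (ih j (by omega) hb.1 hb.2)
    exact hPd hfP

/-- The homomorphism `τ` maps onto `S^L`. -/
lemma mem_range_tau [CharZero K] {f : SymmetricAlgebra K (Dual K V)}
    (hf : f ∈ invariantAlgebra (dualRep K V) L) : f ∈ E.tau.range := by
  have h1 := sub_algebraMapInv_mem_posInvariants hf
  have h2 : f - algebraMap K _ (SymmetricAlgebra.algebraMapInv f)
      ∈ Subalgebra.toSubmodule E.tau.range := by
    refine SetLike.le_def.1 (iSup_le fun d => ?_) (posInvariants_le_iSup h1)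
    exact fun x hx => E.mem_range_tau_of_homogeneous d hx.1 hx.2
  have h3 := Subalgebra.add_mem _ h2
    (Subalgebra.algebraMap_mem E.tau.range (SymmetricAlgebra.algebraMapInv f))
  simpa using h3

/-- Hilbert's argument: finitely many invariants generate the ideal of `S` spanned by all of them;
applying the Reynolds operator to the coefficients, these span `S^L_+` modulo its square. -/
lemma finiteDimensional_space [CharZero K] [FiniteDimensional K V] [Finite L] :
    FiniteDimensional K E.space := by
  set 𝔪 := posInvariants (dualRep K V) L with h𝔪
  have hnoeth : IsNoetherianRing (SymmetricAlgebra K (Dual K V)) :=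
    isNoetherianRing_of_ringEquiv _
      (SymmetricAlgebra.equivMvPolynomial (Module.finBasis K (Dual K V))).symm.toRingEquiv
  obtain ⟨t, ht𝔪, ht⟩ := (Submodule.fg_span_iff_fg_span_finset_subset
    (R := SymmetricAlgebra K (Dual K V)) (𝔪 : Set _)).1 (hnoeth.noetherian _)
  have hle : 𝔪 ≤ Submodule.span K (t : Set _) ⊔ 𝔪 ^ 2 := by
    have key : ∀ f ∈ Submodule.span (SymmetricAlgebra K (Dual K V)) (t : Set _), ∀ s,
        reynolds (dualRep K V) L (s * f) ∈ Submodule.span K (t : Set _) ⊔ 𝔪 ^ 2 := by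
      intro f hf
      induction hf using Submodule.span_induction with
      | mem p hp =>
        intro s
        have hp𝔪 := ht𝔪 hp
        rw [mul_comm, reynolds_mul (mem_posInvariants.1 hp𝔪).1]
        set r := reynolds (dualRep K V) L s
        have e : p * r = SymmetricAlgebra.algebraMapInv r • p
            + p * (r - algebraMap K _ (SymmetricAlgebra.algebraMapInv r)) := by
          rw [Algebra.smul_def]; ring
        rw [e, pow_two]
        exact Submodule.add_mem_sup (Submodule.smul_mem _ _ (Submodule.subset_span hp))
          (Submodule.mul_mem_mul hp𝔪 (sub_algebraMapInv_mem_posInvariants (reynolds_mem s)))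
      | zero => simp
      | add a b _ _ ha hb =>
        intro s
        rw [mul_add, map_add]
        exact Submodule.add_mem _ (ha s) (hb s)
      | smul c a _ ha =>
        intro s
        rw [smul_eq_mul, ← mul_assoc]
        exact ha _
    intro f hf
    have hf' : f ∈ Submodule.span (SymmetricAlgebra K (Dual K V)) (t : Set _) :=
      ht ▸ Submodule.subset_span hf
    have := key f hf' 1
    rwa [one_mul, reynolds_of_mem (mem_posInvariants.1 hf).1] at this
  let π := (𝔪 ^ 2).mkQ
  let F : Submodule K _ := (Submodule.span K (t : Set _)).map π
  have hF : FiniteDimensional K F := by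
    have : FiniteDimensional K (Submodule.span K (t : Set (SymmetricAlgebra K (Dual K V)))) :=
      FiniteDimensional.span_finset K t
    exact Module.Finite.map _ _
  have hmem : ∀ x : E.space, π x ∈ F := by
    intro x
    obtain ⟨a, ha, b, hb, hab⟩ := Submodule.mem_sup.1 (hle (E.space_le x.2))
    refine ⟨a, ha, ?_⟩
    have hb0 : π b = 0 := (Submodule.Quotient.mk_eq_zero _).2 hb
    rw [← hab, map_add, hb0, add_zero]
  refine Module.Finite.of_injective ((π ∘ₗ E.space.subtype).codRestrict F hmem) ?_
  rw [← LinearMap.ker_eq_bot, Submodule.eq_bot_iff]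
  intro x hx
  have h1 : π x = 0 := congrArg Subtype.val (LinearMap.mem_ker.1 hx)
  have h2 : (x : SymmetricAlgebra K (Dual K V)) ∈ 𝔪 ^ 2 := (Submodule.Quotient.mk_eq_zero _).1 h1
  exact Subtype.ext (Submodule.disjoint_def.1 E.disjoint x x.2 h2)

end EquivariantComplement

end Tau

/-! ### The isomorphism from the coinvariants of `Ḡ` onto the `L`-fixed coinvariants of `G` -/

section ReflectionAction

variable {K : Type*} [Field K] {X : Type*} [AddCommGroup X] [Module K X]
  {A : Type*} [Group A] {σ : Representation K A X}

lemma exists_eq_smul_of_finrank_range_eq_one {N : End K X}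
    (h : finrank K (LinearMap.range N) = 1) : ∃ (φ : Dual K X) (l : X), ∀ x, N x = φ x • l := by
  have : FiniteDimensional K (LinearMap.range N) := FiniteDimensional.of_finrank_pos (by omega)
  let e : LinearMap.range N ≃ₗ[K] K := LinearEquiv.ofFinrankEq _ _ (by rw [h, finrank_self])
  refine ⟨e.toLinearMap ∘ₗ N.rangeRestrict, e.symm 1, fun x => ?_⟩
  have h1 : e.symm (e (N.rangeRestrict x)) = e (N.rangeRestrict x) • e.symm 1 := by
    rw [← map_smul, smul_eq_mul, mul_one]
  rw [LinearEquiv.symm_apply_apply] at h1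
  exact congrArg Subtype.val h1

lemma eq_of_dual_eq {a b : A} (h : σ.dual a = σ.dual b) : σ a = σ b := by
  have h1 : σ a⁻¹ = σ b⁻¹ := by
    ext x
    refine (Module.forall_dual_apply_eq_zero_iff K _).1 (fun φ => ?_) |> sub_eq_zero.1
    rw [map_sub, sub_eq_zero]
    exact LinearMap.congr_fun (LinearMap.congr_fun h φ) x
  calc σ a = σ a * (σ b⁻¹ * σ b) := by rw [← map_mul, inv_mul_cancel, map_one, mul_one]
    _ = σ b := by rw [← h1, ← mul_assoc, ← map_mul, mul_inv_cancel, map_one, one_mul]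

/-- A group whose image in the dual of `X` is a reflection group acts on `X` by reflections. -/
lemma actsByReflections_of_dual [FiniteDimensional K X] {H : Subgroup A}
    (h : IsReflectionGroup (H.map σ.dual.asGroupHom)) : ActsByReflections σ H := by
  set C := Submonoid.closure
    {T : End K X | (∃ s ∈ H, σ s = T) ∧ ∃ (φ : Dual K X) (l : X), ∀ x, T x = x + φ x • l} with hC
  have key : ∀ u ∈ H.map σ.dual.asGroupHom,
      ∃ a ∈ H, σ.dual.asGroupHom a = u ∧ σ a ∈ C ∧ σ a⁻¹ ∈ C := by
    intro u hu
    rw [← h.2] at hu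
    induction hu using Subgroup.closure_induction with
    | mem u hu =>
      obtain ⟨⟨a, ha, rfl⟩, hr⟩ := hu
      have h1 : ((σ.dual.asGroupHom a : LinearMap.GeneralLinearGroup K (Dual K X)) :
          Dual K X →ₗ[K] Dual K X) - LinearMap.id = (σ a⁻¹ - LinearMap.id).dualMap := by
        ext φ x
        simp [Representation.asGroupHom_apply, Representation.dual_apply, Module.Dual.transpose]
      rw [IsPseudoReflection, h1, LinearMap.finrank_range_dualMap_eq_finrank_range] at hr
      obtain ⟨φ, l, hN⟩ := exists_eq_smul_of_finrank_range_eq_one hr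
      have h2 : ∀ x, σ a⁻¹ x = x + φ x • l := fun x => by
        rw [← hN, LinearMap.sub_apply, LinearMap.id_apply, add_sub_cancel]
      have h3 : ∀ x, σ a x = x + φ x • (-σ a l) := fun x => by
        have h4 : σ a (σ a⁻¹ x) = x := by
          rw [← Module.End.mul_apply, ← map_mul, mul_inv_cancel, map_one, Module.End.one_apply]
        rw [h2, map_add, map_smul] at h4
        rw [smul_neg, ← sub_eq_add_neg, eq_sub_iff_add_eq, h4]
      exact ⟨a, ha, rfl, Submonoid.subset_closure ⟨⟨a, ha, rfl⟩, φ, _, h3⟩,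
        Submonoid.subset_closure ⟨⟨a⁻¹, H.inv_mem ha, rfl⟩, φ, l, h2⟩⟩
    | one => exact ⟨1, H.one_mem, map_one _, by simp [C.one_mem], by simp [C.one_mem]⟩
    | mul u v _ _ hu hv =>
      obtain ⟨a, ha, rfl, h1, h2⟩ := hu
      obtain ⟨b, hb, rfl, h3, h4⟩ := hv
      exact ⟨a * b, H.mul_mem ha hb, map_mul _ _ _, by rw [map_mul]; exact C.mul_mem h1 h3,
        by rw [mul_inv_rev, map_mul]; exact C.mul_mem h4 h2⟩
    | inv u _ hu =>
      obtain ⟨a, ha, rfl, h1, h2⟩ := hu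
      exact ⟨a⁻¹, H.inv_mem ha, map_inv _ _, h2, by rwa [inv_inv]⟩
  intro g hg
  obtain ⟨a, -, h1, h2, -⟩ := key _ (Subgroup.mem_map_of_mem _ hg)
  have : σ a = σ g := eq_of_dual_eq (by
    rw [← Representation.asGroupHom_apply, h1, Representation.asGroupHom_apply])
  rwa [← this]

end ReflectionAction

section CoinvariantMap

lemma mem_eigenspace_iff_of_injective {K Y Y' : Type*} [Field K] [AddCommGroup Y] [Module K Y]
    [AddCommGroup Y'] [Module K Y'] {F : Y →ₗ[K] Y'} (hF : Function.Injective F) {Θ : End K Y}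
    {Θ' : End K Y'} (h : ∀ y, F (Θ y) = Θ' (F y)) (μ : K) (y : Y) :
    y ∈ Θ.eigenspace μ ↔ F y ∈ Θ'.eigenspace μ := by
  rw [End.mem_eigenspace_iff, End.mem_eigenspace_iff, ← h, ← F.map_smul, hF.eq_iff]

variable {K : Type*} [Field K] {X : Type*} [AddCommGroup X] [Module K X]
  {A : Type*} [Group A] {σ : Representation K A X} {G : Subgroup A}

lemma coinvariantAct_mk [G.Normal] (a : A) (f : SymmetricAlgebra K X) :
    coinvariantAct σ G a (coinvariantMk σ G f) = coinvariantMk σ G (symAct σ a f) := rfl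

/-- A linear map commuting with `G` acts on the coinvariants. -/
noncomputable def coinvariantMap (θ : X →ₗ[K] X) (hθ : ∀ g ∈ G, ∀ x, σ g (θ x) = θ (σ g x)) :
    Coinvariants σ G →ₐ[K] Coinvariants σ G :=
  Ideal.Quotient.liftₐ (coinvariantIdeal σ G) ((coinvariantMk σ G).comp (symMap θ))
    (fun _ hf => coinvariantMk_eq_zero.2 (symMap_mem_coinvariantIdeal hθ hf))

lemma coinvariantMap_mk {θ : X →ₗ[K] X} (hθ : ∀ g ∈ G, ∀ x, σ g (θ x) = θ (σ g x))
    (f : SymmetricAlgebra K X) :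
    coinvariantMap θ hθ (coinvariantMk σ G f) = coinvariantMk σ G (symMap θ f) := rfl

lemma coinvariantDegree_eq_eigenspace [CharZero K] {𝒮 : ℕ → Submodule K (SymmetricAlgebra K X)}
    {θ : X →ₗ[K] X} (hθ : ∀ g ∈ G, ∀ x, σ g (θ x) = θ (σ g x))
    (h𝒮 : ∀ d, 𝒮 d = End.eigenspace (symMap θ).toLinearMap ((2 : K) ^ d)) (htop : ⨆ d, 𝒮 d = ⊤)
    (d : ℕ) : coinvariantDegree σ 𝒮 G d
      = End.eigenspace (coinvariantMap θ hθ).toLinearMap ((2 : K) ^ d) := by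
  refine eq_of_le_of_iSupIndep (P := coinvariantDegree σ 𝒮 G) (fun d => ?_)
    (eigenspace_comp_iSupIndep _ two_pow_injective) ?_ d
  · rintro _ ⟨f, hf, rfl⟩
    have h1 : symMap θ f = (2 : K) ^ d • f := End.mem_eigenspace_iff.1 ((h𝒮 d).le hf)
    refine End.mem_eigenspace_iff.2 ?_
    rw [AlgHom.toLinearMap_apply, AlgHom.toLinearMap_apply, coinvariantMap_mk, h1, map_smul]
  · simp_rw [coinvariantDegree]
    rw [← Submodule.map_iSup, htop, Submodule.map_top, LinearMap.range_eq_top]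
    exact coinvariantMk_surjective

end CoinvariantMap

namespace EquivariantComplement

variable {K : Type*} [Field K] {V : Type*} [AddCommGroup V] [Module K V]
  {G L : Subgroup (LinearMap.GeneralLinearGroup K V)} (E : EquivariantComplement L)

variable (G) in
/-- The homomorphism `S̄_Ḡ → S_G` induced by `τ`. -/
noncomputable def coinvariantTau : Coinvariants (E.repBar G) (Gbar G L) →ₐ[K]
    Coinvariants (formRep G L) (subG G L) :=
  Ideal.Quotient.liftₐ (coinvariantIdeal (E.repBar G) (Gbar G L))
    ((coinvariantMk (formRep G L) (subG G L)).comp E.tau)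
    (fun _ hf => coinvariantMk_eq_zero.2 (E.tau_mem_coinvariantIdeal hf))

lemma coinvariantTau_mk (f : SymmetricAlgebra K E.space) :
    E.coinvariantTau G (coinvariantMk (E.repBar G) (Gbar G L) f)
      = coinvariantMk (formRep G L) (subG G L) (E.tau f) := rfl

lemma coinvariantTau_mem (x : Coinvariants (E.repBar G) (Gbar G L)) :
    E.coinvariantTau G x ∈ fixedCoinvariants (formRep G L) (subG G L) (subL G L) := by
  intro l hl
  obtain ⟨f, rfl⟩ := coinvariantMk_surjective x
  have h : symAct (formRep G L) l (E.tau f) = E.tau f := E.tau_mem_invariantAlgebra f l hl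
  rw [coinvariantTau_mk, coinvariantAct_mk, h]

variable (G) in
/-- The homomorphism `S̄_Ḡ → (S_G)^L` induced by `τ`. -/
noncomputable def tauBar : Coinvariants (E.repBar G) (Gbar G L) →ₐ[K]
    fixedCoinvariants (formRep G L) (subG G L) (subL G L) :=
  (E.coinvariantTau G).codRestrict _ E.coinvariantTau_mem

lemma coe_tauBar_mk (f : SymmetricAlgebra K E.space) :
    (E.tauBar G (coinvariantMk (E.repBar G) (Gbar G L) f) : Coinvariants (formRep G L) (subG G L))
      = coinvariantMk (formRep G L) (subG G L) (E.tau f) := rfl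

lemma coe_tauBar_coinvariantAct (n : commonNormalizer G L)
    (x : Coinvariants (E.repBar G) (Gbar G L)) :
    (E.tauBar G (coinvariantAct (E.repBar G) (Gbar G L) (quotientHom G L n) x) :
        Coinvariants (formRep G L) (subG G L))
      = coinvariantAct (formRep G L) (subG G L) n (E.tauBar G x) := by
  obtain ⟨f, rfl⟩ := coinvariantMk_surjective x
  rw [coinvariantAct_mk, coe_tauBar_mk, coe_tauBar_mk, coinvariantAct_mk, tau_symAct]

section Finite

variable [CharZero K] [Finite (subL G L)]

/-- Every `L`-fixed coinvariant is represented by an `L`-invariant polynomial. -/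
lemma exists_invariant_of_mem_fixedCoinvariants
    {x : Coinvariants (formRep G L) (subG G L)}
    (hx : x ∈ fixedCoinvariants (formRep G L) (subG G L) (subL G L)) :
    ∃ f ∈ invariantAlgebra (formRep G L) (subL G L), coinvariantMk _ _ f = x := by
  obtain ⟨f, rfl⟩ := coinvariantMk_surjective x
  refine ⟨reynolds (formRep G L) (subL G L) f, reynolds_mem f, ?_⟩
  rw [← sub_eq_zero, ← map_sub, coinvariantMk_eq_zero]
  refine reynolds_sub_mem fun l hl => ?_
  rw [← coinvariantMk_eq_zero, map_sub, sub_eq_zero]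
  exact hx l hl

lemma tauBar_surjective (hLN : L ≤ commonNormalizer G L) :
    Function.Surjective (E.tauBar G) := by
  rintro ⟨x, hx⟩
  obtain ⟨f, hf, rfl⟩ := exists_invariant_of_mem_fixedCoinvariants hx
  obtain ⟨p, rfl⟩ := E.mem_range_tau ((mem_invariantAlgebra_subL hLN).1 hf)
  exact ⟨coinvariantMk _ _ p, Subtype.ext rfl⟩

/-- The elements of `Ḡ` act on `S^L` by distinct maps, and there are as many of them as the
dimension of `S̄_Ḡ` allows, so the surjection `S̄_Ḡ → (S_G)^L` is bijective. -/
lemma tauBar_bijective [FiniteDimensional K V] [Finite (subG G L)]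
    (hLN : L ≤ commonNormalizer G L) (hLG : subL G L ≤ subG G L)
    (hgen : ActsByReflections (E.repBar G) (Gbar G L)) : Function.Bijective (E.tauBar G) := by
  have hsurj := E.tauBar_surjective hLN
  have : Finite (Gbar G L) := Set.Finite.image _ (Set.finite_coe_iff.1 ‹Finite (subG G L)›)
  have := Fintype.ofFinite (Gbar G L)
  have hrank := rank_coinvariants_le hgen
  have hfd : FiniteDimensional K (Coinvariants (E.repBar G) (Gbar G L)) :=
    Module.rank_lt_aleph0_iff.1 (hrank.trans_lt (Cardinal.natCast_lt_aleph0))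
  have hle : finrank K (Coinvariants (E.repBar G) (Gbar G L)) ≤ Nat.card (Gbar G L) :=
    finrank_le_of_rank_le hrank
  have hfd' : FiniteDimensional K (fixedCoinvariants (formRep G L) (subG G L) (subL G L)) :=
    Module.Finite.of_surjective (E.tauBar G).toLinearMap hsurj
  have hge : Nat.card (Gbar G L)
      ≤ finrank K (fixedCoinvariants (formRep G L) (subG G L) (subL G L)) := by
    let b := Module.finBasis K (fixedCoinvariants (formRep G L) (subG G L) (subL G L))
    choose x hxL hx using fun j => exists_invariant_of_mem_fixedCoinvariants (b j).2
    choose r hrG hr using fun q : Gbar G L => q.2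
    rw [Nat.card_eq_fintype_card]
    refine card_le_of_span_invariants hLG r hrG (fun q q' h => ?_) (fun f hf => ?_) hxL
    · have h1 : (r q')⁻¹ * r q ∈ subL G L := by
        refine mem_of_fixes_invariantAlgebra formRep_injective fun f hf => ?_
        rw [← symAct_symAct, h f hf, symAct_symAct, inv_mul_cancel, symAct_one_apply]
      apply Subtype.ext
      rw [← hr q, ← hr q']
      exact (QuotientGroup.eq.2 h1).symm
    · let y : fixedCoinvariants (formRep G L) (subG G L) (subL G L) :=
        ⟨coinvariantMk _ _ f, fun l hl => by rw [coinvariantAct_mk, hf l hl]⟩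
      refine ⟨b.repr y, ?_⟩
      rw [← coinvariantMk_eq_zero, map_sub, map_sum, sub_eq_zero]
      simp_rw [map_smul, hx]
      have := congrArg Subtype.val (b.sum_repr y)
      rw [AddSubmonoidClass.coe_finsetSum] at this
      exact this.symm
  have heq : finrank K (Coinvariants (E.repBar G) (Gbar G L))
      = finrank K (fixedCoinvariants (formRep G L) (subG G L) (subL G L)) :=
    le_antisymm (hle.trans hge) (LinearMap.finrank_le_finrank_of_surjective
      (f := (E.tauBar G).toLinearMap) hsurj)
  exact ⟨(LinearMap.injective_iff_surjective_of_finrank_eq_finrank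
    (f := (E.tauBar G).toLinearMap) heq).2 hsurj, hsurj⟩

end Finite

lemma formRep_comp_scaling (n : commonNormalizer G L) (x : Dual K V) :
    formRep G L n (((2 : K) • LinearMap.id : Dual K V →ₗ[K] Dual K V) x)
      = ((2 : K) • LinearMap.id : Dual K V →ₗ[K] Dual K V) (formRep G L n x) := by simp

lemma coinvariantTau_coinvariantMap (x : Coinvariants (E.repBar G) (Gbar G L)) :
    E.coinvariantTau G (coinvariantMap E.scaling (fun g _ => E.repBar_comp_scaling g) x)
      = coinvariantMap ((2 : K) • LinearMap.id) (fun g _ => formRep_comp_scaling g)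
        (E.coinvariantTau G x) := by
  obtain ⟨f, rfl⟩ := coinvariantMk_surjective x
  rw [coinvariantMap_mk, coinvariantTau_mk, coinvariantTau_mk, coinvariantMap_mk,
    E.tau_symMap E.coe_scaling]

lemma mem_coinvariantDegree_iff [CharZero K] (hinj : Function.Injective (E.coinvariantTau G))
    (d : ℕ) (x : Coinvariants (E.repBar G) (Gbar G L)) :
    x ∈ coinvariantDegree (E.repBar G) E.degree (Gbar G L) d ↔
      E.coinvariantTau G x ∈
        coinvariantDegree (formRep G L) (symDegree K (Dual K V)) (subG G L) d := by
  have h1 := coinvariantDegree_eq_eigenspace (G := Gbar G L)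
    (fun g _ => E.repBar_comp_scaling g) E.degree_eq_eigenspace E.iSup_degree d
  have h2 := coinvariantDegree_eq_eigenspace (G := subG G L) (σ := formRep G L)
    (𝒮 := symDegree K (Dual K V)) (θ := (2 : K) • LinearMap.id)
    (fun g _ => formRep_comp_scaling g) symDegree_eq_eigenspace iSup_symDegree d
  rw [h1, h2]
  exact mem_eigenspace_iff_of_injective (F := (E.coinvariantTau G).toLinearMap) hinj
    E.coinvariantTau_coinvariantMap _ x

end EquivariantComplement

/-! ### Covariants with harmonic coefficients -/

section Covariants

variable {K : Type*} [Field K] {X : Type*} [AddCommGroup X] [Module K X]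
  {A : Type*} [Group A] {σ : Representation K A X} {G : Subgroup A}

/-- The coinvariant algebra of a finite group is finite-dimensional: module generators of `S(X)`
over `S(X)^G` span it. -/
lemma finiteDimensional_coinvariants [FiniteDimensional K X] [Finite G] :
    FiniteDimensional K (Coinvariants σ G) := by
  obtain ⟨k, t, ht⟩ := (finite_invariantAlgebra (σ := σ) (G := G)).exists_fin
  classical
  refine Module.Finite.of_fg_top ⟨Finset.univ.image fun i => coinvariantMk σ G (t i), ?_⟩
  rw [eq_top_iff]
  rintro x -
  obtain ⟨f, rfl⟩ := coinvariantMk_surjective x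
  have hf : f ∈ Submodule.span (invariantAlgebra σ G) (Set.range t) := ht ▸ Submodule.mem_top
  obtain ⟨a, rfl⟩ := (Submodule.mem_span_range_iff_exists_fun _).1 hf
  rw [map_sum]
  refine Submodule.sum_mem _ fun i _ => ?_
  have h1 : coinvariantMk σ G (a i • t i)
      = SymmetricAlgebra.algebraMapInv (a i : SymmetricAlgebra K X) • coinvariantMk σ G (t i) := by
    rw [← map_smul, ← sub_eq_zero, ← map_sub, coinvariantMk_eq_zero, Algebra.smul_def,
      Algebra.smul_def, ← sub_mul]
    exact Ideal.mul_mem_right _ _ (posInvariants_le_coinvariantIdeal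
      (sub_algebraMapInv_mem_posInvariants (a i).2))
  rw [h1]
  exact Submodule.smul_mem _ _ (Submodule.subset_span (by simp))

lemma finiteDimensional_harmonics [CharZero K] [FiniteDimensional K X] [Finite G] :
    FiniteDimensional K (harmonics σ G) := by
  have := finiteDimensional_coinvariants (σ := σ) (G := G)
  refine Module.Finite.of_injective
    ((coinvariantMk σ G).toLinearMap ∘ₗ (harmonics σ G).subtype) ?_
  rw [← LinearMap.ker_eq_bot, Submodule.eq_bot_iff]
  intro f hf
  exact Subtype.ext (Submodule.disjoint_def.1 (isCompl_harmonics σ G).disjoint f f.2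
    (coinvariantMk_eq_zero.1 hf))

variable {M : Type*} [AddCommGroup M] [Module K M] {γ : A}
  {ρ : Representation K (cosetGroup G γ) M}

lemma mem_harmonicCovariants {w : SymmetricAlgebra K X ⊗[K] Dual K M} :
    w ∈ harmonicCovariants σ G γ ρ ↔
      w ∈ LinearMap.range ((harmonics σ G).subtype.rTensor (Dual K M)) ∧
        ∀ g : cosetGroup G γ, (g : A) ∈ G → covariantRep σ G γ ρ g w = w := by
  simp [harmonicCovariants, Submodule.mem_iInf, sub_eq_zero]

lemma covariantRep_apply (g : cosetGroup G γ) : covariantRep σ G γ ρ g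
    = TensorProduct.map (symAct σ (g : A)).toLinearMap (ρ.dual g) := rfl

lemma finiteDimensional_harmonicCovariants [CharZero K] [FiniteDimensional K X] [Finite G]
    [FiniteDimensional K M] : FiniteDimensional K (harmonicCovariants σ G γ ρ) := by
  have := finiteDimensional_harmonics (σ := σ) (G := G)
  exact Submodule.finiteDimensional_of_le (inf_le_left :
    _ ≤ LinearMap.range ((harmonics σ G).subtype.rTensor (Dual K M)))

/-- A tensor product of maps of which the first preserves a subspace `P` preserves `P ⊗ N`. -/
lemma map_mem_range_rTensor {S S' N : Type*} [AddCommGroup S] [Module K S] [AddCommGroup S']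
    [Module K S'] [AddCommGroup N] [Module K N] {P : Submodule K S} {P' : Submodule K S'}
    {f : S →ₗ[K] S'} (hf : ∀ x ∈ P, f x ∈ P') (g : N →ₗ[K] N) {w : S ⊗[K] N}
    (hw : w ∈ LinearMap.range (P.subtype.rTensor N)) :
    TensorProduct.map f g w ∈ LinearMap.range (P'.subtype.rTensor N) := by
  obtain ⟨u, rfl⟩ := hw
  induction u with
  | zero => simp
  | add a b ha hb => rw [map_add, map_add]; exact Submodule.add_mem _ ha hb
  | tmul x n => exact ⟨⟨f x, hf x x.2⟩ ⊗ₜ g n, by simp⟩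

lemma covariantRep_mem_harmonicCovariants [G.Normal] (a : cosetGroup G γ)
    {w : SymmetricAlgebra K X ⊗[K] Dual K M} (hw : w ∈ harmonicCovariants σ G γ ρ) :
    covariantRep σ G γ ρ a w ∈ harmonicCovariants σ G γ ρ := by
  obtain ⟨h1, h2⟩ := mem_harmonicCovariants.1 hw
  refine mem_harmonicCovariants.2
    ⟨map_mem_range_rTensor (fun f hf => symAct_mem_harmonics (a : A) hf) _ h1, fun g hg => ?_⟩
  have h3 := h2 (a⁻¹ * g * a) (by
    simpa using Subgroup.Normal.conj_mem ‹G.Normal› (g : A) hg (a : A)⁻¹)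
  calc covariantRep σ G γ ρ g (covariantRep σ G γ ρ a w)
      = covariantRep σ G γ ρ a (covariantRep σ G γ ρ (a⁻¹ * g * a) w) := by
        rw [← End.mul_apply, ← End.mul_apply, ← map_mul, ← map_mul]
        congr 2
        group
    _ = covariantRep σ G γ ρ a w := by rw [h3]

lemma covariantRep_rTensor {θ : X →ₗ[K] X} (hθ : ∀ a x, σ a (θ x) = θ (σ a x))
    (a : cosetGroup G γ) (w : SymmetricAlgebra K X ⊗[K] Dual K M) :
    covariantRep σ G γ ρ a ((symMap θ).toLinearMap.rTensor (Dual K M) w)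
      = (symMap θ).toLinearMap.rTensor (Dual K M) (covariantRep σ G γ ρ a w) := by
  rw [covariantRep_apply]
  induction w with
  | zero => simp
  | add x y hx hy => simp only [map_add, hx, hy]
  | tmul f m =>
    have : symAct σ (a : A) (symMap θ f) = symMap θ (symAct σ (a : A) f) := by
      rw [symAct_eq_symMap, symMap_symMap, symMap_symMap]
      congr 2
      exact LinearMap.ext (hθ a)
    simp [this]

lemma rTensor_mem_harmonicCovariants {θ θ' : X →ₗ[K] X} (h1 : θ ∘ₗ θ' = LinearMap.id)
    (h2 : θ' ∘ₗ θ = LinearMap.id) (hθ : ∀ a x, σ a (θ x) = θ (σ a x))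
    {w : SymmetricAlgebra K X ⊗[K] Dual K M} (hw : w ∈ harmonicCovariants σ G γ ρ) :
    (symMap θ).toLinearMap.rTensor (Dual K M) w ∈ harmonicCovariants σ G γ ρ := by
  obtain ⟨h3, h4⟩ := mem_harmonicCovariants.1 hw
  refine mem_harmonicCovariants.2 ⟨map_mem_range_rTensor (fun f hf => ?_) _ h3, fun g hg => ?_⟩
  · exact symMap_mem_harmonics h1 h2 (fun g hg => ⟨g, hg, LinearMap.ext (hθ g)⟩) hf
  · rw [covariantRep_rTensor hθ, h4 g hg]

lemma isFactorDegreePairs_iff [CharZero K] {𝒮 : ℕ → Submodule K (SymmetricAlgebra K X)}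
    {Θ : End K (SymmetricAlgebra K X)} (h𝒮 : ∀ d, 𝒮 d = Θ.eigenspace ((2 : K) ^ d))
    (htop : ⨆ d, 𝒮 d = ⊤) {p : Multiset (K × ℕ)} :
    IsFactorDegreePairs σ 𝒮 G γ ρ p ↔ IsJointEigenPairs (harmonicCovariants σ G γ ρ)
      (covariantRep σ G γ ρ (cosetElt G γ)) (Θ.rTensor (Dual K M)) p := by
  simp only [IsFactorDegreePairs, IsJointEigenPairs, range_rTensor_eq_eigenspace h𝒮 htop,
    End.mem_eigenspace_iff]

/-- The inverse of a diagonalizable operator is diagonalizable. -/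
lemma iSup_eigenspace_inv {B N : Type*} [Group B] [AddCommGroup N] [Module K N]
    (τ : Representation K B N) {b : B} (h : ⨆ μ, End.eigenspace (τ b) μ = ⊤) :
    ⨆ μ, End.eigenspace (τ b⁻¹) μ = ⊤ := by
  rw [eq_top_iff, ← h]
  refine iSup_le fun μ x hx => Submodule.mem_iSup_of_mem μ⁻¹ (End.mem_eigenspace_iff.2 ?_)
  have h1 : τ b x = μ • x := End.mem_eigenspace_iff.1 hx
  have h2 : τ b⁻¹ (τ b x) = x := by
    rw [← End.mul_apply, ← map_mul, inv_mul_cancel, map_one, End.one_apply]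
  rw [h1, map_smul] at h2
  rcases eq_or_ne μ 0 with rfl | hμ
  · rw [← h2, zero_smul, map_zero, smul_zero]
  · rw [eq_inv_smul_iff₀ hμ, h2]

lemma exists_isJointEigenPairs_harmonicCovariants [CharZero K] [FiniteDimensional K X]
    [Finite G] [G.Normal] [FiniteDimensional K M] (hγ : ⨆ μ, End.eigenspace (σ γ) μ = ⊤)
    (hρ : ⨆ μ, End.eigenspace (ρ (cosetElt G γ)) μ = ⊤) {θ θ' : X →ₗ[K] X}
    (h1 : θ ∘ₗ θ' = LinearMap.id) (h2 : θ' ∘ₗ θ = LinearMap.id)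
    (hθ : ∀ a x, σ a (θ x) = θ (σ a x))
    (hΘ : ⨆ d : ℕ, End.eigenspace (symMap θ).toLinearMap ((2 : K) ^ d) = ⊤) :
    ∃ p, IsJointEigenPairs (harmonicCovariants σ G γ ρ) (covariantRep σ G γ ρ (cosetElt G γ))
      ((symMap θ).toLinearMap.rTensor (Dual K M)) p := by
  have := finiteDimensional_harmonicCovariants (σ := σ) (G := G) (γ := γ) (ρ := ρ)
  refine exists_isJointEigenPairs _ _ _ (fun w hw => covariantRep_mem_harmonicCovariants _ hw)
    (fun w hw => rTensor_mem_harmonicCovariants h1 h2 hθ hw)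
    (fun w => covariantRep_rTensor hθ _ w) ?_ ?_
  · exact iSup_eigenspace_tensor_map (iSup_eigenspace_symMap hγ)
      (iSup_eigenspace_dualMap (iSup_eigenspace_inv ρ hρ))
  · simp_rw [← range_rTensor_eq_eigenspace (N := Dual K M) (𝒮 := fun d : ℕ =>
      End.eigenspace (symMap θ).toLinearMap ((2 : K) ^ d)) (fun _ => rfl) hΘ]
    rw [eq_top_iff, ← TensorProduct.span_tmul_eq_top, Submodule.span_le]
    rintro _ ⟨s, n, rfl⟩
    have hs : s ∈ ⨆ d : ℕ, End.eigenspace (symMap θ).toLinearMap ((2 : K) ^ d) :=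
      hΘ ▸ Submodule.mem_top
    rw [SetLike.mem_coe]
    induction hs using Submodule.iSup_induction' with
    | zero => simp
    | add a b _ _ ha hb => rw [TensorProduct.add_tmul]; exact Submodule.add_mem _ ha hb
    | mem d s hs => exact Submodule.mem_iSup_of_mem d ⟨⟨s, hs⟩ ⊗ₜ n, by simp⟩

end Covariants

/-! ### Transport of covariants from `G/L` to `G` -/

section Transfer

lemma dual_comp {K A B M : Type*} [Field K] [Group A] [Group B] [AddCommGroup M] [Module K M]
    (ρ : Representation K B M) (f : A →* B) (a : A) :
    Representation.dual (ρ.comp f) a = ρ.dual (f a) := by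
  rw [Representation.dual_apply, Representation.dual_apply, MonoidHom.comp_apply, map_inv]

variable {K : Type*} [Field K] {X X' : Type*} [AddCommGroup X] [Module K X]
  [AddCommGroup X'] [Module K X'] {A B : Type*} [Group A] [Group B] {q : A →* B}
  {σ : Representation K A X} {σ' : Representation K B X'} {G L : Subgroup A}
  {M : Type*} [AddCommGroup M] [Module K M] {γ : A}
  {ρ : Representation K (cosetGroup (G.map q) (q γ)) M}
  {J : SymmetricAlgebra K X' →ₗ[K] SymmetricAlgebra K X}

lemma rTensor_covariantRep (hJ : ∀ a f, J (symAct σ' (q a) f) = symAct σ a (J f))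
    (a : cosetGroup G γ) (w : SymmetricAlgebra K X' ⊗[K] Dual K M) :
    J.rTensor (Dual K M) (covariantRep σ' (G.map q) (q γ) ρ (cosetHom q G γ a) w)
      = covariantRep σ G γ (ρ.comp (cosetHom q G γ)) a (J.rTensor (Dual K M) w) := by
  induction w with
  | zero => simp
  | add x y hx hy => simp only [map_add, hx, hy]
  | tmul f m =>
    rw [covariantRep_apply, covariantRep_apply, TensorProduct.map_tmul, LinearMap.rTensor_tmul,
      LinearMap.rTensor_tmul, TensorProduct.map_tmul]
    congr 1
    · exact hJ a f
    · rw [dual_comp]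

/-- An equivariant map `J` that restricts to an isomorphism of the harmonics of `G/L` onto the
`L`-fixed harmonics of `G` induces an isomorphism of the covariants of `G/L` with values in `M*`
onto those of `G`, because `L` acts trivially on `M`. -/
lemma exists_harmonicCovariants_equiv [CharZero K] [Finite L] (hLG : L ≤ G) (hLq : L ≤ q.ker)
    (hJ : ∀ a f, J (symAct σ' (q a) f) = symAct σ a (J f))
    (hJG : ∀ f ∈ harmonics σ' (G.map q), J f ∈ harmonics σ G)
    (hinj : ∀ f ∈ harmonics σ' (G.map q), J f = 0 → f = 0)
    (hsurj : ∀ h ∈ harmonics σ G, h ∈ invariantAlgebra σ L →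
      ∃ f ∈ harmonics σ' (G.map q), J f = h)
    (hstab : ∀ a, ∀ f ∈ harmonics σ G, symAct σ a f ∈ harmonics σ G)
    (hstab' : ∀ b, ∀ f ∈ harmonics σ' (G.map q), symAct σ' b f ∈ harmonics σ' (G.map q)) :
    ∃ e : harmonicCovariants σ' (G.map q) (q γ) ρ
        ≃ₗ[K] harmonicCovariants σ G γ (ρ.comp (cosetHom q G γ)),
      ∀ w, (e w : SymmetricAlgebra K X ⊗[K] Dual K M) = J.rTensor (Dual K M) w := by
  have hmem : ∀ w ∈ harmonicCovariants σ' (G.map q) (q γ) ρ, J.rTensor (Dual K M) w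
      ∈ harmonicCovariants σ G γ (ρ.comp (cosetHom q G γ)) := by
    intro w hw
    obtain ⟨h1, h2⟩ := mem_harmonicCovariants.1 hw
    refine mem_harmonicCovariants.2 ⟨map_mem_range_rTensor hJG _ h1, fun g hg => ?_⟩
    rw [← rTensor_covariantRep hJ, h2 _ (Subgroup.mem_map_of_mem q hg)]
  have hinj' : ∀ w ∈ LinearMap.range ((harmonics σ' (G.map q)).subtype.rTensor (Dual K M)),
      J.rTensor (Dual K M) w = 0 → w = 0 := by
    rintro _ ⟨u, rfl⟩ h
    rw [← LinearMap.rTensor_comp_apply] at h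
    have h1 : Function.Injective (J ∘ₗ (harmonics σ' (G.map q)).subtype) := by
      rw [← LinearMap.ker_eq_bot, Submodule.eq_bot_iff]
      exact fun f hf => Subtype.ext (hinj f f.2 hf)
    have h2 := Module.Flat.rTensor_preserves_injective_linearMap (M := Dual K M) _ h1
    rw [h2 (h.trans (map_zero _).symm), map_zero]
  let F : harmonicCovariants σ' (G.map q) (q γ) ρ
      →ₗ[K] harmonicCovariants σ G γ (ρ.comp (cosetHom q G γ)) :=
    (J.rTensor (Dual K M)).restrict hmem
  have hF : Function.Injective F := by
    intro w w' h
    have h1 : J.rTensor (Dual K M) w = J.rTensor (Dual K M) w' := congrArg Subtype.val h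
    refine Subtype.ext (sub_eq_zero.1 (hinj' _ (Submodule.sub_mem _ w.2.1 w'.2.1) ?_))
    rw [map_sub, h1, sub_self]
  have hFs : Function.Surjective F := by
    rintro ⟨w, hw⟩
    obtain ⟨⟨u, hu⟩, h2⟩ := mem_harmonicCovariants.1 hw
    have := Fintype.ofFinite L
    -- averaging over `L` does not change `w`, as `L` acts only on the polynomial factor
    have hR : (reynolds σ L).rTensor (Dual K M) w = w := by
      have h3 : ∀ l : L, (symAct σ (l : A)).toLinearMap.rTensor (Dual K M) w = w := by
        intro l
        let g : cosetGroup G γ := ⟨l, (le_sup_left : G ≤ _) (hLG l.2)⟩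
        have h4 : cosetHom q G γ g = 1 := Subtype.ext (hLq l.2)
        have h5 : Representation.dual (ρ.comp (cosetHom q G γ)) g = LinearMap.id := by
          rw [dual_comp, h4, map_one]
          rfl
        have h6 := h2 g (hLG l.2)
        rw [covariantRep_apply, h5] at h6
        exact h6
      have h7 : reynolds σ L
          = (Nat.card L : K)⁻¹ • ∑ l : L, (symAct σ (l : A)).toLinearMap := by
        ext1 f
        rw [reynolds_apply]
        simp
      have h8 : (∑ l : L, (symAct σ (l : A)).toLinearMap).rTensor (Dual K M)
          = ∑ l : L, (symAct σ (l : A)).toLinearMap.rTensor (Dual K M) :=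
        map_sum (LinearMap.rTensorHom (Dual K M)) _ _
      rw [h7, LinearMap.rTensor_smul, h8, LinearMap.smul_apply, LinearMap.sum_apply,
        Finset.sum_congr rfl fun l _ => h3 l, Finset.sum_const, Finset.card_univ,
        ← Nat.card_eq_fintype_card, ← Nat.cast_smul_eq_nsmul K, smul_smul,
        inv_mul_cancel₀ natCard_ne_zero, one_smul]
    have hrange : ∀ u : harmonics σ G ⊗[K] Dual K M, ∃ v : harmonics σ' (G.map q) ⊗[K] Dual K M,
        J.rTensor (Dual K M) ((harmonics σ' (G.map q)).subtype.rTensor (Dual K M) v)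
          = (reynolds σ L).rTensor (Dual K M) ((harmonics σ G).subtype.rTensor (Dual K M) u) := by
      intro u
      induction u with
      | zero => exact ⟨0, by simp⟩
      | add x y hx hy =>
        obtain ⟨a, ha⟩ := hx
        obtain ⟨b, hb⟩ := hy
        exact ⟨a + b, by simp only [map_add, ha, hb]⟩
      | tmul h m =>
        obtain ⟨f, hf, hfh⟩ := hsurj (reynolds σ L h) (by
          rw [reynolds_apply]
          exact Submodule.smul_mem _ _ (Submodule.sum_mem _ fun l _ => hstab _ _ h.2))
          (reynolds_mem _)
        exact ⟨⟨f, hf⟩ ⊗ₜ m, by simp [hfh]⟩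
    obtain ⟨v, hv⟩ := hrange u
    rw [hu, hR] at hv
    refine ⟨⟨(harmonics σ' (G.map q)).subtype.rTensor (Dual K M) v,
      mem_harmonicCovariants.2 ⟨⟨v, rfl⟩, fun b hb => ?_⟩⟩, Subtype.ext hv⟩
    obtain ⟨g, hg, hgb⟩ := hb
    let g' : cosetGroup G γ := ⟨g, (le_sup_left : G ≤ _) hg⟩
    have hb' : b = cosetHom q G γ g' := Subtype.ext hgb.symm
    rw [← sub_eq_zero]
    refine hinj' _ (Submodule.sub_mem _ (map_mem_range_rTensor (hstab' _) _ ⟨v, rfl⟩) ⟨v, rfl⟩) ?_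
    rw [map_sub, hb', rTensor_covariantRep hJ, hv, h2 g' hg, sub_self]
  exact ⟨LinearEquiv.ofBijective F ⟨hF, hFs⟩, fun w => rfl⟩

lemma isJointEigenPairs_of_rTensor {W : Submodule K (SymmetricAlgebra K X' ⊗[K] Dual K M)}
    {W' : Submodule K (SymmetricAlgebra K X ⊗[K] Dual K M)} (e : W ≃ₗ[K] W')
    (he : ∀ w, (e w : SymmetricAlgebra K X ⊗[K] Dual K M) = J.rTensor (Dual K M) w)
    (hJ : ∀ a f, J (symAct σ' (q a) f) = symAct σ a (J f))
    {Θ : End K (SymmetricAlgebra K X')} {Θ' : End K (SymmetricAlgebra K X)}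
    (hΘ : ∀ f, J (Θ f) = Θ' (J f)) {p : Multiset (K × ℕ)}
    (hp : IsJointEigenPairs W (covariantRep σ' (G.map q) (q γ) ρ (cosetElt (G.map q) (q γ)))
      (Θ.rTensor (Dual K M)) p) :
    IsJointEigenPairs W' (covariantRep σ G γ (ρ.comp (cosetHom q G γ)) (cosetElt G γ))
      (Θ'.rTensor (Dual K M)) p := by
  refine hp.map e (fun w μ hw => ?_) (fun w μ hw => ?_)
  · have h := rTensor_covariantRep (ρ := ρ) hJ (cosetElt G γ)
      (w : SymmetricAlgebra K X' ⊗[K] Dual K M)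
    have h1 : cosetHom q G γ (cosetElt G γ) = cosetElt (G.map q) (q γ) := rfl
    rw [he, ← h, h1, hw, LinearMap.map_smul]
  · have h : Θ' ∘ₗ J = J ∘ₗ Θ := LinearMap.ext fun f => (hΘ f).symm
    rw [he, ← LinearMap.rTensor_comp_apply, h, LinearMap.rTensor_comp_apply, hw,
      LinearMap.map_smul]

end Transfer

/-! ### Equality of the factors of `Ḡγ̄` and `Gγ` -/

section Diagonalizable

variable {K : Type*} [Field K] {Y : Type*} [AddCommGroup Y] [Module K Y]

lemma iSup_eigenspace_of_stable {f : End K Y} {p : Submodule K Y} {g : End K p}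
    (hg : ∀ x, (g x : Y) = f x) (hf : ⨆ μ, f.eigenspace μ = ⊤) : ⨆ μ, g.eigenspace μ = ⊤ := by
  rw [eq_top_iff]
  rintro ⟨x, hx⟩ -
  have h1 := mem_iSup_inf_eigenspace f (c := id) Function.injective_id (p := p)
    (fun y hy => hg ⟨y, hy⟩ ▸ (g ⟨y, hy⟩).2) hx (hf ▸ Submodule.mem_top)
  have h2 : ⨆ μ, p ⊓ f.eigenspace (id μ) ≤ (⨆ μ, g.eigenspace μ).map p.subtype := by
    refine iSup_le fun μ y hy => ⟨⟨y, hy.1⟩, Submodule.mem_iSup_of_mem μ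
      (End.mem_eigenspace_iff.2 (Subtype.ext ?_)), rfl⟩
    rw [hg]
    exact End.mem_eigenspace_iff.1 hy.2
  obtain ⟨y, hy, h⟩ := h2 h1
  have : y = ⟨x, hx⟩ := Subtype.ext h
  exact this ▸ hy

end Diagonalizable

namespace EquivariantComplement

variable {K : Type*} [Field K] {V : Type*} [AddCommGroup V] [Module K V]
  {G L : Subgroup (LinearMap.GeneralLinearGroup K V)} (E : EquivariantComplement L)

lemma iSup_eigenspace_formRep [FiniteDimensional K V] (γ : commonNormalizer G L)
    (h : ⨆ μ, End.eigenspace ((γ : LinearMap.GeneralLinearGroup K V) : V →ₗ[K] V) μ = ⊤) :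
    ⨆ μ, End.eigenspace (formRep G L γ) μ = ⊤ :=
  iSup_eigenspace_dualMap (iSup_eigenspace_inv (Units.coeHom (V →ₗ[K] V) : Representation K _ V)
    (b := (γ : LinearMap.GeneralLinearGroup K V)) h)

lemma iSup_eigenspace_repBar [FiniteDimensional K V] (γ : commonNormalizer G L)
    (h : ⨆ μ, End.eigenspace ((γ : LinearMap.GeneralLinearGroup K V) : V →ₗ[K] V) μ = ⊤) :
    ⨆ μ, End.eigenspace (E.repBar G (quotientHom G L γ)) μ = ⊤ :=
  iSup_eigenspace_of_stable (f := (symMap (formRep G L γ)).toLinearMap) (fun _ => rfl)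
    (iSup_eigenspace_symMap (iSup_eigenspace_formRep γ h))

lemma exists_inverse_scaling [CharZero K] [FiniteDimensional K E.space] :
    ∃ θ', E.scaling ∘ₗ θ' = LinearMap.id ∧ θ' ∘ₗ E.scaling = LinearMap.id := by
  have hinj : Function.Injective E.scaling := by
    rw [← LinearMap.ker_eq_bot, Submodule.eq_bot_iff]
    intro x hx
    have h1 : symMap ((2 : K) • LinearMap.id : Dual K V →ₗ[K] Dual K V) x = 0 :=
      congrArg Subtype.val hx
    have h2 := congrArg (symMap ((2 : K)⁻¹ • LinearMap.id : Dual K V →ₗ[K] Dual K V)) h1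
    rw [symMap_symMap, map_zero, LinearMap.smul_comp, LinearMap.id_comp, smul_smul,
      inv_mul_cancel₀ two_ne_zero, one_smul, symMap_id] at h2
    exact Subtype.ext h2
  let e := LinearEquiv.ofInjectiveEndo E.scaling hinj
  refine ⟨e.symm.toLinearMap, LinearMap.ext fun x => ?_, LinearMap.ext fun x => ?_⟩
  · exact e.apply_symm_apply x
  · exact e.symm_apply_apply x

lemma exists_isJointEigenPairs_repBar [CharZero K] [FiniteDimensional K V]
    [FiniteDimensional K E.space] [Finite (Gbar G L)] (γ : commonNormalizer G L)
    (hγ : ⨆ μ, End.eigenspace ((γ : LinearMap.GeneralLinearGroup K V) : V →ₗ[K] V) μ = ⊤)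
    {M : Type*} [AddCommGroup M] [Module K M] [FiniteDimensional K M]
    (ρ : Representation K (cosetGroup (Gbar G L) (quotientHom G L γ)) M)
    (hρ : ⨆ μ, End.eigenspace (ρ (cosetElt (Gbar G L) (quotientHom G L γ))) μ = ⊤) :
    ∃ p, IsJointEigenPairs (harmonicCovariants (E.repBar G) (Gbar G L) (quotientHom G L γ) ρ)
      (covariantRep (E.repBar G) (Gbar G L) (quotientHom G L γ) ρ
        (cosetElt (Gbar G L) (quotientHom G L γ)))
      ((symMap E.scaling).toLinearMap.rTensor (Dual K M)) p := by
  obtain ⟨θ', hθ1, hθ2⟩ := E.exists_inverse_scaling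
  refine exists_isJointEigenPairs_harmonicCovariants (E.iSup_eigenspace_repBar γ hγ) hρ
    hθ1 hθ2 E.repBar_comp_scaling ?_
  simp_rw [← degree_eq_eigenspace]
  exact E.iSup_degree

lemma exists_isFactorDegreePairs_repBar [CharZero K] [FiniteDimensional K V]
    [FiniteDimensional K E.space] [Finite (Gbar G L)] (γ : commonNormalizer G L)
    (hγ : ⨆ μ, End.eigenspace ((γ : LinearMap.GeneralLinearGroup K V) : V →ₗ[K] V) μ = ⊤)
    {M : Type*} [AddCommGroup M] [Module K M] [FiniteDimensional K M]
    (ρ : Representation K (cosetGroup (Gbar G L) (quotientHom G L γ)) M)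
    (hρ : ⨆ μ, End.eigenspace (ρ (cosetElt (Gbar G L) (quotientHom G L γ))) μ = ⊤) :
    ∃ p, IsFactorDegreePairs (E.repBar G) (symDegree K E.space) (Gbar G L)
      (quotientHom G L γ) ρ p := by
  simp_rw [isFactorDegreePairs_iff symDegree_eq_eigenspace iSup_symDegree]
  refine exists_isJointEigenPairs_harmonicCovariants (E.iSup_eigenspace_repBar γ hγ) hρ
    (θ' := (2 : K)⁻¹ • LinearMap.id) (by ext1 x; simp) (by ext1 x; simp) (by simp) ?_
  simp_rw [← symDegree_eq_eigenspace]
  exact iSup_symDegree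

section Harmonic

variable [CharZero K] [FiniteDimensional K V] [Finite (subG G L)]

variable (G) in
/-- The map `S̄ → ℋ`, where `ℋ` is the space of `G`-harmonic polynomials: apply `τ` and project
along the ideal generated by the invariants of `G` without constant term. -/
noncomputable def harmonicTau :
    SymmetricAlgebra K E.space →ₗ[K] SymmetricAlgebra K (Dual K V) :=
  (harmonics (formRep G L) (subG G L)).projection
    ((coinvariantIdeal (formRep G L) (subG G L)).restrictScalars K)
    (isCompl_harmonics (formRep G L) (subG G L)) ∘ₗ E.tau.toLinearMap

lemma harmonicTau_mem (f : SymmetricAlgebra K E.space) :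
    E.harmonicTau G f ∈ harmonics (formRep G L) (subG G L) :=
  Submodule.projection_apply_mem _ _

lemma tau_sub_harmonicTau_mem (f : SymmetricAlgebra K E.space) :
    E.tau f - E.harmonicTau G f ∈ coinvariantIdeal (formRep G L) (subG G L) :=
  Submodule.sub_projection_mem (isCompl_harmonics (formRep G L) (subG G L)) (E.tau f)

lemma eq_harmonicTau {f : SymmetricAlgebra K E.space} {h : SymmetricAlgebra K (Dual K V)}
    (hh : h ∈ harmonics (formRep G L) (subG G L))
    (hf : E.tau f - h ∈ coinvariantIdeal (formRep G L) (subG G L)) : E.harmonicTau G f = h := by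
  rw [← sub_eq_zero]
  refine Submodule.disjoint_def.1 (isCompl_harmonics (formRep G L) (subG G L)).disjoint _
    (Submodule.sub_mem _ (E.harmonicTau_mem f) hh) ?_
  have := Ideal.sub_mem _ hf (E.tau_sub_harmonicTau_mem f)
  rwa [sub_sub_sub_cancel_left] at this

lemma harmonicTau_symAct (n : commonNormalizer G L) (f : SymmetricAlgebra K E.space) :
    E.harmonicTau G (symAct (E.repBar G) (quotientHom G L n) f)
      = symAct (formRep G L) n (E.harmonicTau G f) := by
  refine E.eq_harmonicTau (symAct_mem_harmonics n (E.harmonicTau_mem f)) ?_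
  rw [tau_symAct, ← map_sub]
  exact symAct_mem_coinvariantIdeal _ _ n _ (E.tau_sub_harmonicTau_mem f)

lemma harmonicTau_symMap_scaling (f : SymmetricAlgebra K E.space) :
    E.harmonicTau G (symMap E.scaling f)
      = symMap ((2 : K) • LinearMap.id) (E.harmonicTau G f) := by
  refine E.eq_harmonicTau (symMap_mem_harmonics (θ' := (2 : K)⁻¹ • LinearMap.id) ?_ ?_
    (fun g hg => ⟨g, hg, LinearMap.ext (formRep_comp_scaling g)⟩) (E.harmonicTau_mem f)) ?_
  · ext1 x
    simp
  · ext1 x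
    simp
  · rw [E.tau_symMap E.coe_scaling, ← map_sub]
    exact symMap_mem_coinvariantIdeal (fun g _ => formRep_comp_scaling g)
      (E.tau_sub_harmonicTau_mem f)

variable [FiniteDimensional K E.space] [Finite (Gbar G L)]

lemma eq_zero_of_harmonicTau_eq_zero (hinj : Function.Injective (E.coinvariantTau G))
    {f : SymmetricAlgebra K E.space} (hf : f ∈ harmonics (E.repBar G) (Gbar G L))
    (h0 : E.harmonicTau G f = 0) : f = 0 := by
  refine Submodule.disjoint_def.1 (isCompl_harmonics (E.repBar G) (Gbar G L)).disjoint f hf ?_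
  refine coinvariantMk_eq_zero.1 (hinj ?_)
  have h1 := E.tau_sub_harmonicTau_mem (G := G) f
  rw [h0, sub_zero] at h1
  rw [coinvariantTau_mk, map_zero]
  exact coinvariantMk_eq_zero.2 h1

lemma exists_harmonicTau_eq (hsurj : Function.Surjective (E.tauBar G))
    {h : SymmetricAlgebra K (Dual K V)} (hh : h ∈ harmonics (formRep G L) (subG G L))
    (hL : h ∈ invariantAlgebra (formRep G L) (subL G L)) :
    ∃ f ∈ harmonics (E.repBar G) (Gbar G L), E.harmonicTau G f = h := by
  obtain ⟨x, hx⟩ := hsurj ⟨coinvariantMk _ _ h, fun l hl => by rw [coinvariantAct_mk, hL l hl]⟩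
  obtain ⟨f, rfl⟩ := coinvariantMk_surjective x
  have h1 : E.tau f - h ∈ coinvariantIdeal (formRep G L) (subG G L) := by
    rw [← coinvariantMk_eq_zero, map_sub, sub_eq_zero]
    exact congrArg Subtype.val hx
  have h2 : f ∈ harmonics (E.repBar G) (Gbar G L)
      ⊔ (coinvariantIdeal (E.repBar G) (Gbar G L)).restrictScalars K :=
    (isCompl_harmonics (E.repBar G) (Gbar G L)).sup_eq_top ▸ Submodule.mem_top
  obtain ⟨f₀, hf₀, f₁, hf₁, rfl⟩ := Submodule.mem_sup.1 h2
  refine ⟨f₀, hf₀, E.eq_harmonicTau hh ?_⟩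
  have h3 : E.tau f₀ - h = E.tau (f₀ + f₁) - h - E.tau f₁ := by rw [map_add]; ring
  exact h3 ▸ Ideal.sub_mem _ h1 (E.tau_mem_coinvariantIdeal hf₁)

/-- The map `S̄ → ℋ` induces an isomorphism of the spaces of covariants which commutes with `γ` and
with the gradings, so that a homogeneous eigenbasis for `Ḡγ̄` is carried to one for `Gγ`. -/
lemma isJointEigenPairs_transfer [Finite (subL G L)] (hLG : subL G L ≤ subG G L)
    (hbij : Function.Bijective (E.tauBar G)) (γ : commonNormalizer G L)
    {M : Type*} [AddCommGroup M] [Module K M]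
    (ρ : Representation K (cosetGroup (Gbar G L) (quotientHom G L γ)) M) {p : Multiset (K × ℕ)}
    (hp : IsJointEigenPairs (harmonicCovariants (E.repBar G) (Gbar G L) (quotientHom G L γ) ρ)
      (covariantRep (E.repBar G) (Gbar G L) (quotientHom G L γ) ρ
        (cosetElt (Gbar G L) (quotientHom G L γ)))
      ((symMap E.scaling).toLinearMap.rTensor (Dual K M)) p) :
    IsJointEigenPairs (harmonicCovariants (formRep G L) (subG G L) γ
        (ρ.comp (cosetHom (quotientHom G L) (subG G L) γ)))
      (covariantRep (formRep G L) (subG G L) γ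
        (ρ.comp (cosetHom (quotientHom G L) (subG G L) γ)) (cosetElt (subG G L) γ))
      ((symMap ((2 : K) • LinearMap.id : Dual K V →ₗ[K] Dual K V)).toLinearMap.rTensor
        (Dual K M)) p := by
  have hinj : Function.Injective (E.coinvariantTau G) := fun x y h => hbij.1 (Subtype.ext h)
  obtain ⟨e, he⟩ := exists_harmonicCovariants_equiv (q := quotientHom G L) (γ := γ) (ρ := ρ) hLG
    (QuotientGroup.ker_mk' (subL G L)).ge E.harmonicTau_symAct (fun f _ => E.harmonicTau_mem f)
    (fun f hf => E.eq_zero_of_harmonicTau_eq_zero hinj hf)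
    (fun h hh hL => E.exists_harmonicTau_eq hbij.2 hh hL)
    (fun a f hf => symAct_mem_harmonics a hf) (fun b f hf => symAct_mem_harmonics b hf)
  exact isJointEigenPairs_of_rTensor (q := quotientHom G L) (G := subG G L) (γ := γ)
    (σ := formRep G L) (σ' := E.repBar G) (ρ := ρ) (J := E.harmonicTau G)
    (Θ := (symMap E.scaling).toLinearMap) e he E.harmonicTau_symAct
    (fun f => E.harmonicTau_symMap_scaling f) hp

end Harmonic

end EquivariantComplement

section Factors

variable {K : Type*} [Field K] [CharZero K] {X : Type*} [AddCommGroup X] [Module K X]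
  {A : Type*} [Group A] {σ : Representation K A X} {G : Subgroup A} {M : Type*} [AddCommGroup M]
  [Module K M] {γ : A} {ρ : Representation K (cosetGroup G γ) M} {p : Multiset (K × ℕ)}

lemma isFactorDegreePairs_iff_eq {𝒮 : ℕ → Submodule K (SymmetricAlgebra K X)}
    {Θ : End K (SymmetricAlgebra K X)} (h𝒮 : ∀ d, 𝒮 d = Θ.eigenspace ((2 : K) ^ d))
    (htop : ⨆ d, 𝒮 d = ⊤) (hp : IsJointEigenPairs (harmonicCovariants σ G γ ρ)
      (covariantRep σ G γ ρ (cosetElt G γ)) (Θ.rTensor (Dual K M)) p) (p' : Multiset (K × ℕ)) :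
    IsFactorDegreePairs σ 𝒮 G γ ρ p' ↔ p' = p := by
  rw [isFactorDegreePairs_iff h𝒮 htop]
  exact ⟨fun h => h.unique hp, fun h => h ▸ hp⟩

/-- The factors can be read off from an eigenbasis that is homogeneous for any grading. -/
lemma isMFactors_iff_eq {Θ : End K (SymmetricAlgebra K X)}
    (hp : IsJointEigenPairs (harmonicCovariants σ G γ ρ) (covariantRep σ G γ ρ (cosetElt G γ))
      (Θ.rTensor (Dual K M)) p)
    (hex : ∃ p₁, IsFactorDegreePairs σ (symDegree K X) G γ ρ p₁) (t : Multiset K) :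
    IsMFactors σ G γ ρ t ↔ t = p.map Prod.fst := by
  constructor
  · rintro ⟨p', hp', rfl⟩
    rw [isFactorDegreePairs_iff symDegree_eq_eigenspace iSup_symDegree] at hp'
    exact hp'.map_fst_unique hp
  · rintro rfl
    obtain ⟨p₁, hp₁⟩ := hex
    refine ⟨p₁, hp₁, ?_⟩
    rw [isFactorDegreePairs_iff symDegree_eq_eigenspace iSup_symDegree] at hp₁
    exact hp.map_fst_unique hp₁

end Factors

end ReflectionQuotient

theorem mainTheorem11 {K : Type*} [Field K] [IsAlgClosed K] [CharZero K]
    {V : Type*} [AddCommGroup V] [Module K V] [FiniteDimensional K V]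
    (G L : Subgroup (LinearMap.GeneralLinearGroup K V))
    (hG : IsReflectionGroup G) (hLG : L ≤ G) (hL : (L.subgroupOf G).Normal)
    (E : EquivariantComplement L) (hE : IsReflectionGroup (E.imageGL G)) :
    (∃ τbar : Coinvariants (E.repBar G) (Gbar G L) ≃ₐ[K]
        fixedCoinvariants (formRep G L) (subG G L) (subL G L),
      (∀ f : SymmetricAlgebra K E.space,
        (τbar (coinvariantMk (E.repBar G) (Gbar G L) f) :
            Coinvariants (formRep G L) (subG G L))
          = coinvariantMk (formRep G L) (subG G L) (E.tau f)) ∧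
      (∀ (d : ℕ) (x : Coinvariants (E.repBar G) (Gbar G L)),
        x ∈ coinvariantDegree (E.repBar G) E.degree (Gbar G L) d ↔
          (τbar x : Coinvariants (formRep G L) (subG G L)) ∈
            coinvariantDegree (formRep G L) (symDegree K (Module.Dual K V)) (subG G L) d) ∧
      (∀ (n : commonNormalizer G L) (x : Coinvariants (E.repBar G) (Gbar G L)),
        (τbar (coinvariantAct (E.repBar G) (Gbar G L) (quotientHom G L n) x) :
            Coinvariants (formRep G L) (subG G L))
          = coinvariantAct (formRep G L) (subG G L) n (τbar x))) ∧
    (∀ γ : commonNormalizer G L,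
      Module.End.IsSemisimple ((γ : LinearMap.GeneralLinearGroup K V) : V →ₗ[K] V) →
      ∀ (M : Type*) [AddCommGroup M] [Module K M] [FiniteDimensional K M]
        (ρ : Representation K (cosetGroup (Gbar G L) (quotientHom G L γ)) M),
        Module.End.IsSemisimple (ρ (cosetElt (Gbar G L) (quotientHom G L γ))) →
        (∃ s : Multiset K, ∀ t : Multiset K,
          (IsMFactors (formRep G L) (subG G L) γ
            (ρ.comp (cosetHom (quotientHom G L) (subG G L) γ)) t ↔ t = s) ∧
          (IsMFactors (E.repBar G) (Gbar G L) (quotientHom G L γ) ρ t ↔ t = s)) ∧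
        (∃ p : Multiset (K × ℕ), ∀ q : Multiset (K × ℕ),
          (IsFactorDegreePairs (formRep G L) (symDegree K (Module.Dual K V)) (subG G L) γ
            (ρ.comp (cosetHom (quotientHom G L) (subG G L) γ)) q ↔ q = p) ∧
          (IsFactorDegreePairs (E.repBar G) E.degree (Gbar G L) (quotientHom G L γ) ρ q ↔
            q = p))) := by
  have hGfin : Finite G := hG.1
  have hfinG : Finite (subG G L) := Finite.of_injective
    (fun g : subG G L => (⟨_, g.2⟩ : G)) fun g g' h =>
      Subtype.ext (Subtype.ext (congrArg (Subtype.val : G → _) h))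
  have hLfin : Finite L := Finite.of_injective _ (Subgroup.inclusion_injective hLG)
  have hLG' : subL G L ≤ subG G L := fun l hl => hLG hl
  have hfinL : Finite (subL G L) := Finite.of_injective _ (Subgroup.inclusion_injective hLG')
  have hfinB : Finite (Gbar G L) := Set.Finite.image _ (Set.finite_coe_iff.1 hfinG)
  have hfd := E.finiteDimensional_space
  have hbij := E.tauBar_bijective (hLG.trans (le_commonNormalizer hLG hL)) hLG'
    (actsByReflections_of_dual hE)
  have hinj : Function.Injective (E.coinvariantTau G) := fun x y h => hbij.1 (Subtype.ext h)
  refine ⟨⟨AlgEquiv.ofBijective (E.tauBar G) hbij, fun f => rfl,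
    fun d x => E.mem_coinvariantDegree_iff hinj d x,
    fun n x => E.coe_tauBar_coinvariantAct n x⟩, ?_⟩
  intro γ hγ M _ _ _ ρ hρ
  obtain ⟨p, hp⟩ := E.exists_isJointEigenPairs_repBar γ hγ.iSup_eigenspace_eq_top ρ
    hρ.iSup_eigenspace_eq_top
  have hV := E.isJointEigenPairs_transfer hLG' hbij γ ρ hp
  exact ⟨⟨p.map Prod.fst, fun t => ⟨isMFactors_iff_eq hV
      ⟨p, (isFactorDegreePairs_iff symDegree_eq_eigenspace iSup_symDegree).2 hV⟩ t,
      isMFactors_iff_eq hp (E.exists_isFactorDegreePairs_repBar γ hγ.iSup_eigenspace_eq_top ρ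
        hρ.iSup_eigenspace_eq_top) t⟩⟩,
    ⟨p, fun q => ⟨isFactorDegreePairs_iff_eq symDegree_eq_eigenspace iSup_symDegree hV q,
      isFactorDegreePairs_iff_eq E.degree_eq_eigenspace E.iSup_degree hp q⟩⟩⟩
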